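/- Let $(M,g)$ be a smooth Riemannian manifold of dimension $n$ with Levi-Civita connection $\nabla$ and let $f\in C^\infty(M)$, $f>0$. All indices run over $1,\dots,n$ and repeated indices are summed. Let $(U,x^i)$ be a chart of $M$, with coordinate vector fields $\partial_i=\partial/\partial x^i$, components $g_{ij}$, inverse matrix $g^{ij}$ and Christoffel symbols $\Gamma_{ij}^h$, and let $(x^i,p_i)$ be the induced coordinates on $\pi^{-1}(U)\subset T^*M$, where $p=p_i\,dx^i$. Put $f_i=\partial_i f$, $p^i=g^{it}p_t$, $\alpha=1+g^{ij}p_ip_j$, $$R(X,Y)=[\nabla_X,\nabla_Y]-\nabla_{[X,Y]},\qquad R(\partial_i,\partial_j)\partial_l=R_{ijl}{}^{s}\partial_s,$$ $$S_{ij}{}^{l\,a}=g^{lm}R_{ijm}{}^{a},\qquad Q^{k}{}_{j}{}^{i\,s}=g^{kt}g^{im}R_{tjm}{}^{s},\qquad A_{ji}^{h}=\frac1{2f}\left(f_j\delta_i^h+f_i\delta_j^h-g^{hm}f_m\,g_{ji}\right).$$ Here $\nabla_l R_{ijm}{}^{t}$, $\nabla_lQ^{k}{}_{j}{}^{i\,s}$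 and $\nabla_lA_{ij}^m$ denote the components of the covariant derivatives of these tensor fields. The adapted frame on $\pi^{-1}(U)$ is $$E_j=\frac{\partial}{\partial x^j}+p_a\Gamma^a_{hj}\frac{\partial}{\partial p_h},\qquad E_{\bar j}=\frac{\partial}{\partial p_j}$$ (the horizontal lift of $\partial_j$ and the vertical lift of $dx^j$). Let ${}^{CG}g_f$ be the rescaled Riemannian metric of Cheeger--Gromoll type on $T^*M$, i.e. $${}^{CG}g_f(E_i,E_j)=f\,g_{ij},\qquad {}^{CG}g_f(E_{\bar i},E_j)=0,\qquad {}^{CG}g_f(E_{\bar i},E_{\bar j})=\frac1\alpha\left(g^{ij}+p^ip^j\right),$$ let $\widetilde\nabla$ be its Levi-Civita connection and $\widetilde R(X,Y)Z=\widetilde\nabla_X\widetilde\nabla_YZ-\widetilde\nabla_Y\widetilde\nabla_XZ-\widetilde\nabla_{[X,Y]}Z$ its curvature tensor. Then at every point of $\pi^{-1}(U)$ and for all $l,i,j$: \begin{align*} \widetilde R(E_l,E_i)E_j={}&\Big\{R_{lij}{}^{m}-\tfrac{1}{2f\alpha}p_tp_aR_{lih}{}^{a}Q^{m}{}_{j}{}^{h\,t}+\tfrac1{4f\alpha}p_tp_a\big(Q^{m}{}_{l}{}^{h\,t}R_{ijh}{}^{a}-Q^{m}{}_{i}{}^{h\,t}R_{ljh}{}^{a}\big)\\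 &\ +\nabla_lA_{ij}^m-\nabla_iA_{lj}^m+A_{lh}^mA_{ij}^h-A_{ih}^mA_{lj}^h\Big\}E_m\\ &+\Big\{\tfrac12p_t\big(\nabla_lR_{ijm}{}^{t}-\nabla_iR_{ljm}{}^{t}\big)+\tfrac12p_t\big(R_{lhm}{}^{t}A_{ij}^h-R_{ihm}{}^{t}A_{lj}^h\big)\Big\}E_{\bar m},\\ \widetilde R(E_{\bar l},E_i)E_j={}&\Big\{-\tfrac1{2f\alpha}p_a\nabla_iQ^{m}{}_{j}{}^{l\,a}+\tfrac1{2f\alpha}p_a\big(Q^{m}{}_{h}{}^{l\,a}A_{ij}^h-Q^{h}{}_{j}{}^{l\,a}A_{ih}^m+\tfrac{f_i}{f}Q^{m}{}_{j}{}^{l\,a}\big)\Big\}E_m\\ &+\Big\{\tfrac12R_{ijm}{}^{l}-\tfrac1{4f\alpha}p_tp_aR_{ihm}{}^{t}Q^{h}{}_{j}{}^{l\,a}-\tfrac1{2\alpha}p_ap^lR_{ijm}{}^{a}+\tfrac{\alpha+1}{2\alpha^2}p_ap_mS_{ij}{}^{l\,a}\Big\}E_{\bar m},\\ \widetilde R(E_l,E_{\bar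 i})E_j={}&\Big\{\tfrac1{2f\alpha}p_a\nabla_lQ^{m}{}_{j}{}^{i\,a}+\tfrac1{2f\alpha}p_a\big(Q^{h}{}_{j}{}^{i\,a}A_{lh}^m-Q^{m}{}_{h}{}^{i\,a}A_{lj}^h-\tfrac{f_l}{f}Q^{m}{}_{j}{}^{i\,a}\big)\Big\}E_m\\ &+\Big\{-\tfrac12R_{ljm}{}^{i}+\tfrac1{4f\alpha}p_tp_aR_{lhm}{}^{a}Q^{h}{}_{j}{}^{i\,t}+\tfrac1{2\alpha}p_ap^iR_{ljm}{}^{a}-\tfrac{\alpha+1}{2\alpha^2}p_ap_mS_{lj}{}^{i\,a}\Big\}E_{\bar m},\\ \widetilde R(E_{\bar l},E_{\bar i})E_j={}&\Big\{\tfrac1{4f^2\alpha^2}p_tp_a\big(Q^{m}{}_{h}{}^{l\,a}Q^{h}{}_{j}{}^{i\,t}-Q^{m}{}_{h}{}^{i\,a}Q^{h}{}_{j}{}^{l\,t}\big)+\tfrac1{f\alpha}Q^{m}{}_{j}{}^{i\,l}+\tfrac1{f\alpha^2}p_a\big(p^iQ^{m}{}_{j}{}^{l\,a}-p^lQ^{m}{}_{j}{}^{i\,a}\big)\Big\}E_m,\\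 \widetilde R(E_l,E_i)E_{\bar j}={}&\Big\{\tfrac1{2f\alpha}p_a\big(\nabla_lQ^{m}{}_{i}{}^{j\,a}-\nabla_iQ^{m}{}_{l}{}^{j\,a}\big)+\tfrac1{2f\alpha}p_a\big(Q^{h}{}_{i}{}^{j\,a}A_{lh}^m-Q^{h}{}_{l}{}^{j\,a}A_{ih}^m-\tfrac{f_l}fQ^{m}{}_{i}{}^{j\,a}+\tfrac{f_i}fQ^{m}{}_{l}{}^{j\,a}\big)\Big\}E_m\\ &+\Big\{R_{ilm}{}^{j}+\tfrac1{4f\alpha}p_tp_a\big(R_{lhm}{}^{t}Q^{h}{}_{i}{}^{j\,a}-R_{ihm}{}^{a}Q^{h}{}_{l}{}^{j\,t}\big)+\tfrac1\alpha p_ap^jR_{lim}{}^{a}-\tfrac{\alpha+1}{\alpha^2}p_ap_mS_{li}{}^{j\,a}\Big\}E_{\bar m},\\ \widetilde R(E_{\bar l},E_i)E_{\bar j}={}&\Big\{\tfrac1{2f\alpha}Q^{m}{}_{i}{}^{j\,l}+\tfrac1{2f\alpha^2}p_a\big(p^jQ^{m}{}_{i}{}^{l\,a}-p^lQ^{m}{}_{i}{}^{j\,a}\big)+\tfrac1{4f^2\alpha^2}p_ap_tQ^{m}{}_{h}{}^{l\,a}Q^{h}{}_{i}{}^{j\,t}\Big\}E_m,\\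 \widetilde R(E_l,E_{\bar i})E_{\bar j}={}&\Big\{-\tfrac1{2f\alpha}Q^{m}{}_{l}{}^{j\,i}+\tfrac1{2f\alpha^2}p_a\big(p^iQ^{m}{}_{l}{}^{j\,a}-p^jQ^{m}{}_{l}{}^{i\,a}\big)-\tfrac1{4f^2\alpha^2}p_ap_tQ^{m}{}_{h}{}^{i\,a}Q^{h}{}_{l}{}^{j\,t}\Big\}E_m,\\ \widetilde R(E_{\bar l},E_{\bar i})E_{\bar j}={}&\Big\{\tfrac{\alpha^2+\alpha+1}{\alpha^3}\big(g^{ij}\delta_m^l-g^{jl}\delta_m^i\big)+\tfrac{\alpha+2}{\alpha^3}\big(g^{lj}p^ip_m-g^{ij}p^lp_m\big)+\tfrac{\alpha-1}{\alpha^3}\big(\delta_m^ip^lp^j-\delta_m^lp^ip^j\big)\Big\}E_{\bar m}. \end{align*} -/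

import Mathlib

open scoped Manifold ContDiff

noncomputable section

namespace CheegerGromoll

/-! ### Riemannian geometry in a coordinate domain

A metric is given by its matrix of components, a vector field by its tuple of components. -/

section Coordinates

variable {ι : Type*} [Fintype ι] [DecidableEq ι]

/-- The partial derivative `∂F/∂x^k`. -/
def pd (k : ι) (F : (ι → ℝ) → ℝ) (x : ι → ℝ) : ℝ :=
  fderiv ℝ F x (Pi.single k 1)

/-- The Christoffel symbol `Γ_{ij}^h` of the Levi-Civita connection of `G`. -/
def christoffel (G : (ι → ℝ) → Matrix ι ι ℝ) (i j h : ι) (x : ι → ℝ) : ℝ :=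
  1 / 2 * ∑ l, (G x)⁻¹ h l *
    (pd i (fun y => G y l j) x + pd j (fun y => G y i l) x - pd l (fun y => G y i j) x)

/-- The Levi-Civita connection `∇_X Y` of `G` on vector fields:
`(∇_X Y)^c = X^a ∂_a Y^c + Γ_{ab}^c X^a Y^b`. -/
def nabla (G : (ι → ℝ) → Matrix ι ι ℝ) (X Y : (ι → ℝ) → (ι → ℝ)) : (ι → ℝ) → (ι → ℝ) :=
  fun x c => (∑ a, X x a * pd a (fun y => Y y c) x)
    + ∑ a, ∑ b, christoffel G a b c x * X x a * Y x b

/-- The Riemann curvature `R(X,Y)Z = ∇_X ∇_Y Z - ∇_Y ∇_X Z - ∇_{[X,Y]} Z` of `G`. -/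
def curvature (G : (ι → ℝ) → Matrix ι ι ℝ) (X Y Z : (ι → ℝ) → (ι → ℝ)) :
    (ι → ℝ) → (ι → ℝ) :=
  nabla G X (nabla G Y Z) - nabla G Y (nabla G X Z) - nabla G (VectorField.lieBracket ℝ X Y) Z

/-- The coordinate vector field `∂/∂x^i`. -/
def coordField (i : ι) : (ι → ℝ) → (ι → ℝ) := fun _ => Pi.single i 1

/-- The component `R_{ijl}^s` of the curvature tensor:
`R(∂_i, ∂_j) ∂_l = R_{ijl}^s ∂_s`. -/
def riem (G : (ι → ℝ) → Matrix ι ι ℝ) (i j l s : ι) (x : ι → ℝ) : ℝ :=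
  curvature G (coordField i) (coordField j) (coordField l) x s

/-- The components `∇_l T^{u_1 … u_r}_{d_1 … d_q}` of the covariant derivative of a tensor field
of type `(r,q)`; the upper indices of `T` are listed in `u` and the lower ones in `d`. -/
def nablaTensor {r q : ℕ} (G : (ι → ℝ) → Matrix ι ι ℝ)
    (T : (Fin r → ι) → (Fin q → ι) → (ι → ℝ) → ℝ)
    (l : ι) (u : Fin r → ι) (d : Fin q → ι) (x : ι → ℝ) : ℝ :=
  pd l (T u d) x
    + (∑ k, ∑ h, christoffel G l h (u k) x * T (Function.update u k h) d x)
    - ∑ k, ∑ h, christoffel G l (d k) h x * T u (Function.update d k h) x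

/-- `R_{ij.}^{l a} = g^{lm} R_{ijm}^a` -/
def riemUp (G : (ι → ℝ) → Matrix ι ι ℝ) (i j l a : ι) (x : ι → ℝ) : ℝ :=
  ∑ m, (G x)⁻¹ l m * riem G i j m a x

/-- `R_.^k_{j.}^{i s} = g^{kt} g^{im} R_{tjm}^s` -/
def riemUpUp (G : (ι → ℝ) → Matrix ι ι ℝ) (k j i s : ι) (x : ι → ℝ) : ℝ :=
  ∑ t, ∑ m, (G x)⁻¹ k t * (G x)⁻¹ i m * riem G t j m s x

/-- The tensor field `A_{ji}^h = 1/(2f) (f_j δ_i^h + f_i δ_j^h - g^{hm} f_m g_{ji})`,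
where `f_j = ∂_j f`. -/
def tensorA (G : (ι → ℝ) → Matrix ι ι ℝ) (f : (ι → ℝ) → ℝ) (j i h : ι) (x : ι → ℝ) : ℝ :=
  1 / (2 * f x) * (pd j f x * (if i = h then 1 else 0) + pd i f x * (if j = h then 1 else 0)
    - (∑ m, (G x)⁻¹ h m * pd m f x) * G x j i)

/-- `∇_l R_{ijm}^t` -/
def nablaRiem (G : (ι → ℝ) → Matrix ι ι ℝ) (l i j m t : ι) (x : ι → ℝ) : ℝ :=
  nablaTensor G (fun (u : Fin 1 → ι) (d : Fin 3 → ι) => riem G (d 0) (d 1) (d 2) (u 0))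
    l ![t] ![i, j, m] x

/-- `∇_l R_.^k_{j.}^{i s}` -/
def nablaRiemUpUp (G : (ι → ℝ) → Matrix ι ι ℝ) (l k j i s : ι) (x : ι → ℝ) : ℝ :=
  nablaTensor G (fun (u : Fin 3 → ι) (d : Fin 1 → ι) => riemUpUp G (u 0) (d 0) (u 1) (u 2))
    l ![k, i, s] ![j] x

/-- `∇_l A_{ij}^m` -/
def nablaA (G : (ι → ℝ) → Matrix ι ι ℝ) (f : (ι → ℝ) → ℝ) (l i j m : ι) (x : ι → ℝ) : ℝ :=
  nablaTensor G (fun (u : Fin 1 → ι) (d : Fin 2 → ι) => tensorA G f (d 0) (d 1) (u 0))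
    l ![m] ![i, j] x

end Coordinates

/-! ### The cotangent bundle in induced coordinates

Over a coordinate domain with coordinates `x^i`, the induced coordinates on the cotangent bundle
are `(x^i, p_i)`; a point is a tuple indexed by `Fin n ⊕ Fin n`. Below `g` is the matrix of
components of the metric of the base and `f` the coordinate expression of the rescaling function. -/

section Cotangent

variable {n : ℕ}

/-- The coordinates `x^i` of the base point. -/
def basePt (z : Fin n ⊕ Fin n → ℝ) : Fin n → ℝ := fun i => z (Sum.inl i)

/-- The components `p_i` of the covector. -/
def covec (z : Fin n ⊕ Fin n → ℝ) : Fin n → ℝ := fun i => z (Sum.inr i)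

/-- `g⁻¹(ξ, θ) = g^{ij} ξ_i θ_j` -/
def coInner (g : (Fin n → ℝ) → Matrix (Fin n) (Fin n) ℝ) (x ξ θ : Fin n → ℝ) : ℝ :=
  ∑ i, ∑ j, (g x)⁻¹ i j * ξ i * θ j

/-- `p^i = g^{it} p_t` -/
def covecUp (g : (Fin n → ℝ) → Matrix (Fin n) (Fin n) ℝ) (z : Fin n ⊕ Fin n → ℝ) (i : Fin n) : ℝ :=
  ∑ t, (g (basePt z))⁻¹ i t * covec z t

/-- `α = 1 + g⁻¹(p, p)` -/
def alpha (g : (Fin n → ℝ) → Matrix (Fin n) (Fin n) ℝ) (z : Fin n ⊕ Fin n → ℝ) : ℝ :=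
  1 + coInner g (basePt z) (covec z) (covec z)

/-- The vertical lift `ξ_i ∂/∂p_i` of the one-form `ξ`. -/
def verticalLift (ξ : (Fin n → ℝ) → (Fin n → ℝ)) (z : Fin n ⊕ Fin n → ℝ) : Fin n ⊕ Fin n → ℝ :=
  Sum.elim 0 (ξ (basePt z))

/-- The horizontal lift `X^i ∂/∂x^i + p_h Γ_{ij}^h X^j ∂/∂p_i` of the vector field `X`. -/
def horizontalLift (g : (Fin n → ℝ) → Matrix (Fin n) (Fin n) ℝ) (X : (Fin n → ℝ) → (Fin n → ℝ))
    (z : Fin n ⊕ Fin n → ℝ) : Fin n ⊕ Fin n → ℝ :=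
  Sum.elim (X (basePt z))
    (fun i => ∑ h, ∑ j, covec z h * christoffel g i j h (basePt z) * X (basePt z) j)

/-- `E_j`, the horizontal lift of `∂/∂x^j`. -/
def frameH (g : (Fin n → ℝ) → Matrix (Fin n) (Fin n) ℝ) (j : Fin n) :
    (Fin n ⊕ Fin n → ℝ) → (Fin n ⊕ Fin n → ℝ) :=
  horizontalLift g (coordField j)

/-- `E_{j̄}`, the vertical lift of `dx^j`. -/
def frameV (j : Fin n) : (Fin n ⊕ Fin n → ℝ) → (Fin n ⊕ Fin n → ℝ) :=
  verticalLift (fun _ => Pi.single j 1)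

/-- The horizontal part of a tangent vector at `z`, as a tangent vector of the base:
its projection. -/
def horPart (ξ : Fin n ⊕ Fin n → ℝ) : Fin n → ℝ := fun i => ξ (Sum.inl i)

/-- The vertical part of a tangent vector at `z`, as a covector of the base:
`dp_i - p_h Γ_{ij}^h dx^j`. -/
def verPart (g : (Fin n → ℝ) → Matrix (Fin n) (Fin n) ℝ) (z ξ : Fin n ⊕ Fin n → ℝ) : Fin n → ℝ :=
  fun i => ξ (Sum.inr i)
    - ∑ h, ∑ j, covec z h * christoffel g i j h (basePt z) * ξ (Sum.inl j)

/-- The rescaled metric of Cheeger-Gromoll type at the point `z` of the cotangent bundle: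
`f g` on horizontal vectors, `(1/α) (g⁻¹(ξ, θ) + g⁻¹(ξ, p) g⁻¹(θ, p))` on the vertical lifts
of covectors `ξ`, `θ`, with horizontal and vertical vectors orthogonal. -/
def cgForm (g : (Fin n → ℝ) → Matrix (Fin n) (Fin n) ℝ) (f : (Fin n → ℝ) → ℝ)
    (z v w : Fin n ⊕ Fin n → ℝ) : ℝ :=
  f (basePt z) * (∑ i, ∑ j, g (basePt z) i j * horPart v i * horPart w j)
    + 1 / alpha g z *
      (coInner g (basePt z) (verPart g z v) (verPart g z w)
        + coInner g (basePt z) (verPart g z v) (covec z)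
          * coInner g (basePt z) (verPart g z w) (covec z))

/-- The matrix of components of the rescaled metric in the natural frame `∂/∂x^i, ∂/∂p_i`. -/
def cgMetric (g : (Fin n → ℝ) → Matrix (Fin n) (Fin n) ℝ) (f : (Fin n → ℝ) → ℝ)
    (z : Fin n ⊕ Fin n → ℝ) : Matrix (Fin n ⊕ Fin n) (Fin n ⊕ Fin n) ℝ :=
  Matrix.of fun a b => cgForm g f z (Pi.single a 1) (Pi.single b 1)

theorem verPart_verticalLift (g : (Fin n → ℝ) → Matrix (Fin n) (Fin n) ℝ)
    (ξ : (Fin n → ℝ) → (Fin n → ℝ)) (z : Fin n ⊕ Fin n → ℝ) :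
    verPart g z (verticalLift ξ z) = ξ (basePt z) := by
  funext i; simp [verPart, verticalLift]

theorem verPart_horizontalLift (g : (Fin n → ℝ) → Matrix (Fin n) (Fin n) ℝ)
    (X : (Fin n → ℝ) → (Fin n → ℝ)) (z : Fin n ⊕ Fin n → ℝ) :
    verPart g z (horizontalLift g X z) = 0 := by
  funext i; simp [verPart, horizontalLift]

/-- The first defining equation of the metric. -/
theorem cgForm_vertical_vertical (g : (Fin n → ℝ) → Matrix (Fin n) (Fin n) ℝ)
    (f : (Fin n → ℝ) → ℝ) (ξ θ : (Fin n → ℝ) → (Fin n → ℝ)) (z : Fin n ⊕ Fin n → ℝ) :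
    cgForm g f z (verticalLift ξ z) (verticalLift θ z) =
      1 / alpha g z * (coInner g (basePt z) (ξ (basePt z)) (θ (basePt z))
        + coInner g (basePt z) (ξ (basePt z)) (covec z)
          * coInner g (basePt z) (θ (basePt z)) (covec z)) := by
  simp only [cgForm, verPart_verticalLift]
  simp [horPart, verticalLift]

/-- The second defining equation of the metric. -/
theorem cgForm_vertical_horizontal (g : (Fin n → ℝ) → Matrix (Fin n) (Fin n) ℝ)
    (f : (Fin n → ℝ) → ℝ) (ξ Y : (Fin n → ℝ) → (Fin n → ℝ)) (z : Fin n ⊕ Fin n → ℝ) :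
    cgForm g f z (verticalLift ξ z) (horizontalLift g Y z) = 0 := by
  simp only [cgForm, verPart_horizontalLift]
  simp [horPart, verticalLift, coInner]

/-- The third defining equation of the metric. -/
theorem cgForm_horizontal_horizontal (g : (Fin n → ℝ) → Matrix (Fin n) (Fin n) ℝ)
    (f : (Fin n → ℝ) → ℝ) (X Y : (Fin n → ℝ) → (Fin n → ℝ)) (z : Fin n ⊕ Fin n → ℝ) :
    cgForm g f z (horizontalLift g X z) (horizontalLift g Y z) =
      f (basePt z) * ∑ i, ∑ j, g (basePt z) i j * X (basePt z) i * Y (basePt z) j := by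
  simp only [cgForm, verPart_horizontalLift]
  simp [horPart, horizontalLift, coInner]

end Cotangent

/-! ### Charts of a Riemannian manifold -/

section Manifold

variable {n : ℕ} {M : Type*} [TopologicalSpace M] [ChartedSpace (EuclideanSpace ℝ (Fin n)) M]

/-- The coordinate vector `∂/∂x^i` at the point `x` of the domain of the chart `e`. -/
def coordVec (e : OpenPartialHomeomorph M (EuclideanSpace ℝ (Fin n))) (x : M) (i : Fin n) :
    TangentSpace (𝓡 n) x :=
  mfderiv (𝓡 n) (𝓡 n) e.symm (e x) (EuclideanSpace.single i (1 : ℝ))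

/-- The components `g_{ij}` of a Riemannian metric, as functions of the coordinates of a chart. -/
def metricInChart [IsManifold (𝓡 n) ∞ M]
    (g : Bundle.ContMDiffRiemannianMetric (𝓡 n) ∞ (EuclideanSpace ℝ (Fin n))
      (fun x : M => TangentSpace (𝓡 n) x))
    (e : OpenPartialHomeomorph M (EuclideanSpace ℝ (Fin n))) (u : Fin n → ℝ) :
    Matrix (Fin n) (Fin n) ℝ :=
  Matrix.of fun i j => g.inner (e.symm (WithLp.toLp 2 u))
    (coordVec e (e.symm (WithLp.toLp 2 u)) i) (coordVec e (e.symm (WithLp.toLp 2 u)) j)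

/-- The coordinate expression of a function in a chart. -/
def funInChart (f : M → ℝ) (e : OpenPartialHomeomorph M (EuclideanSpace ℝ (Fin n)))
    (u : Fin n → ℝ) : ℝ :=
  f (e.symm (WithLp.toLp 2 u))

variable (n M) in
/-- The cotangent bundle of `M`. -/
abbrev CotangentBundle : Type _ :=
  Bundle.TotalSpace (EuclideanSpace ℝ (Fin n) →L[ℝ] ℝ)
    (fun x : M => TangentSpace (𝓡 n) x →L[ℝ] ℝ)

/-- The induced coordinates `(x^i, p_i)` of a point of the cotangent bundle over the domain of
the chart `e`. -/
def inducedCoord (e : OpenPartialHomeomorph M (EuclideanSpace ℝ (Fin n)))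
    (P : CotangentBundle n M) : Fin n ⊕ Fin n → ℝ :=
  Sum.elim (fun i => e P.proj i) (fun i => P.snd (coordVec e P.proj i))

end Manifold

end CheegerGromoll

end

/-! The statement is local, so a chart reduces it to a computation on an open subset of ℝ^n × ℝ^n,
with the metric given by a matrix function γ and the rescaling by a function φ.

The connection of the total space is found in the adapted frame, not in natural coordinates.
`frameCoeff` writes down candidate coefficients: Γ + A for two horizontal fields, where A accounts
for the conformal change from g to fg; the term p R / 2 and its adjoint p Q / (2fα) mixing
horizontal and vertical directions; the dual connection -Γ on vertical fields; and `vertCoeff` along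
the fibres. The candidates are certified by `IsMetricOn.nabla_frame`: a torsion-free metric
connection is unique, because the difference tensor is symmetric in one pair of slots and skew in
another. Torsion is checked in `frameCoeff_torsion`, whose main content is that [E_i, E_j] is
vertical with components p_a R_{ijm}^a; compatibility with the metric is checked in
`frameCoeff_metric`.

`curvature_frame` then expresses the curvature through the coefficients, their derivatives along the
frame and the bracket coefficients. Along E_l, contraction with p commutes with covariant
differentiation (`hasDirDerivAt_frameH_contract`) and α is constant, so each derivative of a
contracted tensor is a covariant derivative plus Christoffel terms, which cancel against those in
the coefficients and brackets. Along a vertical field, p_a has derivative δ and α has derivative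
2p^l. The terms f_l/f come from differentiating 1/(2fα).

Besides antisymmetry in the first pair of indices, the base curvature enters through its skewness in
the second pair (`riemUp_skew`), which gives p_a p^m R_{ijm}^a = 0 and removes the contractions
absent from the final formulas. Four of the eight formulas are computed directly (HHH, VHH, VHV, VVV
in the types of the arguments). HVH and HVV follow by antisymmetry, VVH and HHV by the first Bianchi
identity `IsMetricOn.curvature_cyclic` on the total space. -/

noncomputable section

namespace CheegerGromoll

/-! ### Smoothness and positivity of the metric components in a chart. -/

section ChartMetric

variable {n : ℕ} {M : Type*} [TopologicalSpace M]

/-- The image of the chart `e`, as a set of tuples of coordinates. -/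
def chartImage (e : OpenPartialHomeomorph M (EuclideanSpace ℝ (Fin n))) : Set (Fin n → ℝ) :=
  {u | WithLp.toLp 2 u ∈ e.target}

theorem isOpen_chartImage (e : OpenPartialHomeomorph M (EuclideanSpace ℝ (Fin n))) :
    IsOpen (chartImage e) :=
  e.open_target.preimage (PiLp.continuous_toLp 2 _)

variable [ChartedSpace (EuclideanSpace ℝ (Fin n)) M]

/-- `coordVec` differentiates at `e x`, which for `x = e.symm v` is `v`. All tangent spaces are
definitionally the model space, so the base point can be rewritten by `congrArg` with values there,
without transport. -/
theorem coordVec_symm (e : OpenPartialHomeomorph M (EuclideanSpace ℝ (Fin n)))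
    {v : EuclideanSpace ℝ (Fin n)} (hv : v ∈ e.target) (i : Fin n) :
    coordVec e (e.symm v) i =
      (mfderiv (𝓡 n) (𝓡 n) e.symm v (EuclideanSpace.single i (1 : ℝ)) :
        TangentSpace (𝓡 n) (e.symm v)) :=
  congrArg (fun w => (mfderiv (𝓡 n) (𝓡 n) e.symm w (EuclideanSpace.single i (1 : ℝ)) :
    EuclideanSpace ℝ (Fin n))) (e.right_inv hv)

theorem contDiffOn_funInChart {f : M → ℝ} (hf : ContMDiff (𝓡 n) 𝓘(ℝ, ℝ) ∞ f)
    {e : OpenPartialHomeomorph M (EuclideanSpace ℝ (Fin n))}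
    (he : e ∈ IsManifold.maximalAtlas (𝓡 n) ∞ M) :
    ContDiffOn ℝ ∞ (funInChart f e) (chartImage e) :=
  (contMDiffOn_iff_contDiffOn.1
    (hf.comp_contMDiffOn (contMDiffOn_symm_of_mem_maximalAtlas he))).comp
    (PiLp.contDiff_toLp (p := 2)).contDiffOn (fun _ hu => hu)

variable [IsManifold (𝓡 n) ∞ M]

/-- The coordinate field is the image of a constant field under the tangent map of the smooth map
`e.symm`. -/
theorem contMDiffOn_coordVec {e : OpenPartialHomeomorph M (EuclideanSpace ℝ (Fin n))}
    (he : e ∈ IsManifold.maximalAtlas (𝓡 n) ∞ M) (i : Fin n) :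
    ContMDiffOn (𝓡 n) (𝓡 n).tangent ∞
      (fun v => (⟨e.symm v, coordVec e (e.symm v) i⟩ : TangentBundle (𝓡 n) M)) e.target := by
  have h1 := (contMDiffOn_symm_of_mem_maximalAtlas he).contMDiffOn_tangentMapWithin
    (m := ∞) (by simp) e.open_target.uniqueMDiffOn
  have h2 : ContMDiff (𝓡 n) (𝓡 n).tangent ∞ (fun v : EuclideanSpace ℝ (Fin n) =>
      (⟨v, EuclideanSpace.single i (1 : ℝ)⟩ : TangentBundle (𝓡 n) (EuclideanSpace ℝ (Fin n)))) := by
    exact (contMDiff_vectorSpace_iff_contDiff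
      (V := fun _ => EuclideanSpace.single i (1 : ℝ))).2 contDiff_const
  refine (h1.comp h2.contMDiffOn (fun v hv => hv)).congr fun v hv => ?_
  simp only [Function.comp, tangentMapWithin]
  rw [mfderivWithin_of_isOpen e.open_target hv, coordVec_symm e hv]

theorem contDiffOn_metricInChart
    (g : Bundle.ContMDiffRiemannianMetric (𝓡 n) ∞ (EuclideanSpace ℝ (Fin n))
      (fun x : M => TangentSpace (𝓡 n) x))
    {e : OpenPartialHomeomorph M (EuclideanSpace ℝ (Fin n))}
    (he : e ∈ IsManifold.maximalAtlas (𝓡 n) ∞ M) (i j : Fin n) :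
    ContDiffOn ℝ ∞ (fun u => metricInChart g e u i j) (chartImage e) := by
  have hg := g.contMDiff.comp_contMDiffOn (contMDiffOn_symm_of_mem_maximalAtlas he)
  have h := hg.clm_bundle_apply₂ (F₁ := EuclideanSpace ℝ (Fin n))
    (F₂ := EuclideanSpace ℝ (Fin n)) (E₃ := Bundle.Trivial M ℝ)
    (contMDiffOn_coordVec he i) (contMDiffOn_coordVec he j)
  have h' : ContMDiffOn (𝓡 n) 𝓘(ℝ, ℝ) ∞ (fun v => g.inner (e.symm v)
      (coordVec e (e.symm v) i) (coordVec e (e.symm v) j)) e.target := fun v hv =>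
    (Bundle.contMDiffWithinAt_totalSpace.1 (h v hv)).2
  exact (contMDiffOn_iff_contDiffOn.1 h').comp
    (PiLp.contDiff_toLp (p := 2)).contDiffOn (fun u hu => hu)

theorem bilin_sum_smul {ι E : Type*} [Fintype ι] [AddCommGroup E] [Module ℝ E]
    [TopologicalSpace E] [IsTopologicalAddGroup E] [ContinuousConstSMul ℝ E]
    (B : E →L[ℝ] E →L[ℝ] ℝ) (w : ι → ℝ) (v : ι → E) :
    B (∑ i, w i • v i) (∑ i, w i • v i) = ∑ i, ∑ j, w i * (w j * B (v i) (v j)) := by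
  rw [map_sum]
  simp only [map_sum, map_smul, sum_apply, smul_apply, smul_eq_mul, Finset.mul_sum]
  exact Finset.sum_comm.trans
    (Finset.sum_congr rfl fun _ _ => Finset.sum_congr rfl fun _ _ => by ring)

theorem posDef_metricInChart
    (g : Bundle.ContMDiffRiemannianMetric (𝓡 n) ∞ (EuclideanSpace ℝ (Fin n))
      (fun x : M => TangentSpace (𝓡 n) x))
    {e : OpenPartialHomeomorph M (EuclideanSpace ℝ (Fin n))}
    (he : e ∈ IsManifold.maximalAtlas (𝓡 n) ∞ M) {u : Fin n → ℝ} (hu : u ∈ chartImage e) :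
    (metricInChart g e u).PosDef := by
  -- The quadratic form of the component matrix at w is g evaluated on the image of w under the
  -- differential of `e.symm`, and that differential is injective.
  have key : ∀ w : Fin n → ℝ, ∑ i, w i • coordVec e (e.symm (WithLp.toLp 2 u)) i =
      mfderiv (𝓡 n) (𝓡 n) e.symm (WithLp.toLp 2 u) (WithLp.toLp 2 w) := by
    intro w
    have hw : WithLp.toLp 2 w = ∑ i, w i • EuclideanSpace.single i (1 : ℝ) := by
      ext k; simp [Finset.sum_apply, Pi.single_apply]
    rw [hw]
    simp only [coordVec_symm e hu]
    refine Eq.symm ((map_sum (mfderiv (𝓡 n) (𝓡 n) e.symm (WithLp.toLp 2 u)) _ _).trans ?_)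
    exact Finset.sum_congr rfl fun k _ => map_smul _ _ _
  refine Matrix.PosDef.of_dotProduct_mulVec_pos ?_ fun w hw => ?_
  · ext i j
    simp [metricInChart, g.symm]
  have hinj : mfderiv (𝓡 n) (𝓡 n) e.symm (WithLp.toLp 2 u) (WithLp.toLp 2 w) ≠ 0 := by
    have hd : e.MDifferentiable (𝓡 n) (𝓡 n) :=
      ⟨(contMDiffOn_of_mem_maximalAtlas he).mdifferentiableOn (by simp),
        (contMDiffOn_symm_of_mem_maximalAtlas he).mdifferentiableOn (by simp)⟩
    refine (map_ne_zero_iff _ (hd.symm.mfderiv_injective hu)).2 fun h => hw ?_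
    exact congrArg WithLp.ofLp h
  have hpos := g.pos _ _ hinj
  rw [← key] at hpos
  refine (hpos.trans_eq (bilin_sum_smul _ _ _)).trans_eq ?_
  simp only [dotProduct, Matrix.mulVec, Finset.mul_sum, metricInChart, Matrix.of_apply,
    Pi.star_apply, star_trivial]
  refine Finset.sum_congr rfl fun a _ => Finset.sum_congr rfl fun b _ => ?_
  ring

end ChartMetric

/-! ### A calculus of directional derivatives that carries differentiability along. -/

section DirDeriv

variable {E : Type*} [NormedAddCommGroup E] [NormedSpace ℝ E] {F F₁ F₂ : E → ℝ}
  {d d₁ d₂ : ℝ} {v z : E}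

/-- The function `F` is differentiable at `z`, with derivative `d` in the direction `v`. -/
def HasDirDerivAt (F : E → ℝ) (d : ℝ) (v z : E) : Prop :=
  DifferentiableAt ℝ F z ∧ fderiv ℝ F z v = d

theorem DifferentiableAt.hasDirDerivAt (h : DifferentiableAt ℝ F z) (v : E) :
    HasDirDerivAt F (fderiv ℝ F z v) v z := ⟨h, rfl⟩

namespace HasDirDerivAt

theorem fderiv_eq (h : HasDirDerivAt F d v z) : fderiv ℝ F z v = d := h.2

theorem const (c : ℝ) (v z : E) : HasDirDerivAt (fun _ => c) 0 v z :=
  ⟨differentiableAt_const c, by simp⟩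

theorem congr_deriv (h : HasDirDerivAt F d₁ v z) (hd : d₁ = d₂) : HasDirDerivAt F d₂ v z :=
  hd ▸ h

theorem congr_of_eventuallyEq (h : HasDirDerivAt F₁ d v z) (he : F₂ =ᶠ[nhds z] F₁) :
    HasDirDerivAt F₂ d v z :=
  ⟨h.1.congr_of_eventuallyEq he, by rw [he.fderiv_eq]; exact h.2⟩

theorem add (h₁ : HasDirDerivAt F₁ d₁ v z) (h₂ : HasDirDerivAt F₂ d₂ v z) :
    HasDirDerivAt (fun y => F₁ y + F₂ y) (d₁ + d₂) v z :=
  ⟨h₁.1.add h₂.1, by rw [fderiv_fun_add h₁.1 h₂.1, ← h₁.2, ← h₂.2]; rfl⟩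

theorem sub (h₁ : HasDirDerivAt F₁ d₁ v z) (h₂ : HasDirDerivAt F₂ d₂ v z) :
    HasDirDerivAt (fun y => F₁ y - F₂ y) (d₁ - d₂) v z :=
  ⟨h₁.1.sub h₂.1, by rw [fderiv_fun_sub h₁.1 h₂.1, ← h₁.2, ← h₂.2]; rfl⟩

theorem neg (h : HasDirDerivAt F d v z) : HasDirDerivAt (fun y => -F y) (-d) v z :=
  ⟨h.1.neg, by rw [fderiv_fun_neg, ← h.2]; rfl⟩

theorem mul (h₁ : HasDirDerivAt F₁ d₁ v z) (h₂ : HasDirDerivAt F₂ d₂ v z) :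
    HasDirDerivAt (fun y => F₁ y * F₂ y) (d₁ * F₂ z + F₁ z * d₂) v z :=
  ⟨h₁.1.mul h₂.1, by
    rw [fderiv_fun_mul h₁.1 h₂.1, ← h₁.2, ← h₂.2]
    simp only [add_apply, smul_apply, smul_eq_mul]
    ring⟩

theorem const_mul (c : ℝ) (h : HasDirDerivAt F d v z) :
    HasDirDerivAt (fun y => c * F y) (c * d) v z :=
  ((const c v z).mul h).congr_deriv (by ring)

theorem inv (h : HasDirDerivAt F d v z) (hz : F z ≠ 0) :
    HasDirDerivAt (fun y => (F y)⁻¹) (-d / F z ^ 2) v z :=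
  ⟨h.1.inv hz, by
    have e : (fun y => (F y)⁻¹) = (fun t : ℝ => t⁻¹) ∘ F := rfl
    rw [e, ((hasDerivAt_inv hz).comp_hasFDerivAt z h.1.hasFDerivAt).fderiv, ← h.2]
    simp only [smul_apply, smul_eq_mul]
    ring⟩

theorem sum {κ : Type*} {s : Finset κ} {f : κ → E → ℝ} {d : κ → ℝ}
    (h : ∀ i ∈ s, HasDirDerivAt (f i) (d i) v z) :
    HasDirDerivAt (fun y => ∑ i ∈ s, f i y) (∑ i ∈ s, d i) v z :=
  ⟨DifferentiableAt.fun_sum fun i hi => (h i hi).1, by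
    rw [fderiv_fun_sum fun i hi => (h i hi).1, sum_apply]
    exact Finset.sum_congr rfl fun i hi => (h i hi).2⟩

end HasDirDerivAt

end DirDeriv

/-! ### Levi-Civita connection and curvature of a coordinate metric, in an arbitrary frame. -/

section Geometry

variable {ι : Type*} [Fintype ι] [DecidableEq ι]

theorem fderiv_eq_sum_pd (F : (ι → ℝ) → ℝ) (x v : ι → ℝ) :
    fderiv ℝ F x v = ∑ k, v k * pd k F x := by
  conv_lhs => rw [← Finset.univ_sum_single v, map_sum]
  refine Finset.sum_congr rfl fun k _ => ?_
  rw [pd, ← smul_eq_mul, ← map_smul]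
  congr 1
  ext j
  simp [Pi.single_apply]

theorem _root_.ContDiffOn.pd {F : (ι → ℝ) → ℝ} {Ω : Set (ι → ℝ)} (hF : ContDiffOn ℝ ∞ F Ω)
    (hΩ : IsOpen Ω) (k : ι) : ContDiffOn ℝ ∞ (pd k F) Ω :=
  (hF.fderiv_of_isOpen hΩ (m := ∞) (by simp)).clm_apply contDiffOn_const

theorem _root_.ContDiffOn.differentiableAt_of_isOpen {E : Type*} [NormedAddCommGroup E]
    [NormedSpace ℝ E] {F : E → ℝ} {Ω : Set E} {x : E}
    (hF : ContDiffOn ℝ ∞ F Ω) (hΩ : IsOpen Ω) (hx : x ∈ Ω) : DifferentiableAt ℝ F x :=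
  (hF.differentiableOn (by simp)).differentiableAt (hΩ.mem_nhds hx)

theorem pd_comm {F : (ι → ℝ) → ℝ} {Ω : Set (ι → ℝ)} (hF : ContDiffOn ℝ ∞ F Ω)
    (hΩ : IsOpen Ω) {x : ι → ℝ} (hx : x ∈ Ω) (i j : ι) : pd i (pd j F) x = pd j (pd i F) x := by
  have hd : DifferentiableAt ℝ (fderiv ℝ F) x :=
    ((hF.fderiv_of_isOpen hΩ (m := ∞) (by simp)).differentiableOn (by simp)).differentiableAt
      (hΩ.mem_nhds hx)
  have key : ∀ a b : ι, CheegerGromoll.pd a (CheegerGromoll.pd b F) x =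
      fderiv ℝ (fderiv ℝ F) x (Pi.single a 1) (Pi.single b 1) := by
    intro a b
    have : CheegerGromoll.pd b F = fun y => fderiv ℝ F y (Pi.single b 1) := rfl
    rw [CheegerGromoll.pd, this, fderiv_clm_apply hd (differentiableAt_const _)]
    simp
  rw [key, key]
  have hs : IsSymmSndFDerivAt ℝ F x := (hF.contDiffAt (hΩ.mem_nhds hx)).isSymmSndFDerivAt
    (by simpa using ENat.LEInfty.out)
  exact hs _ _

/-- The matrix-valued function `G` is smooth, symmetric and invertible on the open set `Ω`. -/
structure IsMetricOn (G : (ι → ℝ) → Matrix ι ι ℝ) (Ω : Set (ι → ℝ)) : Prop where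
  isOpen : IsOpen Ω
  contDiffOn : ∀ a b, ContDiffOn ℝ ∞ (fun y => G y a b) Ω
  symm : ∀ y ∈ Ω, ∀ a b, G y a b = G y b a
  isUnit : ∀ y ∈ Ω, IsUnit (G y).det

theorem contDiffOn_det {G : (ι → ℝ) → Matrix ι ι ℝ} {Ω : Set (ι → ℝ)}
    (hG : ∀ a b, ContDiffOn ℝ ∞ (fun y => G y a b) Ω) :
    ContDiffOn ℝ ∞ (fun y => (G y).det) Ω := by
  simp only [Matrix.det_apply']
  exact ContDiffOn.sum fun σ _ => contDiffOn_const.mul (contDiffOn_prod fun i _ => hG _ _)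

namespace IsMetricOn

variable {G : (ι → ℝ) → Matrix ι ι ℝ} {Ω : Set (ι → ℝ)} {x : ι → ℝ}

/-- Cramer's rule: the entries are cofactors, polynomial in the entries of the metric, divided by
the nonvanishing determinant. -/
theorem contDiffOn_inv (hG : IsMetricOn G Ω) (a b : ι) :
    ContDiffOn ℝ ∞ (fun y => (G y)⁻¹ a b) Ω := by
  have h : ContDiffOn ℝ ∞ (fun y => ((G y).det)⁻¹ * (G y).adjugate a b) Ω := by
    refine ((contDiffOn_det hG.contDiffOn).inv fun y hy => (hG.isUnit y hy).ne_zero).mul ?_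
    simp only [Matrix.adjugate_apply]
    refine contDiffOn_det fun c d => ?_
    simp only [Matrix.updateRow_apply]
    split_ifs
    · exact contDiffOn_const
    · exact hG.contDiffOn c d
  exact h.congr fun y _ => by simp [Matrix.inv_def, Ring.inverse_eq_inv']

theorem contDiffOn_christoffel (hG : IsMetricOn G Ω) (i j h : ι) :
    ContDiffOn ℝ ∞ (christoffel G i j h) Ω :=
  contDiffOn_const.mul (ContDiffOn.sum fun l _ => (hG.contDiffOn_inv h l).mul
    ((((hG.contDiffOn l j).pd hG.isOpen i).add ((hG.contDiffOn i l).pd hG.isOpen j)).sub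
      ((hG.contDiffOn i j).pd hG.isOpen l)))

theorem eventually_mem (hG : IsMetricOn G Ω) (hx : x ∈ Ω) : ∀ᶠ y in nhds x, y ∈ Ω :=
  hG.isOpen.mem_nhds hx

theorem pd_symm (hG : IsMetricOn G Ω) (hx : x ∈ Ω) (k a b : ι) :
    pd k (fun y => G y a b) x = pd k (fun y => G y b a) x := by
  have : (fun y => G y a b) =ᶠ[nhds x] fun y => G y b a :=
    (hG.eventually_mem hx).mono fun y hy => hG.symm y hy a b
  rw [pd, pd, this.fderiv_eq]

theorem inv_symm (hG : IsMetricOn G Ω) (hx : x ∈ Ω) (a b : ι) :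
    (G x)⁻¹ a b = (G x)⁻¹ b a := by
  have : (G x).transpose = G x := Matrix.ext fun i j => hG.symm x hx j i
  conv_lhs => rw [← this, ← Matrix.transpose_nonsing_inv, Matrix.transpose_apply]

theorem christoffel_symm (hG : IsMetricOn G Ω) (hx : x ∈ Ω) (i j h : ι) :
    christoffel G i j h x = christoffel G j i h x := by
  unfold christoffel
  congr 1
  refine Finset.sum_congr rfl fun l _ => ?_
  rw [hG.pd_symm hx i l j, hG.pd_symm hx j i l, hG.pd_symm hx l i j]
  ring

theorem sum_mul_inv (hG : IsMetricOn G Ω) (hx : x ∈ Ω) (a b : ι) :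
    ∑ h, G x a h * (G x)⁻¹ h b = if a = b then 1 else 0 := by
  rw [← Matrix.mul_apply, Matrix.mul_nonsing_inv _ (hG.isUnit x hx), Matrix.one_apply]

theorem sum_inv_mul (hG : IsMetricOn G Ω) (hx : x ∈ Ω) (a b : ι) :
    ∑ h, (G x)⁻¹ a h * G x h b = if a = b then 1 else 0 := by
  rw [← Matrix.mul_apply, Matrix.nonsing_inv_mul _ (hG.isUnit x hx), Matrix.one_apply]

/-- The Christoffel symbols of the first kind. -/
theorem sum_mul_christoffel (hG : IsMetricOn G Ω) (hx : x ∈ Ω) (i j k : ι) :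
    ∑ h, G x k h * christoffel G i j h x = 1 / 2 * (pd i (fun y => G y k j) x
      + pd j (fun y => G y i k) x - pd k (fun y => G y i j) x) := by
  simp only [christoffel, Finset.mul_sum]
  rw [Finset.sum_comm]
  have : ∀ l, ∑ h, G x k h * (1 / 2 * ((G x)⁻¹ h l * (pd i (fun y => G y l j) x
      + pd j (fun y => G y i l) x - pd l (fun y => G y i j) x))) =
      (if k = l then 1 else 0) * (1 / 2 * (pd i (fun y => G y l j) x
      + pd j (fun y => G y i l) x - pd l (fun y => G y i j) x)) := by
    intro l
    rw [← hG.sum_mul_inv hx, Finset.sum_mul]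
    exact Finset.sum_congr rfl fun h _ => by ring
  simp only [this]
  simp

/-- The metric is parallel. -/
theorem pd_metric (hG : IsMetricOn G Ω) (hx : x ∈ Ω) (k a b : ι) :
    pd k (fun y => G y a b) x = (∑ h, christoffel G k a h x * G x h b)
      + ∑ h, christoffel G k b h x * G x a h := by
  have h1 : ∑ h, christoffel G k a h x * G x h b = ∑ h, G x b h * christoffel G k a h x :=
    Finset.sum_congr rfl fun h _ => by rw [hG.symm x hx b h, mul_comm]
  have h2 : ∑ h, christoffel G k b h x * G x a h = ∑ h, G x a h * christoffel G k b h x :=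
    Finset.sum_congr rfl fun h _ => by rw [mul_comm]
  rw [h1, h2, hG.sum_mul_christoffel hx, hG.sum_mul_christoffel hx,
    hG.pd_symm hx k b a, hG.pd_symm hx a k b, hG.pd_symm hx b k a, hG.pd_symm hx a b k]
  ring

end IsMetricOn

theorem nabla_apply (G : (ι → ℝ) → Matrix ι ι ℝ) (X Y : (ι → ℝ) → (ι → ℝ)) (x : ι → ℝ) (c : ι) :
    nabla G X Y x c = fderiv ℝ (fun y => Y y c) x (X x)
      + ∑ a, ∑ b, christoffel G a b c x * X x a * Y x b := by
  rw [nabla, fderiv_eq_sum_pd]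

/-- Only the germ of the differentiated field matters. This permits replacing an inner covariant
derivative by its frame expansion before differentiating again. -/
theorem nabla_congr {G : (ι → ℝ) → Matrix ι ι ℝ} {X Y Z : (ι → ℝ) → (ι → ℝ)} {x : ι → ℝ}
    (h : Y =ᶠ[nhds x] Z) : nabla G X Y x = nabla G X Z x := by
  funext c
  have hc : (fun y => Y y c) =ᶠ[nhds x] fun y => Z y c := h.mono fun y hy => congrFun hy c
  rw [nabla_apply, nabla_apply, hc.fderiv_eq, h.eq_of_nhds]

theorem nabla_sum_smul {κ : Type*} [Fintype κ] (G : (ι → ℝ) → Matrix ι ι ℝ)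
    (X : (ι → ℝ) → (ι → ℝ)) {c : κ → (ι → ℝ) → ℝ} {F : κ → (ι → ℝ) → (ι → ℝ)} {x : ι → ℝ}
    {d : κ → ℝ} (hc : ∀ m, HasDirDerivAt (c m) (d m) (X x) x)
    (hF : ∀ m b, DifferentiableAt ℝ (fun y => F m y b) x) :
    nabla G X (fun y => ∑ m, c m y • F m y) x =
      ∑ m, (d m • F m x + c m x • nabla G X (F m) x) := by
  funext b
  have h1 : HasDirDerivAt (fun y => (∑ m, c m y • F m y) b)
      (∑ m, (d m * F m x b + c m x * fderiv ℝ (fun y => F m y b) x (X x))) (X x) x := by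
    simp only [Finset.sum_apply, Pi.smul_apply, smul_eq_mul]
    exact HasDirDerivAt.sum fun m _ =>
      (hc m).mul (DifferentiableAt.hasDirDerivAt (hF m b) (X x))
  rw [nabla_apply, h1.fderiv_eq]
  simp only [Finset.sum_apply, Pi.smul_apply, Pi.add_apply, smul_eq_mul, nabla_apply, mul_add,
    Finset.sum_add_distrib, Finset.mul_sum, ← add_assoc]
  congr 1
  conv_rhs => rw [Finset.sum_comm]
  refine Finset.sum_congr rfl fun a _ => ?_
  conv_rhs => rw [Finset.sum_comm]
  exact Finset.sum_congr rfl fun e _ => Finset.sum_congr rfl fun m _ => by ring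

theorem nabla_sub {G : (ι → ℝ) → Matrix ι ι ℝ} {X Y Z : (ι → ℝ) → (ι → ℝ)} {x : ι → ℝ}
    (hY : ∀ b, DifferentiableAt ℝ (fun y => Y y b) x)
    (hZ : ∀ b, DifferentiableAt ℝ (fun y => Z y b) x) :
    nabla G X (Y - Z) x = nabla G X Y x - nabla G X Z x := by
  funext b
  simp only [nabla_apply, Pi.sub_apply, mul_sub, Finset.sum_sub_distrib]
  rw [fderiv_fun_sub (hY b) (hZ b)]
  simp only [sub_apply]
  ring

/-- The connection is tensorial in the direction, so an expansion of X at the single point x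
suffices. It is used for Lie brackets of frame fields. -/
theorem nabla_left_sum {κ : Type*} [Fintype κ] {G : (ι → ℝ) → Matrix ι ι ℝ}
    {X Y : (ι → ℝ) → (ι → ℝ)} {F : κ → (ι → ℝ) → (ι → ℝ)} {x : ι → ℝ} {s : κ → ℝ}
    (h : X x = ∑ e, s e • F e x) :
    nabla G X Y x = ∑ e, s e • nabla G (F e) Y x := by
  funext c
  simp only [nabla_apply, h, map_sum, map_smul, Finset.sum_apply, Pi.smul_apply, smul_eq_mul,
    mul_add, Finset.sum_add_distrib]
  congr 1
  simp only [Finset.mul_sum, Finset.sum_mul]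
  conv_rhs => rw [Finset.sum_comm]
  refine Finset.sum_congr rfl fun a _ => ?_
  conv_rhs => rw [Finset.sum_comm]
  exact Finset.sum_congr rfl fun b _ => Finset.sum_congr rfl fun e _ => by ring

omit [DecidableEq ι] in
theorem lieBracket_apply {X Y : (ι → ℝ) → (ι → ℝ)} {x : ι → ℝ}
    (hX : ∀ b, DifferentiableAt ℝ (fun y => X y b) x)
    (hY : ∀ b, DifferentiableAt ℝ (fun y => Y y b) x) (c : ι) :
    VectorField.lieBracket ℝ X Y x c =
      fderiv ℝ (fun y => Y y c) x (X x) - fderiv ℝ (fun y => X y c) x (Y x) := by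
  rw [VectorField.lieBracket, fderiv_pi hY, fderiv_pi hX]
  simp

/-- Torsion vanishes because the Christoffel symbols are symmetric in their lower indices. -/
theorem IsMetricOn.nabla_sub_nabla {G : (ι → ℝ) → Matrix ι ι ℝ} {Ω : Set (ι → ℝ)} {x : ι → ℝ}
    (hG : IsMetricOn G Ω) (hx : x ∈ Ω) {X Y : (ι → ℝ) → (ι → ℝ)}
    (hX : ∀ b, DifferentiableAt ℝ (fun y => X y b) x)
    (hY : ∀ b, DifferentiableAt ℝ (fun y => Y y b) x) :
    nabla G X Y x - nabla G Y X x = VectorField.lieBracket ℝ X Y x := by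
  funext c
  rw [lieBracket_apply hX hY, Pi.sub_apply, nabla_apply, nabla_apply]
  have : ∑ a, ∑ b, christoffel G a b c x * X x a * Y x b =
      ∑ a, ∑ b, christoffel G a b c x * Y x a * X x b := by
    rw [Finset.sum_comm]
    refine Finset.sum_congr rfl fun a _ => Finset.sum_congr rfl fun b _ => ?_
    rw [hG.christoffel_symm hx]
    ring
  rw [this]
  ring

/-- Metric compatibility: `pd_metric` turns the derivative of the components into exactly the two
Christoffel terms that complete the derivatives of Y and Z to covariant ones. -/
theorem IsMetricOn.hasDirDerivAt_bilin {G : (ι → ℝ) → Matrix ι ι ℝ} {Ω : Set (ι → ℝ)} {x : ι → ℝ}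
    (hG : IsMetricOn G Ω) (hx : x ∈ Ω) (X : (ι → ℝ) → (ι → ℝ)) {Y Z : (ι → ℝ) → (ι → ℝ)}
    (hY : ∀ b, DifferentiableAt ℝ (fun y => Y y b) x)
    (hZ : ∀ b, DifferentiableAt ℝ (fun y => Z y b) x) :
    HasDirDerivAt (fun y => Matrix.toBilin' (G y) (Y y) (Z y))
      (Matrix.toBilin' (G x) (nabla G X Y x) (Z x) + Matrix.toBilin' (G x) (Y x) (nabla G X Z x))
      (X x) x := by
  have hg : ∀ a b, HasDirDerivAt (fun y => G y a b)
      (∑ k, X x k * ((∑ h, christoffel G k a h x * G x h b)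
        + ∑ h, christoffel G k b h x * G x a h)) (X x) x := fun a b =>
    (DifferentiableAt.hasDirDerivAt
      ((hG.contDiffOn a b).differentiableAt_of_isOpen hG.isOpen hx) _).congr_deriv (by
        rw [fderiv_eq_sum_pd]
        exact Finset.sum_congr rfl fun k _ => by rw [hG.pd_metric hx])
  simp only [Matrix.toBilin'_apply]
  refine (HasDirDerivAt.sum fun a _ => HasDirDerivAt.sum fun b _ =>
    ((DifferentiableAt.hasDirDerivAt (hY a) (X x)).mul (hg a b)).mul
      (DifferentiableAt.hasDirDerivAt (hZ b) (X x))).congr_deriv ?_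
  simp only [nabla_apply, add_mul, mul_add, Finset.sum_add_distrib]
  have e2 : ∑ a, ∑ b, Y x a * (∑ k, X x k * ∑ h, christoffel G k a h x * G x h b) * Z x b =
      ∑ h, ∑ b, (∑ k, ∑ a, christoffel G k a h x * X x k * Y x a) * G x h b * Z x b := by
    simp only [Finset.mul_sum, Finset.sum_mul]
    rw [Finset.sum_comm]
    conv_rhs => rw [Finset.sum_comm]
    refine Finset.sum_congr rfl fun b _ => ?_
    rw [Finset.sum_comm]
    conv_rhs => rw [Finset.sum_comm]
    refine Finset.sum_congr rfl fun k _ => ?_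
    rw [Finset.sum_comm]
    exact Finset.sum_congr rfl fun h _ => Finset.sum_congr rfl fun a _ => by ring
  have e3 : ∑ a, ∑ b, Y x a * (∑ k, X x k * ∑ h, christoffel G k b h x * G x a h) * Z x b =
      ∑ a, ∑ h, Y x a * G x a h * ∑ k, ∑ b, christoffel G k b h x * X x k * Z x b := by
    simp only [Finset.mul_sum, Finset.sum_mul]
    refine Finset.sum_congr rfl fun a _ => ?_
    rw [Finset.sum_comm]
    conv_rhs => rw [Finset.sum_comm]
    refine Finset.sum_congr rfl fun k _ => ?_
    rw [Finset.sum_comm]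
    exact Finset.sum_congr rfl fun h _ => Finset.sum_congr rfl fun a _ => by ring
  rw [e2, e3]
  ring

/-- A torsion-free metric connection on a frame is the Levi-Civita connection. -/
theorem IsMetricOn.nabla_frame {κ : Type*} [Fintype κ] {G : (ι → ℝ) → Matrix ι ι ℝ}
    {Ω : Set (ι → ℝ)} {x : ι → ℝ} (hG : IsMetricOn G Ω) (hx : x ∈ Ω)
    {F : κ → (ι → ℝ) → (ι → ℝ)} (hF : ∀ a b, DifferentiableAt ℝ (fun y => F a y b) x)
    (hspan : ∀ v, (∀ a, Matrix.toBilin' (G x) v (F a x) = 0) → v = 0)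
    {Θ : κ → κ → κ → ℝ}
    (htors : ∀ a b, VectorField.lieBracket ℝ (F a) (F b) x = ∑ c, (Θ a b c - Θ b a c) • F c x)
    (hmetr : ∀ a b c, fderiv ℝ (fun y => Matrix.toBilin' (G y) (F b y) (F c y)) x (F a x) =
      (∑ e, Θ a b e * Matrix.toBilin' (G x) (F e x) (F c x))
        + ∑ e, Θ a c e * Matrix.toBilin' (G x) (F b x) (F e x)) (a b : κ) :
    nabla G (F a) (F b) x = ∑ c, Θ a b c • F c x := by
  have hbs : ∀ v w, Matrix.toBilin' (G x) v w = Matrix.toBilin' (G x) w v := fun v w => by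
    simp only [Matrix.toBilin'_apply]
    rw [Finset.sum_comm]
    refine Finset.sum_congr rfl fun i _ => Finset.sum_congr rfl fun j _ => ?_
    rw [hG.symm x hx]
    ring
  -- T is the difference between the true connection and the proposed one; equality of torsions
  -- makes it symmetric, and compatibility of both with the metric makes ⟨T a b, F c⟩ skew in b and
  -- c.
  set T : κ → κ → ι → ℝ := fun a b => nabla G (F a) (F b) x - ∑ c, Θ a b c • F c x with hT
  have hTs : ∀ a b, T a b = T b a := fun a b => by
    have h1 := (hG.nabla_sub_nabla hx (hF a) (hF b)).trans (htors a b)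
    simp only [sub_smul, Finset.sum_sub_distrib] at h1
    rw [hT]
    dsimp only
    rw [sub_eq_sub_iff_sub_eq_sub, h1]
  have hTa : ∀ a b c, Matrix.toBilin' (G x) (T a b) (F c x) =
      - Matrix.toBilin' (G x) (T a c) (F b x) := fun a b c => by
    have h1 := (hG.hasDirDerivAt_bilin hx (F a) (hF b) (hF c)).fderiv_eq.symm.trans (hmetr a b c)
    rw [hbs (F b x) (nabla G (F a) (F c) x)] at h1
    have h2 : ∀ b c, Matrix.toBilin' (G x) (T a b) (F c x) =
        Matrix.toBilin' (G x) (nabla G (F a) (F b) x) (F c x)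
          - ∑ e, Θ a b e * Matrix.toBilin' (G x) (F e x) (F c x) := fun b c => by
      simp [hT]
    have h3 : ∑ e, Θ a c e * Matrix.toBilin' (G x) (F b x) (F e x) =
      ∑ e, Θ a c e * Matrix.toBilin' (G x) (F e x) (F b x) :=
      Finset.sum_congr rfl fun e _ => by rw [hbs]
    rw [h2, h2]
    linarith
  -- Alternating the symmetry in the first pair with the skewness in the last pair three times
  -- returns the same number with the opposite sign.
  have : T a b = 0 := hspan _ fun c => by
    have h1 := hTa a b c
    rw [hTs a c] at h1
    have h2 := hTa c a b
    rw [hTs c b] at h2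
    have h3 := hTa b c a
    rw [hTs b a] at h3
    linarith
  exact sub_eq_zero.1 this

theorem curvature_antisymm (G : (ι → ℝ) → Matrix ι ι ℝ) (X Y Z : (ι → ℝ) → (ι → ℝ))
    (x : ι → ℝ) : curvature G X Y Z x = -curvature G Y X Z x := by
  have h : nabla G (VectorField.lieBracket ℝ X Y) Z x =
      - nabla G (VectorField.lieBracket ℝ Y X) Z x := by
    funext c
    simp only [nabla_apply, Pi.neg_apply, VectorField.lieBracket_swap (V := X) (W := Y), map_neg,
      mul_neg, neg_mul, Finset.sum_neg_distrib]
    ring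
  simp only [curvature, Pi.sub_apply, h]
  abel

theorem contDiffOn_nabla {G : (ι → ℝ) → Matrix ι ι ℝ} {Ω : Set (ι → ℝ)} (hG : IsMetricOn G Ω)
    {X Y : (ι → ℝ) → (ι → ℝ)} (hX : ∀ b, ContDiffOn ℝ ∞ (fun y => X y b) Ω)
    (hY : ∀ b, ContDiffOn ℝ ∞ (fun y => Y y b) Ω) (c : ι) :
    ContDiffOn ℝ ∞ (fun y => nabla G X Y y c) Ω :=
  (ContDiffOn.sum fun a _ => (hX a).mul ((hY c).pd hG.isOpen a)).add
    (ContDiffOn.sum fun a _ => ContDiffOn.sum fun b _ =>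
      ((hG.contDiffOn_christoffel a b c).mul (hX a)).mul (hY b))

/-- The first Bianchi identity. -/
theorem IsMetricOn.curvature_cyclic {G : (ι → ℝ) → Matrix ι ι ℝ} {Ω : Set (ι → ℝ)} {x : ι → ℝ}
    (hG : IsMetricOn G Ω) (hx : x ∈ Ω) {X Y Z : (ι → ℝ) → (ι → ℝ)}
    (hX : ∀ b, ContDiffOn ℝ ∞ (fun y => X y b) Ω) (hY : ∀ b, ContDiffOn ℝ ∞ (fun y => Y y b) Ω)
    (hZ : ∀ b, ContDiffOn ℝ ∞ (fun y => Z y b) Ω) :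
    curvature G X Y Z x + curvature G Y Z X x + curvature G Z X Y x = 0 := by
  -- Vanishing torsion is used twice: ∇_U∇_V W - ∇_U∇_W V = ∇_U[V,W], and ∇_U[V,W] - ∇_{[V,W]}U =
  -- [U,[V,W]]. The cyclic sum of curvatures thus becomes a cyclic sum of double brackets.
  have key : ∀ {U V W : (ι → ℝ) → (ι → ℝ)}, (∀ b, ContDiffOn ℝ ∞ (fun y => U y b) Ω) →
      (∀ b, ContDiffOn ℝ ∞ (fun y => V y b) Ω) → (∀ b, ContDiffOn ℝ ∞ (fun y => W y b) Ω) →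
      nabla G U (nabla G V W) x - nabla G U (nabla G W V) x
        - nabla G (VectorField.lieBracket ℝ V W) U x =
      VectorField.lieBracket ℝ U (VectorField.lieBracket ℝ V W) x := by
    intro U V W hU hV hW
    have h1 : nabla G V W - nabla G W V =ᶠ[nhds x] VectorField.lieBracket ℝ V W :=
      (hG.eventually_mem hx).mono fun y hy => hG.nabla_sub_nabla hy
        (fun b => (hV b).differentiableAt_of_isOpen hG.isOpen hy)
        (fun b => (hW b).differentiableAt_of_isOpen hG.isOpen hy)
    have hd := fun b => (contDiffOn_nabla hG hV hW b).differentiableAt_of_isOpen hG.isOpen hx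
    have hd' := fun b => (contDiffOn_nabla hG hW hV b).differentiableAt_of_isOpen hG.isOpen hx
    rw [← nabla_sub hd hd', nabla_congr h1]
    refine hG.nabla_sub_nabla hx (fun b => (hU b).differentiableAt_of_isOpen hG.isOpen hx)
      fun b => ?_
    refine ((hd b).sub (hd' b)).congr_of_eventuallyEq ?_
    exact h1.symm.mono fun y hy => congrFun hy b
  have hc : ∀ {U : (ι → ℝ) → (ι → ℝ)}, (∀ b, ContDiffOn ℝ ∞ (fun y => U y b) Ω) →
      ContDiffAt ℝ (minSmoothness ℝ 2) U x := fun hU =>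
    ((contDiffOn_pi.2 hU).contDiffAt (hG.isOpen.mem_nhds hx)).of_le
      (by simpa using ENat.LEInfty.out)
  -- The Jacobi identity in Leibniz form; `s1` and `s2` bring the other two double brackets to its
  -- shape.
  have hj := VectorField.leibniz_identity_lieBracket le_rfl (hc hX) (hc hY) (hc hZ)
  have k1 := key hX hY hZ
  have k2 := key hY hZ hX
  have k3 := key hZ hX hY
  have s1 : VectorField.lieBracket ℝ Y (VectorField.lieBracket ℝ Z X) x =
      - VectorField.lieBracket ℝ Y (VectorField.lieBracket ℝ X Z) x := by
    have e : VectorField.lieBracket ℝ Z X = -VectorField.lieBracket ℝ X Z :=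
      funext fun _ => VectorField.lieBracket_swap
    rw [e, VectorField.lieBracket, VectorField.lieBracket, fderiv_neg]
    simp only [Pi.neg_apply, map_neg, neg_apply]
    abel
  have s2 : VectorField.lieBracket ℝ Z (VectorField.lieBracket ℝ X Y) x =
      - VectorField.lieBracket ℝ (VectorField.lieBracket ℝ X Y) Z x := by
    rw [VectorField.lieBracket_swap]
  simp only [curvature, Pi.sub_apply]
  rw [hj] at k1
  rw [s1] at k2
  rw [s2] at k3
  rw [← sub_eq_zero] at k1 k2 k3
  have := congrArg₂ (· + ·) (congrArg₂ (· + ·) k1 k2) k3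
  simp only [add_zero] at this
  rw [← this]
  abel

/-- The structure equation for a frame: the Leibniz rule applied to the expansion of the inner
derivative. The connection coefficients must be known near x since they get differentiated, while
the bracket is needed at x only. -/
theorem curvature_frame {κ : Type*} [Fintype κ] {G : (ι → ℝ) → Matrix ι ι ℝ}
    {x : ι → ℝ} {F : κ → (ι → ℝ) → (ι → ℝ)} (hF : ∀ a b, DifferentiableAt ℝ (fun y => F a y b) x)
    {Θ : κ → κ → κ → (ι → ℝ) → ℝ}
    (hΘ : ∀ᶠ y in nhds x, ∀ a b, nabla G (F a) (F b) y = ∑ c, Θ a b c y • F c y) {a b c : κ}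
    {s : κ → ℝ} (hs : VectorField.lieBracket ℝ (F a) (F b) x = ∑ e, s e • F e x)
    {d₁ d₂ : κ → ℝ} (h₁ : ∀ e, HasDirDerivAt (Θ b c e) (d₁ e) (F a x) x)
    (h₂ : ∀ e, HasDirDerivAt (Θ a c e) (d₂ e) (F b x) x) :
    curvature G (F a) (F b) (F c) x = ∑ m, (d₁ m - d₂ m
      + ((∑ e, (Θ b c e x * Θ a e m x - Θ a c e x * Θ b e m x)) - ∑ e, s e * Θ e c m x))
        • F m x := by
  have hx := hΘ.self_of_nhds
  have key : ∀ {a b c : κ} {d : κ → ℝ}, (∀ e, HasDirDerivAt (Θ b c e) (d e) (F a x) x) →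
      nabla G (F a) (nabla G (F b) (F c)) x =
        ∑ m, (d m + ∑ e, Θ b c e x * Θ a e m x) • F m x := by
    intro a b c d h
    rw [nabla_congr (hΘ.mono fun y hy => hy b c), nabla_sum_smul G (F a) h hF]
    simp only [hx, Finset.smul_sum, add_smul, Finset.sum_smul, smul_smul, Finset.sum_add_distrib]
    congr 1
    exact Finset.sum_comm
  have k3 : nabla G (VectorField.lieBracket ℝ (F a) (F b)) (F c) x =
      ∑ m, (∑ e, s e * Θ e c m x) • F m x := by
    rw [nabla_left_sum hs]
    simp only [hx, Finset.smul_sum, Finset.sum_smul, smul_smul]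
    exact Finset.sum_comm
  simp only [curvature, Pi.sub_apply]
  rw [key h₁, key h₂, k3, ← Finset.sum_sub_distrib, ← Finset.sum_sub_distrib]
  refine Finset.sum_congr rfl fun m _ => ?_
  rw [← sub_smul, ← sub_smul, Finset.sum_sub_distrib]
  congr 1
  ring

end Geometry

/-! ### Curvature identities on the base. -/

section Base

variable {ι : Type*} [Fintype ι] [DecidableEq ι]

theorem riem_antisymm (G : (ι → ℝ) → Matrix ι ι ℝ) (i j l s : ι) (x : ι → ℝ) :
    riem G i j l s x = -riem G j i l s x :=
  congrFun (curvature_antisymm G _ _ _ x) s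

theorem riemUp_antisymm (G : (ι → ℝ) → Matrix ι ι ℝ) (i j l s : ι) (x : ι → ℝ) :
    riemUp G i j l s x = -riemUp G j i l s x := by
  simp only [riemUp, riem_antisymm G i j, mul_neg, Finset.sum_neg_distrib]

theorem riemUpUp_eq_sum (G : (ι → ℝ) → Matrix ι ι ℝ) (k j i s : ι) (x : ι → ℝ) :
    riemUpUp G k j i s x = ∑ t, (G x)⁻¹ k t * riemUp G t j i s x := by
  simp only [riemUpUp, riemUp, Finset.mul_sum, mul_assoc]

theorem hasDirDerivAt_single {F : (ι → ℝ) → ℝ} {x : ι → ℝ} (hF : DifferentiableAt ℝ F x) (k : ι) :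
    HasDirDerivAt F (pd k F x) (Pi.single k 1) x :=
  DifferentiableAt.hasDirDerivAt hF _

theorem HasDirDerivAt.pd_eq {F : (ι → ℝ) → ℝ} {x : ι → ℝ} {k : ι} {d : ℝ}
    (h : HasDirDerivAt F d (Pi.single k 1) x) : pd k F x = d := h.2

namespace IsMetricOn

variable {G : (ι → ℝ) → Matrix ι ι ℝ} {Ω : Set (ι → ℝ)} {x : ι → ℝ}

theorem nabla_coordField (G : (ι → ℝ) → Matrix ι ι ℝ) (a b : ι) (y : ι → ℝ) :
    nabla G (coordField a) (coordField b) y = ∑ c, christoffel G a b c y • coordField c y := by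
  funext c
  rw [nabla_apply]
  simp [coordField, Pi.single_apply]

theorem hasDirDerivAt_christoffel (hG : IsMetricOn G Ω) (hx : x ∈ Ω) (k i j h : ι) :
    HasDirDerivAt (christoffel G i j h) (pd k (christoffel G i j h) x) (Pi.single k 1) x :=
  hasDirDerivAt_single ((hG.contDiffOn_christoffel i j h).differentiableAt_of_isOpen hG.isOpen hx) k

theorem hasDirDerivAt_inv (hG : IsMetricOn G Ω) (hx : x ∈ Ω) (k i j : ι) :
    HasDirDerivAt (fun y => (G y)⁻¹ i j) (pd k (fun y => (G y)⁻¹ i j) x) (Pi.single k 1) x :=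
  hasDirDerivAt_single ((hG.contDiffOn_inv i j).differentiableAt_of_isOpen hG.isOpen hx) k

/-- The structure equation in the coordinate frame, whose brackets vanish (`s := 0`). -/
theorem riem_eq (hG : IsMetricOn G Ω) (hx : x ∈ Ω) (i j l s : ι) :
    riem G i j l s x = pd i (christoffel G j l s) x - pd j (christoffel G i l s) x
      + ∑ h, (christoffel G j l h x * christoffel G i h s x
        - christoffel G i l h x * christoffel G j h s x) := by
  have h := curvature_frame (G := G) (x := x) (F := coordField) (Θ := christoffel G)
    (fun a b => differentiableAt_const _)
    (Filter.Eventually.of_forall fun y a b => nabla_coordField G a b y)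
    (a := i) (b := j) (c := l) (s := 0) (by
      funext c
      rw [lieBracket_apply (X := coordField i) (Y := coordField j)
        (fun b => differentiableAt_const _) (fun b => differentiableAt_const _)]
      simp [coordField])
    (fun e => hG.hasDirDerivAt_christoffel hx i j l e)
    (fun e => hG.hasDirDerivAt_christoffel hx j i l e)
  rw [riem, h]
  simp [coordField, Pi.single_apply, Finset.sum_apply]

theorem contDiffOn_riem (hG : IsMetricOn G Ω) (i j l s : ι) :
    ContDiffOn ℝ ∞ (riem G i j l s) Ω := by
  have hΓ := hG.contDiffOn_christoffel
  refine ContDiffOn.congr ?_ fun y hy => hG.riem_eq hy i j l s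
  exact (((hΓ j l s).pd hG.isOpen i).sub ((hΓ i l s).pd hG.isOpen j)).add
    (ContDiffOn.sum fun h _ => ((hΓ j l h).mul (hΓ i h s)).sub ((hΓ i l h).mul (hΓ j h s)))

theorem contDiffOn_riemUpUp (hG : IsMetricOn G Ω) (k j i s : ι) :
    ContDiffOn ℝ ∞ (riemUpUp G k j i s) Ω :=
  ContDiffOn.sum fun t _ => ContDiffOn.sum fun m _ =>
    ((hG.contDiffOn_inv k t).mul (hG.contDiffOn_inv i m)).mul (hG.contDiffOn_riem t j m s)

/-- The inverse metric is parallel. -/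
theorem pd_inv (hG : IsMetricOn G Ω) (hx : x ∈ Ω) (k a b : ι) :
    pd k (fun y => (G y)⁻¹ a b) x = -(∑ h, christoffel G k h a x * (G x)⁻¹ h b)
      - ∑ h, christoffel G k h b x * (G x)⁻¹ h a := by
  set D : Matrix ι ι ℝ := Matrix.of fun a b => pd k (fun y => (G y)⁻¹ a b) x with hD
  set Γ : Matrix ι ι ℝ := Matrix.of fun h a => christoffel G k h a x with hΓ
  have hGs : (G x).transpose = G x := Matrix.ext fun i j => hG.symm x hx j i
  -- Differentiate G G⁻¹ = 1; together with the parallelism of G in matrix form (`h5`), this is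
  -- solved for D.
  have h1 : Matrix.of (fun a b => pd k (fun y => G y a b) x) * (G x)⁻¹ + G x * D = 0 := by
    ext a b
    have h2 : HasDirDerivAt (fun y => ∑ h, G y a h * (G y)⁻¹ h b)
        (∑ h, (pd k (fun y => G y a h) x * (G x)⁻¹ h b
          + G x a h * pd k (fun y => (G y)⁻¹ h b) x)) (Pi.single k 1) x :=
      HasDirDerivAt.sum fun h _ => (hasDirDerivAt_single
        ((hG.contDiffOn a h).differentiableAt_of_isOpen hG.isOpen hx) k).mul
        (hG.hasDirDerivAt_inv hx k h b)
    have h3 : (fun _ => if a = b then 1 else 0) =ᶠ[nhds x]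
        fun y => ∑ h, G y a h * (G y)⁻¹ h b :=
      (hG.eventually_mem hx).mono fun y hy => (hG.sum_mul_inv hy a b).symm
    have h4 := (h2.congr_of_eventuallyEq h3).pd_eq.symm.trans
      (HasDirDerivAt.const (if a = b then (1 : ℝ) else 0) (Pi.single k 1) x).pd_eq
    simpa [Matrix.mul_apply, Finset.sum_add_distrib, hD] using h4
  have h5 : Matrix.of (fun a b => pd k (fun y => G y a b) x) = Γ * G x + G x * Γ.transpose := by
    ext a b
    simp only [Matrix.of_apply, hG.pd_metric hx, Matrix.add_apply, Matrix.mul_apply, hΓ,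
      Matrix.transpose_apply]
    congr 1
    exact Finset.sum_congr rfl fun h _ => mul_comm _ _
  have hu := hG.isUnit x hx
  have h6 : D = -(Γ.transpose * (G x)⁻¹) - (G x)⁻¹ * Γ := by
    have h7 : (G x)⁻¹ * (G x * D) = (G x)⁻¹ * (-((Γ * G x + G x * Γ.transpose) * (G x)⁻¹)) := by
      rw [← h5, eq_neg_of_add_eq_zero_right h1]
    rw [Matrix.nonsing_inv_mul_cancel_left _ _ hu] at h7
    rw [h7, add_mul, Matrix.mul_assoc Γ, Matrix.mul_nonsing_inv _ hu, Matrix.mul_one, mul_neg,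
      Matrix.mul_add, Matrix.mul_assoc (G x), Matrix.nonsing_inv_mul_cancel_left _ _ hu]
    abel
  have h8 := congrFun (congrFun h6 a) b
  simp only [hD, hΓ, Matrix.sub_apply, Matrix.neg_apply, Matrix.mul_apply, Matrix.of_apply,
    Matrix.transpose_apply] at h8
  rw [h8]
  congr 1
  exact Finset.sum_congr rfl fun h _ => by rw [hG.inv_symm hx a h, mul_comm]

/-- The curvature is skew-symmetric in its last two indices. -/
theorem riemUp_skew (hG : IsMetricOn G Ω) (hx : x ∈ Ω) (i j a b : ι) :
    riemUp G i j a b x = -riemUp G i j b a x := by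
  set Γ : ι → ι → ι → ℝ := fun i j h => christoffel G i j h x with hΓ
  set q : ι → ι → ℝ := fun a b => (G x)⁻¹ a b with hq
  have hd : ∀ i j a b, HasDirDerivAt (fun y => ∑ h, christoffel G j h a y * (G y)⁻¹ h b)
      ((∑ h, pd i (christoffel G j h a) x * q h b)
        - (∑ h, ∑ s, Γ j h a * Γ i s h * q s b) - ∑ h, ∑ s, Γ j h a * Γ i s b * q s h)
      (Pi.single i 1) x := by
    intro i j a b
    refine (HasDirDerivAt.sum fun h _ => (hG.hasDirDerivAt_christoffel hx i j h a).mul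
      (hG.hasDirDerivAt_inv hx i h b)).congr_deriv ?_
    rw [← Finset.sum_sub_distrib, ← Finset.sum_sub_distrib]
    refine Finset.sum_congr rfl fun h _ => ?_
    rw [hG.pd_inv hx, mul_sub, mul_neg, Finset.mul_sum, Finset.mul_sum]
    simp only [hΓ, hq, mul_assoc]
    ring
  -- The Ricci identity for the parallel tensor g⁻¹: its second derivatives are computed by
  -- differentiating `pd_inv`, and their commutator is, up to sign, the symmetrization in a and b of
  -- the raised curvature.
  have hT : ∀ i j, pd i (pd j fun y => (G y)⁻¹ a b) x =
      -((∑ h, pd i (christoffel G j h a) x * q h b)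
        - (∑ h, ∑ s, Γ j h a * Γ i s h * q s b) - ∑ h, ∑ s, Γ j h a * Γ i s b * q s h)
      - ((∑ h, pd i (christoffel G j h b) x * q h a)
        - (∑ h, ∑ s, Γ j h b * Γ i s h * q s a) - ∑ h, ∑ s, Γ j h b * Γ i s a * q s h) := by
    intro i j
    exact ((((hd i j a b).neg).sub (hd i j b a)).congr_of_eventuallyEq
      ((hG.eventually_mem hx).mono fun y hy => hG.pd_inv hy j a b)).pd_eq
  -- The terms with one Christoffel symbol on each index are unchanged by swapping i with j and a
  -- with b together, so they drop out of the commutator.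
  have hX : ∀ i j a b, ∑ h, ∑ s, Γ j h a * Γ i s b * q s h =
      ∑ h, ∑ s, Γ i h b * Γ j s a * q s h := by
    intro i j a b
    rw [Finset.sum_comm]
    refine Finset.sum_congr rfl fun h _ => Finset.sum_congr rfl fun s _ => ?_
    have : q h s = q s h := hG.inv_symm hx h s
    rw [this]
    ring
  have hS : ∀ a b, riemUp G i j b a x =
      (∑ h, pd i (christoffel G j h a) x * q h b) - (∑ h, pd j (christoffel G i h a) x * q h b)
        - (∑ h, ∑ s, Γ j h a * Γ i s h * q s b) + ∑ h, ∑ s, Γ i h a * Γ j s h * q s b := by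
    intro a b
    rw [Finset.sum_comm, Finset.sum_comm (f := fun h s => Γ i h a * Γ j s h * q s b),
      ← Finset.sum_sub_distrib, ← Finset.sum_sub_distrib, ← Finset.sum_add_distrib, riemUp]
    refine Finset.sum_congr rfl fun h _ => ?_
    rw [hG.riem_eq hx, hG.inv_symm hx b h, Finset.sum_sub_distrib, mul_add, mul_sub, mul_sub,
      Finset.mul_sum, Finset.mul_sum]
    have e1 : ∑ s, Γ j s a * Γ i h s * q h b = ∑ s, (G x)⁻¹ h b *
        (christoffel G i h s x * christoffel G j s a x) :=
      Finset.sum_congr rfl fun s _ => by simp only [hΓ, hq]; ring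
    have e2 : ∑ s, Γ i s a * Γ j h s * q h b = ∑ s, (G x)⁻¹ h b *
        (christoffel G j h s x * christoffel G i s a x) :=
      Finset.sum_congr rfl fun s _ => by simp only [hΓ, hq]; ring
    rw [e1, e2]
    simp only [hq]
    ring
  have hc := pd_comm (hG.contDiffOn_inv a b) hG.isOpen hx i j
  rw [hT, hT] at hc
  rw [hS, hS]
  linarith [hX i j a b, hX i j b a]

theorem riemUpUp_skew (hG : IsMetricOn G Ω) (hx : x ∈ Ω) (k j a b : ι) :
    riemUpUp G k j a b x = -riemUpUp G k j b a x := by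
  simp only [riemUpUp_eq_sum, ← Finset.sum_neg_distrib]
  exact Finset.sum_congr rfl fun t _ => by rw [hG.riemUp_skew hx]; ring

end IsMetricOn

end Base

/-! ### The rescaled metric on the cotangent bundle: bilinearity, positivity, smoothness. -/

section CotangentMetric

variable {n : ℕ} {γ : (Fin n → ℝ) → Matrix (Fin n) (Fin n) ℝ} {φ : (Fin n → ℝ) → ℝ}
  {U : Set (Fin n → ℝ)} {z : Fin n ⊕ Fin n → ℝ}

/-- `γ` is a Riemannian metric and `φ` a positive function on the open set `U`, both smooth. -/
structure IsRescaledMetricOn (γ : (Fin n → ℝ) → Matrix (Fin n) (Fin n) ℝ) (φ : (Fin n → ℝ) → ℝ)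
    (U : Set (Fin n → ℝ)) : Prop where
  metric : IsMetricOn γ U
  posDef : ∀ x ∈ U, (γ x).PosDef
  contDiffOn : ContDiffOn ℝ ∞ φ U
  pos : ∀ x ∈ U, 0 < φ x

/-- The part of the cotangent bundle over `U`. -/
def cotangentOver (U : Set (Fin n → ℝ)) : Set (Fin n ⊕ Fin n → ℝ) := basePt ⁻¹' U

theorem contDiff_basePt : ContDiff ℝ ∞ (basePt : (Fin n ⊕ Fin n → ℝ) → Fin n → ℝ) :=
  contDiff_pi.2 fun i => contDiff_apply ℝ ℝ (Sum.inl i)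

theorem contDiff_covec (i : Fin n) : ContDiff ℝ ∞ (fun z : Fin n ⊕ Fin n → ℝ => covec z i) :=
  contDiff_apply ℝ ℝ (Sum.inr i)

theorem isOpen_cotangentOver (hU : IsOpen U) : IsOpen (cotangentOver U) :=
  hU.preimage contDiff_basePt.continuous

theorem contDiffOn_comp_basePt {F : (Fin n → ℝ) → ℝ} (hF : ContDiffOn ℝ ∞ F U) :
    ContDiffOn ℝ ∞ (fun z : Fin n ⊕ Fin n → ℝ => F (basePt z)) (cotangentOver U) :=
  hF.comp contDiff_basePt.contDiffOn fun _ h => h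

theorem coInner_add_left (x ξ η θ : Fin n → ℝ) :
    coInner γ x (ξ + η) θ = coInner γ x ξ θ + coInner γ x η θ := by
  simp only [coInner, Pi.add_apply, mul_add, add_mul, Finset.sum_add_distrib]

theorem coInner_add_right (x ξ η θ : Fin n → ℝ) :
    coInner γ x ξ (η + θ) = coInner γ x ξ η + coInner γ x ξ θ := by
  simp only [coInner, Pi.add_apply, mul_add, Finset.sum_add_distrib]

theorem coInner_smul_left (c : ℝ) (x ξ θ : Fin n → ℝ) :
    coInner γ x (c • ξ) θ = c * coInner γ x ξ θ := by
  simp only [coInner, Pi.smul_apply, smul_eq_mul, Finset.mul_sum]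
  exact Finset.sum_congr rfl fun i _ => Finset.sum_congr rfl fun j _ => by ring

theorem coInner_smul_right (c : ℝ) (x ξ θ : Fin n → ℝ) :
    coInner γ x ξ (c • θ) = c * coInner γ x ξ θ := by
  simp only [coInner, Pi.smul_apply, smul_eq_mul, Finset.mul_sum]
  exact Finset.sum_congr rfl fun i _ => Finset.sum_congr rfl fun j _ => by ring

theorem verPart_add (z v w : Fin n ⊕ Fin n → ℝ) :
    verPart γ z (v + w) = verPart γ z v + verPart γ z w := by
  funext i
  simp only [verPart, Pi.add_apply, mul_add, Finset.sum_add_distrib]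
  ring

theorem verPart_smul (c : ℝ) (z v : Fin n ⊕ Fin n → ℝ) :
    verPart γ z (c • v) = c • verPart γ z v := by
  funext i
  simp only [verPart, Pi.smul_apply, smul_eq_mul, mul_sub, Finset.mul_sum]
  congr 1
  exact Finset.sum_congr rfl fun i _ => Finset.sum_congr rfl fun j _ => by ring

theorem coInner_symm (hγ : IsMetricOn γ U) {x : Fin n → ℝ} (hx : x ∈ U) (ξ θ : Fin n → ℝ) :
    coInner γ x ξ θ = coInner γ x θ ξ := by
  rw [coInner, Finset.sum_comm]
  exact Finset.sum_congr rfl fun i _ => Finset.sum_congr rfl fun j _ => by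
    rw [hγ.inv_symm hx]; ring

/-- The rescaled metric as a bilinear form. -/
def cgBilin (γ : (Fin n → ℝ) → Matrix (Fin n) (Fin n) ℝ) (φ : (Fin n → ℝ) → ℝ)
    (z : Fin n ⊕ Fin n → ℝ) : LinearMap.BilinForm ℝ (Fin n ⊕ Fin n → ℝ) :=
  LinearMap.mk₂ ℝ (cgForm γ φ z)
    (fun v w u => by
      simp only [cgForm, verPart_add, coInner_add_left, horPart, Pi.add_apply, mul_add, add_mul,
        Finset.sum_add_distrib]
      ring)
    (fun c v w => by
      simp only [cgForm, verPart_smul, coInner_smul_left, horPart, Pi.smul_apply, smul_eq_mul]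
      have : ∑ i, ∑ j, γ (basePt z) i j * (c * v (Sum.inl i)) * w (Sum.inl j) =
          c * ∑ i, ∑ j, γ (basePt z) i j * v (Sum.inl i) * w (Sum.inl j) := by
        simp only [Finset.mul_sum]
        exact Finset.sum_congr rfl fun i _ => Finset.sum_congr rfl fun j _ => by ring
      rw [this]
      ring)
    (fun v w u => by
      simp only [cgForm, verPart_add, coInner_add_left, coInner_add_right, horPart, Pi.add_apply,
        mul_add, Finset.sum_add_distrib]
      ring)
    (fun c v w => by
      simp only [cgForm, verPart_smul, coInner_smul_left, coInner_smul_right, horPart,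
        Pi.smul_apply, smul_eq_mul]
      have : ∑ i, ∑ j, γ (basePt z) i j * v (Sum.inl i) * (c * w (Sum.inl j)) =
          c * ∑ i, ∑ j, γ (basePt z) i j * v (Sum.inl i) * w (Sum.inl j) := by
        simp only [Finset.mul_sum]
        exact Finset.sum_congr rfl fun i _ => Finset.sum_congr rfl fun j _ => by ring
      rw [this]
      ring)

/-- Since `cgForm` is bilinear, its values on the natural basis determine it. Metric computations
can then use the adapted frame, never the natural matrix entries. -/
theorem toBilin'_cgMetric (γ : (Fin n → ℝ) → Matrix (Fin n) (Fin n) ℝ) (φ : (Fin n → ℝ) → ℝ)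
    (z v w : Fin n ⊕ Fin n → ℝ) :
    Matrix.toBilin' (cgMetric γ φ z) v w = cgForm γ φ z v w := by
  have : cgMetric γ φ z = LinearMap.BilinForm.toMatrix' (cgBilin γ φ z) := by
    ext a b
    rw [LinearMap.BilinForm.toMatrix'_apply]
    rfl
  rw [this, Matrix.toBilin'_toMatrix']
  rfl

/-- The vector fields `E_j` and `E_{j̄}`. -/
def frame (γ : (Fin n → ℝ) → Matrix (Fin n) (Fin n) ℝ) :
    Fin n ⊕ Fin n → (Fin n ⊕ Fin n → ℝ) → (Fin n ⊕ Fin n → ℝ) :=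
  Sum.elim (frameH γ) frameV

theorem frameH_inl (j i : Fin n) : frameH γ j z (Sum.inl i) = if i = j then 1 else 0 := by
  simp [frameH, horizontalLift, coordField, Pi.single_apply]

theorem frameH_inr (j i : Fin n) :
    frameH γ j z (Sum.inr i) = ∑ h, covec z h * christoffel γ i j h (basePt z) := by
  simp [frameH, horizontalLift, coordField, Pi.single_apply]

theorem frameV_inl (j i : Fin n) : frameV j z (Sum.inl i) = 0 := by
  simp [frameV, verticalLift]

theorem frameV_inr (j i : Fin n) : frameV j z (Sum.inr i) = if i = j then 1 else 0 := by
  simp [frameV, verticalLift, Pi.single_apply]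

theorem eq_sum_frame (γ : (Fin n → ℝ) → Matrix (Fin n) (Fin n) ℝ) (z v : Fin n ⊕ Fin n → ℝ) :
    v = ∑ a, Sum.elim (horPart v) (verPart γ z v) a • frame γ a z := by
  funext b
  simp only [Fintype.sum_sum_type, frame, Sum.elim_inl, Sum.elim_inr,
    Finset.sum_apply, Pi.smul_apply, smul_eq_mul]
  cases b with
  | inl b => simp [frameH_inl, frameV_inl, horPart]
  | inr b =>
    simp only [frameH_inr, frameV_inr, horPart, verPart, mul_ite, mul_one, mul_zero,
      Finset.sum_ite_eq, Finset.mem_univ, if_true, Finset.mul_sum]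
    have : ∑ h, ∑ j, covec z h * christoffel γ b j h (basePt z) * v (Sum.inl j) =
        ∑ j, ∑ h, v (Sum.inl j) * (covec z h * christoffel γ b j h (basePt z)) := by
      rw [Finset.sum_comm]
      exact Finset.sum_congr rfl fun i _ => Finset.sum_congr rfl fun j _ => by ring
    rw [this]
    ring

/-- The components of the metric on vertical vectors. -/
def vertMetric (γ : (Fin n → ℝ) → Matrix (Fin n) (Fin n) ℝ) (i j : Fin n)
    (z : Fin n ⊕ Fin n → ℝ) : ℝ :=
  (alpha γ z)⁻¹ * ((γ (basePt z))⁻¹ i j + covecUp γ z i * covecUp γ z j)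

theorem coInner_single_left (γ : (Fin n → ℝ) → Matrix (Fin n) (Fin n) ℝ)
    (z : Fin n ⊕ Fin n → ℝ) (i : Fin n) :
    coInner γ (basePt z) (Pi.single i 1) (covec z) = covecUp γ z i := by
  simp only [coInner, covecUp]
  rw [Finset.sum_eq_single i (fun b _ hb => by simp [hb]) (by simp)]
  simp

theorem cgForm_frameV_frameV (i j : Fin n) :
    cgForm γ φ z (frameV i z) (frameV j z) = vertMetric γ i j z := by
  rw [frameV, frameV, cgForm_vertical_vertical, coInner_single_left, coInner_single_left,
    vertMetric, one_div]
  congr 2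
  simp [coInner, Pi.single_apply]

theorem cgForm_frameH_frameH (i j : Fin n) :
    cgForm γ φ z (frameH γ i z) (frameH γ j z) = φ (basePt z) * γ (basePt z) i j := by
  rw [frameH, frameH, cgForm_horizontal_horizontal]
  simp [coordField, Pi.single_apply]

theorem cgForm_frameV_frameH (i j : Fin n) :
    cgForm γ φ z (frameV i z) (frameH γ j z) = 0 :=
  cgForm_vertical_horizontal γ φ _ _ z

theorem alpha_eq (γ : (Fin n → ℝ) → Matrix (Fin n) (Fin n) ℝ) (z : Fin n ⊕ Fin n → ℝ) :
    alpha γ z = 1 + ∑ i, covec z i * covecUp γ z i := by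
  simp only [alpha, coInner, covecUp, Finset.mul_sum]
  congr 1
  exact Finset.sum_congr rfl fun i _ => Finset.sum_congr rfl fun j _ => by ring

namespace IsRescaledMetricOn

variable (h : IsRescaledMetricOn γ φ U)
include h

theorem coInner_self {x : Fin n → ℝ} (hx : x ∈ U) {ξ : Fin n → ℝ} (hξ : ξ ≠ 0) :
    0 < coInner γ x ξ ξ := by
  have := (h.posDef x hx).inv.dotProduct_mulVec_pos hξ
  refine this.trans_eq ?_
  simp only [coInner, dotProduct, Matrix.mulVec, Finset.mul_sum, Pi.star_apply, star_trivial]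
  exact Finset.sum_congr rfl fun i _ => Finset.sum_congr rfl fun j _ => by ring

theorem coInner_self_nonneg {x : Fin n → ℝ} (hx : x ∈ U) (ξ : Fin n → ℝ) :
    0 ≤ coInner γ x ξ ξ := by
  rcases eq_or_ne ξ 0 with rfl | hξ
  · simp [coInner]
  · exact (h.coInner_self hx hξ).le

theorem alpha_pos (hz : z ∈ cotangentOver U) : 0 < alpha γ z := by
  have := h.coInner_self_nonneg hz (covec z)
  rw [alpha]
  linarith

/-- Horizontal and vertical contributions are both nonnegative. If the horizontal part vanishes, the
vertical part cannot, because the two parts are the frame coordinates of v. -/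
theorem cgForm_self_pos (hz : z ∈ cotangentOver U) {v : Fin n ⊕ Fin n → ℝ} (hv : v ≠ 0) :
    0 < cgForm γ φ z v v := by
  have hα := h.alpha_pos hz
  have hφ := h.pos _ hz
  have hv0 := h.coInner_self_nonneg hz (verPart γ z v)
  have hH : ∑ i, ∑ j, γ (basePt z) i j * horPart v i * horPart v j =
      star (horPart v) ⬝ᵥ (γ (basePt z)).mulVec (horPart v) := by
    simp only [dotProduct, Matrix.mulVec, Finset.mul_sum, Pi.star_apply, star_trivial]
    exact Finset.sum_congr rfl fun i _ => Finset.sum_congr rfl fun j _ => by ring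
  have hh0 := (h.posDef _ hz).posSemidef.dotProduct_mulVec_nonneg (horPart v)
  rw [cgForm, hH]
  rcases eq_or_ne (horPart v) 0 with h0 | h0
  · have hw : verPart γ z v ≠ 0 := by
      intro hw
      refine hv ((eq_sum_frame γ z v).trans ?_)
      simp [h0, hw]
    have := h.coInner_self hz hw
    have : 0 < 1 / alpha γ z * (coInner γ (basePt z) (verPart γ z v) (verPart γ z v)
        + coInner γ (basePt z) (verPart γ z v) (covec z)
          * coInner γ (basePt z) (verPart γ z v) (covec z)) := by
      have := mul_self_nonneg (coInner γ (basePt z) (verPart γ z v) (covec z))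
      positivity
    have := mul_nonneg hφ.le hh0
    linarith
  · have h1 := (h.posDef _ hz).dotProduct_mulVec_pos h0
    have := mul_self_nonneg (coInner γ (basePt z) (verPart γ z v) (covec z))
    have : 0 ≤ 1 / alpha γ z * (coInner γ (basePt z) (verPart γ z v) (verPart γ z v)
        + coInner γ (basePt z) (verPart γ z v) (covec z)
          * coInner γ (basePt z) (verPart γ z v) (covec z)) := by
      positivity
    have := mul_pos hφ h1
    linarith

theorem cgForm_symm (hz : z ∈ cotangentOver U) (v w : Fin n ⊕ Fin n → ℝ) :
    cgForm γ φ z v w = cgForm γ φ z w v := by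
  rw [cgForm, cgForm, Finset.sum_comm, coInner_symm h.metric hz (verPart γ z v) (verPart γ z w)]
  have : ∑ y, ∑ x, γ (basePt z) x y * horPart v x * horPart w y =
      ∑ i, ∑ j, γ (basePt z) i j * horPart w i * horPart v j :=
    Finset.sum_congr rfl fun i _ => Finset.sum_congr rfl fun j _ => by
      rw [h.metric.symm _ hz j i]; ring
  rw [this]
  ring

theorem contDiffOn_inv (i j : Fin n) : ContDiffOn ℝ ∞
    (fun z : Fin n ⊕ Fin n → ℝ => (γ (basePt z))⁻¹ i j) (cotangentOver U) :=
  contDiffOn_comp_basePt (h.metric.contDiffOn_inv i j)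

theorem contDiffOn_christoffel (i j k : Fin n) : ContDiffOn ℝ ∞
    (fun z : Fin n ⊕ Fin n → ℝ => christoffel γ i j k (basePt z)) (cotangentOver U) :=
  contDiffOn_comp_basePt (h.metric.contDiffOn_christoffel i j k)

theorem contDiffOn_coInner {ξ θ : (Fin n ⊕ Fin n → ℝ) → Fin n → ℝ}
    (hξ : ∀ i, ContDiffOn ℝ ∞ (fun z => ξ z i) (cotangentOver U))
    (hθ : ∀ i, ContDiffOn ℝ ∞ (fun z => θ z i) (cotangentOver U)) :
    ContDiffOn ℝ ∞ (fun z => coInner γ (basePt z) (ξ z) (θ z)) (cotangentOver U) :=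
  ContDiffOn.sum fun i _ => ContDiffOn.sum fun j _ => ((h.contDiffOn_inv i j).mul (hξ i)).mul (hθ j)

theorem contDiffOn_alpha : ContDiffOn ℝ ∞ (alpha γ) (cotangentOver U) :=
  contDiffOn_const.add (h.contDiffOn_coInner (fun i => (contDiff_covec i).contDiffOn)
    fun i => (contDiff_covec i).contDiffOn)

theorem contDiffOn_frame (a b : Fin n ⊕ Fin n) :
    ContDiffOn ℝ ∞ (fun z => frame γ a z b) (cotangentOver U) := by
  rcases a with a | a
  · rcases b with b | b
    · simp only [frame, Sum.elim_inl, frameH_inl]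
      exact contDiffOn_const
    · simp only [frame, Sum.elim_inl, frameH_inr]
      exact ContDiffOn.sum fun k _ => (contDiff_covec k).contDiffOn.mul (h.contDiffOn_christoffel _ _ _)
  · rcases b with b | b
    · simp only [frame, Sum.elim_inr, frameV_inl]
      exact contDiffOn_const
    · simp only [frame, Sum.elim_inr, frameV_inr]
      exact contDiffOn_const

theorem isMetricOn_cgMetric : IsMetricOn (cgMetric γ φ) (cotangentOver U) where
  isOpen := isOpen_cotangentOver h.metric.isOpen
  contDiffOn a b := by
    have hv : ∀ (a : Fin n ⊕ Fin n) (i : Fin n), ContDiffOn ℝ ∞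
        (fun z => verPart γ z (Pi.single a 1) i) (cotangentOver U) := fun a i =>
      contDiffOn_const.sub (ContDiffOn.sum fun k _ => ContDiffOn.sum fun j _ =>
        ((contDiff_covec k).contDiffOn.mul (h.contDiffOn_christoffel i j k)).mul contDiffOn_const)
    have hp : ∀ i : Fin n, ContDiffOn ℝ ∞ (fun z : Fin n ⊕ Fin n → ℝ => covec z i)
      (cotangentOver U) := fun i => (contDiff_covec i).contDiffOn
    exact ((contDiffOn_comp_basePt h.contDiffOn).mul (ContDiffOn.sum fun i _ =>
      ContDiffOn.sum fun j _ => ((contDiffOn_comp_basePt (h.metric.contDiffOn i j)).mul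
        contDiffOn_const).mul contDiffOn_const)).add
      ((contDiffOn_const.div h.contDiffOn_alpha fun z hz => (h.alpha_pos hz).ne').mul
        ((h.contDiffOn_coInner (hv a) (hv b)).add
          ((h.contDiffOn_coInner (hv a) hp).mul (h.contDiffOn_coInner (hv b) hp))))
  symm z hz a b := h.cgForm_symm hz _ _
  isUnit z hz := by
    have : (cgMetric γ φ z).PosDef := by
      refine Matrix.PosDef.of_dotProduct_mulVec_pos ?_ fun v hv => ?_
      · ext a b
        exact h.cgForm_symm hz _ _
      · have := h.cgForm_self_pos hz hv
        rw [← toBilin'_cgMetric, Matrix.toBilin'_apply'] at this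
        simpa using this
    exact this.det_pos.ne'.isUnit

/-- The frame spans, so such a v is orthogonal to itself. This is the nondegeneracy hypothesis of
`IsMetricOn.nabla_frame`. -/
theorem eq_zero_of_frame (hz : z ∈ cotangentOver U) (v : Fin n ⊕ Fin n → ℝ)
    (hv : ∀ a, Matrix.toBilin' (cgMetric γ φ z) v (frame γ a z) = 0) : v = 0 := by
  by_contra hne
  have := h.cgForm_self_pos hz hne
  rw [← toBilin'_cgMetric] at this
  have e : ∀ w, Matrix.toBilin' (cgMetric γ φ z) v w = 0 := fun w => by
    rw [eq_sum_frame γ z w, map_sum]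
    exact Finset.sum_eq_zero fun a _ => by rw [map_smul, hv, smul_zero]
  exact this.ne' (e v)

end IsRescaledMetricOn

end CotangentMetric

/-! ### Derivatives along the horizontal and vertical frame fields. -/

section FrameDerivatives

variable {n : ℕ} {γ : (Fin n → ℝ) → Matrix (Fin n) (Fin n) ℝ} {φ : (Fin n → ℝ) → ℝ}
  {U : Set (Fin n → ℝ)} {z : Fin n ⊕ Fin n → ℝ}

/-- `p_a R_{ijm}^a` -/
def curvP (γ : (Fin n → ℝ) → Matrix (Fin n) (Fin n) ℝ) (i j m : Fin n)
    (z : Fin n ⊕ Fin n → ℝ) : ℝ :=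
  ∑ a, covec z a * riem γ i j m a (basePt z)

/-- `p_a Q^k_j^{i a}`, where `Q` is `riemUpUp`. -/
def curvUpP (γ : (Fin n → ℝ) → Matrix (Fin n) (Fin n) ℝ) (k j i : Fin n)
    (z : Fin n ⊕ Fin n → ℝ) : ℝ :=
  ∑ a, covec z a * riemUpUp γ k j i a (basePt z)

/-- `1/(2fα)` -/
def mixedCoeff (γ : (Fin n → ℝ) → Matrix (Fin n) (Fin n) ℝ) (φ : (Fin n → ℝ) → ℝ)
    (z : Fin n ⊕ Fin n → ℝ) : ℝ :=
  (2 * φ (basePt z) * alpha γ z)⁻¹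

theorem nablaRiem_eq (γ : (Fin n → ℝ) → Matrix (Fin n) (Fin n) ℝ) (l i j m t : Fin n)
    (x : Fin n → ℝ) : nablaRiem γ l i j m t x = pd l (riem γ i j m t) x
      + (∑ k, christoffel γ l k t x * riem γ i j m k x)
      - ((∑ k, christoffel γ l i k x * riem γ k j m t x)
        + (∑ k, christoffel γ l j k x * riem γ i k m t x)
        + ∑ k, christoffel γ l m k x * riem γ i j k t x) := by
  simp [nablaRiem, nablaTensor, Fin.sum_univ_succ, Function.update, add_assoc]

theorem nablaRiemUpUp_eq (γ : (Fin n → ℝ) → Matrix (Fin n) (Fin n) ℝ) (l k j i t : Fin n)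
    (x : Fin n → ℝ) : nablaRiemUpUp γ l k j i t x = pd l (riemUpUp γ k j i t) x
      + ((∑ s, christoffel γ l s k x * riemUpUp γ s j i t x)
        + (∑ s, christoffel γ l s i x * riemUpUp γ k j s t x)
        + ∑ s, christoffel γ l s t x * riemUpUp γ k j i s x)
      - ∑ s, christoffel γ l j s x * riemUpUp γ k s i t x := by
  simp [nablaRiemUpUp, nablaTensor, Fin.sum_univ_succ, Function.update, add_assoc]

theorem nablaA_eq (γ : (Fin n → ℝ) → Matrix (Fin n) (Fin n) ℝ) (φ : (Fin n → ℝ) → ℝ)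
    (l i j m : Fin n) (x : Fin n → ℝ) : nablaA γ φ l i j m x = pd l (tensorA γ φ i j m) x
      + (∑ k, christoffel γ l k m x * tensorA γ φ i j k x)
      - ((∑ k, christoffel γ l i k x * tensorA γ φ k j m x)
        + ∑ k, christoffel γ l j k x * tensorA γ φ i k m x) := by
  simp [nablaA, nablaTensor, Fin.sum_univ_succ, Function.update]

theorem hasFDerivAt_basePt (z : Fin n ⊕ Fin n → ℝ) : HasFDerivAt basePt
    (ContinuousLinearMap.pi fun i => ContinuousLinearMap.proj (R := ℝ) (Sum.inl i) :
      (Fin n ⊕ Fin n → ℝ) →L[ℝ] Fin n → ℝ) z :=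
  ContinuousLinearMap.hasFDerivAt
    (ContinuousLinearMap.pi fun i => ContinuousLinearMap.proj (R := ℝ) (Sum.inl i) :
      (Fin n ⊕ Fin n → ℝ) →L[ℝ] Fin n → ℝ)

theorem hasDirDerivAt_comp_basePt {F : (Fin n → ℝ) → ℝ} (hF : DifferentiableAt ℝ F (basePt z))
    (v : Fin n ⊕ Fin n → ℝ) : HasDirDerivAt (fun y => F (basePt y))
      (fderiv ℝ F (basePt z) (horPart v)) v z := by
  have := hF.hasFDerivAt.comp z (hasFDerivAt_basePt z)
  exact ⟨this.differentiableAt, congrFun (congrArg DFunLike.coe this.fderiv) v⟩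

theorem hasDirDerivAt_covec (a : Fin n) (v : Fin n ⊕ Fin n → ℝ) :
    HasDirDerivAt (fun y => covec y a) (v (Sum.inr a)) v z := by
  have := ContinuousLinearMap.hasFDerivAt (x := z)
    (ContinuousLinearMap.proj (R := ℝ) (Sum.inr a) : (Fin n ⊕ Fin n → ℝ) →L[ℝ] ℝ)
  exact ⟨this.differentiableAt, congrFun (congrArg DFunLike.coe this.fderiv) v⟩

theorem horPart_frameH (l : Fin n) : horPart (frameH γ l z) = Pi.single l 1 := by
  funext i
  rw [horPart, frameH_inl, Pi.single_apply]

theorem horPart_frameV (l : Fin n) : horPart (frameV l z) = 0 := by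
  funext i
  rw [horPart, frameV_inl, Pi.zero_apply]

theorem hasDirDerivAt_frameH_base {F : (Fin n → ℝ) → ℝ} (hF : DifferentiableAt ℝ F (basePt z))
    (l : Fin n) : HasDirDerivAt (fun y => F (basePt y)) (pd l F (basePt z)) (frameH γ l z) z :=
  (hasDirDerivAt_comp_basePt hF _).congr_deriv (by rw [horPart_frameH, pd])

theorem hasDirDerivAt_frameV_base {F : (Fin n → ℝ) → ℝ} (hF : DifferentiableAt ℝ F (basePt z))
    (l : Fin n) : HasDirDerivAt (fun y => F (basePt y)) 0 (frameV l z) z :=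
  (hasDirDerivAt_comp_basePt hF _).congr_deriv (by rw [horPart_frameV, map_zero])

theorem hasDirDerivAt_frameH_covec (l a : Fin n) : HasDirDerivAt (fun y => covec y a)
    (∑ h, covec z h * christoffel γ a l h (basePt z)) (frameH γ l z) z :=
  (hasDirDerivAt_covec a _).congr_deriv (frameH_inr l a)

theorem hasDirDerivAt_frameV_covec (l a : Fin n) : HasDirDerivAt (fun y => covec y a)
    (if a = l then 1 else 0) (frameV l z) z :=
  (hasDirDerivAt_covec a _).congr_deriv (frameV_inr l a)

theorem hasDirDerivAt_frameV_contract {T : Fin n → (Fin n → ℝ) → ℝ}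
    (hT : ∀ a, DifferentiableAt ℝ (T a) (basePt z)) (l : Fin n) :
    HasDirDerivAt (fun y => ∑ a, covec y a * T a (basePt y)) (T l (basePt z)) (frameV l z) z :=
  (HasDirDerivAt.sum fun a _ => (hasDirDerivAt_frameV_covec l a).mul
    (hasDirDerivAt_frameV_base (hT a) l)).congr_deriv (by simp)

namespace IsRescaledMetricOn

variable (h : IsRescaledMetricOn γ φ U) (hz : z ∈ cotangentOver U)
include h hz

theorem differentiableAt_inv (i j : Fin n) :
    DifferentiableAt ℝ (fun y => (γ y)⁻¹ i j) (basePt z) :=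
  (h.metric.contDiffOn_inv i j).differentiableAt_of_isOpen h.metric.isOpen hz

theorem differentiableAt_christoffel (i j k : Fin n) :
    DifferentiableAt ℝ (christoffel γ i j k) (basePt z) :=
  (h.metric.contDiffOn_christoffel i j k).differentiableAt_of_isOpen h.metric.isOpen hz

theorem differentiableAt_riem (i j l s : Fin n) :
    DifferentiableAt ℝ (riem γ i j l s) (basePt z) :=
  (h.metric.contDiffOn_riem i j l s).differentiableAt_of_isOpen h.metric.isOpen hz

theorem differentiableAt_riemUpUp (i j l s : Fin n) :
    DifferentiableAt ℝ (riemUpUp γ i j l s) (basePt z) :=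
  (h.metric.contDiffOn_riemUpUp i j l s).differentiableAt_of_isOpen h.metric.isOpen hz

theorem differentiableAt_fun : DifferentiableAt ℝ φ (basePt z) :=
  h.contDiffOn.differentiableAt_of_isOpen h.metric.isOpen hz

omit hz in
theorem contDiffOn_tensorA (i j k : Fin n) : ContDiffOn ℝ ∞ (tensorA γ φ i j k) U :=
  (contDiffOn_const.div (contDiffOn_const.mul h.contDiffOn)
    fun x hx => (mul_pos two_pos (h.pos x hx)).ne').mul
    ((((h.contDiffOn.pd h.metric.isOpen i).mul contDiffOn_const).add
      ((h.contDiffOn.pd h.metric.isOpen j).mul contDiffOn_const)).sub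
      ((ContDiffOn.sum fun m _ => (h.metric.contDiffOn_inv k m).mul
        (h.contDiffOn.pd h.metric.isOpen m)).mul (h.metric.contDiffOn i j)))

theorem differentiableAt_tensorA (i j k : Fin n) :
    DifferentiableAt ℝ (tensorA γ φ i j k) (basePt z) :=
  (h.contDiffOn_tensorA i j k).differentiableAt_of_isOpen h.metric.isOpen hz

/-- E_l moves p_a by p_h Γ_{al}^h, which is precisely the Christoffel correction for the upper index
contracted with p. That index is therefore differentiated covariantly. -/
theorem hasDirDerivAt_frameH_contract {T : Fin n → (Fin n → ℝ) → ℝ}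
    (hT : ∀ a, DifferentiableAt ℝ (T a) (basePt z)) (l : Fin n) :
    HasDirDerivAt (fun y => ∑ a, covec y a * T a (basePt y))
      (∑ a, covec z a * (pd l (T a) (basePt z)
        + ∑ k, christoffel γ l k a (basePt z) * T k (basePt z))) (frameH γ l z) z := by
  refine (HasDirDerivAt.sum fun a _ => (hasDirDerivAt_frameH_covec l a).mul
    (hasDirDerivAt_frameH_base (hT a) l)).congr_deriv ?_
  simp only [mul_add, Finset.sum_add_distrib, Finset.sum_mul, Finset.mul_sum]
  rw [Finset.sum_comm, add_comm]
  congr 1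
  refine Finset.sum_congr rfl fun a _ => Finset.sum_congr rfl fun k _ => ?_
  rw [h.metric.christoffel_symm hz k l a]
  ring

/-- The contracted index is absorbed by the motion of p; the three free lower indices leave
Christoffel terms, which cancel in the curvature. -/
theorem hasDirDerivAt_frameH_curvP (l i j m : Fin n) : HasDirDerivAt (curvP γ i j m)
    ((∑ a, covec z a * nablaRiem γ l i j m a (basePt z))
      + ∑ k, (christoffel γ l i k (basePt z) * curvP γ k j m z
        + christoffel γ l j k (basePt z) * curvP γ i k m z
        + christoffel γ l m k (basePt z) * curvP γ i j k z)) (frameH γ l z) z := by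
  refine (h.hasDirDerivAt_frameH_contract hz (fun a => h.differentiableAt_riem hz i j m a)
    l).congr_deriv ?_
  have e : ∀ a, covec z a * (pd l (riem γ i j m a) (basePt z)
      + ∑ k, christoffel γ l k a (basePt z) * riem γ i j m k (basePt z)) =
      covec z a * nablaRiem γ l i j m a (basePt z)
        + ∑ k, (christoffel γ l i k (basePt z) * (covec z a * riem γ k j m a (basePt z))
        + christoffel γ l j k (basePt z) * (covec z a * riem γ i k m a (basePt z))
        + christoffel γ l m k (basePt z) * (covec z a * riem γ i j k a (basePt z))) := by
    intro a
    rw [nablaRiem_eq]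
    simp only [mul_add, mul_sub, Finset.mul_sum, Finset.sum_add_distrib, mul_left_comm (covec z a)]
    ring
  rw [Finset.sum_congr rfl fun a _ => e a, Finset.sum_add_distrib, Finset.sum_comm]
  simp only [curvP, Finset.mul_sum, Finset.sum_add_distrib]

theorem hasDirDerivAt_frameV_curvP (l i j m : Fin n) : HasDirDerivAt (curvP γ i j m)
    (riem γ i j m l (basePt z)) (frameV l z) z :=
  hasDirDerivAt_frameV_contract (fun a => h.differentiableAt_riem hz i j m a) l

theorem hasDirDerivAt_frameH_curvUpP (l k j i : Fin n) : HasDirDerivAt (curvUpP γ k j i)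
    ((∑ a, covec z a * nablaRiemUpUp γ l k j i a (basePt z))
      + ∑ s, (christoffel γ l j s (basePt z) * curvUpP γ k s i z
        - christoffel γ l s k (basePt z) * curvUpP γ s j i z
        - christoffel γ l s i (basePt z) * curvUpP γ k j s z)) (frameH γ l z) z := by
  refine (h.hasDirDerivAt_frameH_contract hz (fun a => h.differentiableAt_riemUpUp hz k j i a)
    l).congr_deriv ?_
  have e : ∀ a, covec z a * (pd l (riemUpUp γ k j i a) (basePt z)
      + ∑ s, christoffel γ l s a (basePt z) * riemUpUp γ k j i s (basePt z)) =
      covec z a * nablaRiemUpUp γ l k j i a (basePt z)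
        + ∑ s, (christoffel γ l j s (basePt z) * (covec z a * riemUpUp γ k s i a (basePt z))
        - christoffel γ l s k (basePt z) * (covec z a * riemUpUp γ s j i a (basePt z))
        - christoffel γ l s i (basePt z) * (covec z a * riemUpUp γ k j s a (basePt z))) := by
    intro a
    rw [nablaRiemUpUp_eq]
    simp only [mul_add, mul_sub, Finset.mul_sum, Finset.sum_sub_distrib, mul_left_comm (covec z a)]
    ring
  rw [Finset.sum_congr rfl fun a _ => e a, Finset.sum_add_distrib, Finset.sum_comm]
  simp only [curvUpP, Finset.mul_sum, Finset.sum_sub_distrib]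

theorem hasDirDerivAt_frameV_curvUpP (l k j i : Fin n) : HasDirDerivAt (curvUpP γ k j i)
    (riemUpUp γ k j i l (basePt z)) (frameV l z) z :=
  hasDirDerivAt_frameV_contract (fun a => h.differentiableAt_riemUpUp hz k j i a) l

/-- The inverse metric is parallel: one of its two Christoffel terms cancels the motion of p, the
other remains on the free index. -/
theorem hasDirDerivAt_frameH_covecUp (l i : Fin n) : HasDirDerivAt (fun y => covecUp γ y i)
    (-∑ k, christoffel γ l k i (basePt z) * covecUp γ z k) (frameH γ l z) z := by
  refine ((h.hasDirDerivAt_frameH_contract hz (fun a => h.differentiableAt_inv hz i a)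
    l).congr_of_eventuallyEq (Filter.Eventually.of_forall fun y => ?_)).congr_deriv ?_
  · exact Finset.sum_congr rfl fun a _ => mul_comm _ _
  · simp only [covecUp, Finset.mul_sum, ← Finset.sum_neg_distrib]
    rw [Finset.sum_comm]
    refine Finset.sum_congr rfl fun a _ => ?_
    rw [h.metric.pd_inv hz]
    have : ∑ k, christoffel γ l k a (basePt z) * (γ (basePt z))⁻¹ i k =
        ∑ k, christoffel γ l k a (basePt z) * (γ (basePt z))⁻¹ k i :=
      Finset.sum_congr rfl fun k _ => by rw [h.metric.inv_symm hz]
    rw [this, sub_add_cancel, mul_neg, Finset.mul_sum, ← Finset.sum_neg_distrib]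
    exact Finset.sum_congr rfl fun k _ => by ring

theorem hasDirDerivAt_frameV_covecUp (l i : Fin n) : HasDirDerivAt (fun y => covecUp γ y i)
    ((γ (basePt z))⁻¹ i l) (frameV l z) z :=
  (hasDirDerivAt_frameV_contract (fun a => h.differentiableAt_inv hz i a) l).congr_of_eventuallyEq
    (Filter.Eventually.of_forall fun _ => Finset.sum_congr rfl fun _ _ => mul_comm _ _)

/-- Horizontal motion is parallel transport of p, which preserves its norm. -/
theorem hasDirDerivAt_frameH_alpha (l : Fin n) : HasDirDerivAt (alpha γ) 0 (frameH γ l z) z := by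
  refine (((HasDirDerivAt.const 1 _ z).add (HasDirDerivAt.sum fun i _ =>
    (hasDirDerivAt_frameH_covec l i).mul
      (h.hasDirDerivAt_frameH_covecUp hz l i))).congr_of_eventuallyEq
    (Filter.Eventually.of_forall fun y => alpha_eq γ y)).congr_deriv ?_
  simp only [Finset.sum_add_distrib, Finset.sum_mul, mul_neg, Finset.mul_sum,
    Finset.sum_neg_distrib, zero_add]
  rw [Finset.sum_comm, ← sub_eq_add_neg, sub_eq_zero]
  refine Finset.sum_congr rfl fun i _ => Finset.sum_congr rfl fun k _ => ?_
  rw [h.metric.christoffel_symm hz k l i]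
  ring

theorem sum_covec_inv (l : Fin n) :
    ∑ i, covec z i * (γ (basePt z))⁻¹ i l = covecUp γ z l :=
  Finset.sum_congr rfl fun i _ => by rw [h.metric.inv_symm hz, mul_comm]

theorem hasDirDerivAt_frameV_alpha (l : Fin n) :
    HasDirDerivAt (alpha γ) (2 * covecUp γ z l) (frameV l z) z := by
  refine (((HasDirDerivAt.const 1 _ z).add (HasDirDerivAt.sum fun i _ =>
    (hasDirDerivAt_frameV_covec l i).mul
      (h.hasDirDerivAt_frameV_covecUp hz l i))).congr_of_eventuallyEq
    (Filter.Eventually.of_forall fun y => alpha_eq γ y)).congr_deriv ?_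
  rw [Finset.sum_add_distrib, h.sum_covec_inv hz]
  simp
  ring

/-- As α is constant in horizontal directions, only f contributes; this is the source of every f_l/f
in the curvature. -/
theorem hasDirDerivAt_frameH_mixedCoeff (l : Fin n) : HasDirDerivAt (mixedCoeff γ φ)
    (-(pd l φ (basePt z) / φ (basePt z)) * mixedCoeff γ φ z) (frameH γ l z) z := by
  have hα := (h.alpha_pos hz).ne'
  have hφ := (h.pos _ hz).ne'
  refine ((((hasDirDerivAt_frameH_base (h.differentiableAt_fun hz) l).const_mul 2).mul
    (h.hasDirDerivAt_frameH_alpha hz l)).inv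
      (mul_ne_zero (mul_ne_zero two_ne_zero hφ) hα)).congr_deriv ?_
  rw [mixedCoeff]
  field_simp
  ring

theorem hasDirDerivAt_frameV_mixedCoeff (l : Fin n) : HasDirDerivAt (mixedCoeff γ φ)
    (-(2 * covecUp γ z l / alpha γ z) * mixedCoeff γ φ z) (frameV l z) z := by
  have hα := (h.alpha_pos hz).ne'
  have hφ := (h.pos _ hz).ne'
  refine ((((hasDirDerivAt_frameV_base (h.differentiableAt_fun hz) l).const_mul 2).mul
    (h.hasDirDerivAt_frameV_alpha hz l)).inv
      (mul_ne_zero (mul_ne_zero two_ne_zero hφ) hα)).congr_deriv ?_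
  rw [mixedCoeff]
  field_simp
  ring

theorem hasDirDerivAt_frameH_inv (l i j : Fin n) :
    HasDirDerivAt (fun y : Fin n ⊕ Fin n → ℝ => (γ (basePt y))⁻¹ i j)
      (-(∑ k, christoffel γ l k i (basePt z) * (γ (basePt z))⁻¹ k j)
        - ∑ k, christoffel γ l k j (basePt z) * (γ (basePt z))⁻¹ k i) (frameH γ l z) z :=
  (hasDirDerivAt_frameH_base (h.differentiableAt_inv hz i j) l).congr_deriv
    (h.metric.pd_inv hz l i j)

theorem hasDirDerivAt_frameV_inv (l i j : Fin n) :
    HasDirDerivAt (fun y : Fin n ⊕ Fin n → ℝ => (γ (basePt y))⁻¹ i j) 0 (frameV l z) z :=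
  hasDirDerivAt_frameV_base (h.differentiableAt_inv hz i j) l

end IsRescaledMetricOn

end FrameDerivatives

/-! ### The Levi-Civita connection of the rescaled metric in the adapted frame. -/

section Connection

variable {n : ℕ} {γ : (Fin n → ℝ) → Matrix (Fin n) (Fin n) ℝ} {φ : (Fin n → ℝ) → ℝ}
  {U : Set (Fin n → ℝ)} {z : Fin n ⊕ Fin n → ℝ}

/-- The coefficients of the Levi-Civita connection on vertical vector fields. -/
def vertCoeff (γ : (Fin n → ℝ) → Matrix (Fin n) (Fin n) ℝ) (i j m : Fin n)
    (z : Fin n ⊕ Fin n → ℝ) : ℝ :=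
  -((alpha γ z)⁻¹ * (covecUp γ z i * (if m = j then 1 else 0)
      + covecUp γ z j * (if m = i then 1 else 0)))
    + ((alpha γ z)⁻¹ + (alpha γ z)⁻¹ * (alpha γ z)⁻¹) * ((γ (basePt z))⁻¹ i j * covec z m)
    + (alpha γ z)⁻¹ * (alpha γ z)⁻¹ * (covecUp γ z i * covecUp γ z j * covec z m)

/-- `p_a S_{ij}^{k a}`, where `S` is `riemUp`. -/
def curvMidP (γ : (Fin n → ℝ) → Matrix (Fin n) (Fin n) ℝ) (i j k : Fin n)
    (z : Fin n ⊕ Fin n → ℝ) : ℝ :=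
  ∑ a, covec z a * riemUp γ i j k a (basePt z)

/-- The coefficients of the Levi-Civita connection of the rescaled metric in the adapted frame. -/
def frameCoeff (γ : (Fin n → ℝ) → Matrix (Fin n) (Fin n) ℝ) (φ : (Fin n → ℝ) → ℝ) :
    Fin n ⊕ Fin n → Fin n ⊕ Fin n → Fin n ⊕ Fin n → (Fin n ⊕ Fin n → ℝ) → ℝ
  | .inl i, .inl j, .inl m => fun z =>
      christoffel γ i j m (basePt z) + tensorA γ φ i j m (basePt z)
  | .inl i, .inl j, .inr m => fun z => 1 / 2 * curvP γ i j m z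
  | .inl i, .inr j, .inl m => fun z => mixedCoeff γ φ z * curvUpP γ m i j z
  | .inl i, .inr j, .inr m => fun z => -christoffel γ i m j (basePt z)
  | .inr i, .inl j, .inl m => fun z => mixedCoeff γ φ z * curvUpP γ m j i z
  | .inr _, .inl _, .inr _ => fun _ => 0
  | .inr _, .inr _, .inl _ => fun _ => 0
  | .inr i, .inr j, .inr m => vertCoeff γ i j m

theorem curvP_antisymm (i j m : Fin n) : curvP γ i j m z = -curvP γ j i m z := by
  simp only [curvP, riem_antisymm γ i j, mul_neg, Finset.sum_neg_distrib]

theorem curvMidP_antisymm (i j m : Fin n) : curvMidP γ i j m z = -curvMidP γ j i m z := by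
  simp only [curvMidP, riemUp_antisymm γ i j, mul_neg, Finset.sum_neg_distrib]

/-- The contraction of a skew-symmetric family with `p` in both indices vanishes. -/
theorem sum_sum_mul_mul_eq_zero {T : Fin n → Fin n → ℝ} (hT : ∀ a b, T a b = -T b a)
    (p : Fin n → ℝ) : ∑ a, p a * ∑ b, p b * T a b = 0 := by
  have e : ∑ a, p a * ∑ b, p b * T a b = -∑ a, p a * ∑ b, p b * T a b := by
    simp only [Finset.mul_sum, ← Finset.sum_neg_distrib]
    rw [Finset.sum_comm]
    exact Finset.sum_congr rfl fun a _ => Finset.sum_congr rfl fun b _ => by rw [hT]; ring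
  linarith

namespace IsRescaledMetricOn

variable (h : IsRescaledMetricOn γ φ U) (hz : z ∈ cotangentOver U)
include h hz

theorem vertMetric_symm (i j : Fin n) : vertMetric γ i j z = vertMetric γ j i z := by
  rw [vertMetric, vertMetric, h.metric.inv_symm hz i j]
  ring

theorem vertCoeff_symm (i j m : Fin n) : vertCoeff γ i j m z = vertCoeff γ j i m z := by
  rw [vertCoeff, vertCoeff, h.metric.inv_symm hz i j]
  ring

theorem tensorA_symm (i j m : Fin n) :
    tensorA γ φ i j m (basePt z) = tensorA γ φ j i m (basePt z) := by
  rw [tensorA, tensorA, h.metric.symm _ hz i j]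
  ring

/-- With its upper index lowered, A is the Koszul expression produced by the derivatives of the
conformal factor in fg; this is the form that enters metric compatibility. -/
theorem sum_tensorA_mul (i j k : Fin n) :
    ∑ a, tensorA γ φ i j a (basePt z) * γ (basePt z) a k = (2 * φ (basePt z))⁻¹ *
      (pd i φ (basePt z) * γ (basePt z) j k + pd j φ (basePt z) * γ (basePt z) i k
        - pd k φ (basePt z) * γ (basePt z) i j) := by
  have e : ∑ a, (∑ m, (γ (basePt z))⁻¹ a m * pd m φ (basePt z)) * γ (basePt z) a k =
      pd k φ (basePt z) := by
    simp only [Finset.sum_mul]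
    rw [Finset.sum_comm]
    have : ∀ m, ∑ a, (γ (basePt z))⁻¹ a m * pd m φ (basePt z) * γ (basePt z) a k =
        pd m φ (basePt z) * if m = k then 1 else 0 := fun m => by
      rw [← h.metric.sum_inv_mul hz, Finset.mul_sum]
      exact Finset.sum_congr rfl fun a _ => by rw [h.metric.inv_symm hz a m]; ring
    simp [this]
  have e2 : ∀ a, tensorA γ φ i j a (basePt z) * γ (basePt z) a k = (2 * φ (basePt z))⁻¹ *
      (pd i φ (basePt z) * ((if j = a then 1 else 0) * γ (basePt z) a k)
      + pd j φ (basePt z) * ((if i = a then 1 else 0) * γ (basePt z) a k)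
      - γ (basePt z) i j * ((∑ m, (γ (basePt z))⁻¹ a m * pd m φ (basePt z))
        * γ (basePt z) a k)) := fun a => by
    rw [tensorA]
    ring
  simp only [e2, ← Finset.mul_sum, Finset.sum_add_distrib, Finset.sum_sub_distrib, e, ite_mul,
    one_mul, zero_mul, Finset.sum_ite_eq, Finset.mem_univ, if_true]
  ring

/-- `R_{ijm}^a p_a p^m = 0` -/
theorem sum_curvP_mul_covecUp (i j : Fin n) : ∑ m, curvP γ i j m z * covecUp γ z m = 0 := by
  have e : ∑ m, curvP γ i j m z * covecUp γ z m = ∑ k, covec z k * curvMidP γ i j k z := by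
    simp only [curvP, curvMidP, covecUp, riemUp, Finset.mul_sum, Finset.sum_mul]
    rw [Finset.sum_comm]
    refine Finset.sum_congr rfl fun k _ => ?_
    rw [Finset.sum_comm]
    exact Finset.sum_congr rfl fun a _ => Finset.sum_congr rfl fun m _ => by
      rw [h.metric.inv_symm hz k m]; ring
  rw [e]
  exact sum_sum_mul_mul_eq_zero (fun a b => h.metric.riemUp_skew hz i j a b) _

theorem sum_curvP_mul_inv (i j k : Fin n) :
    ∑ m, curvP γ i j m z * (γ (basePt z))⁻¹ m k = curvMidP γ i j k z := by
  simp only [curvP, curvMidP, riemUp, Finset.mul_sum, Finset.sum_mul]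
  rw [Finset.sum_comm]
  exact Finset.sum_congr rfl fun a _ => Finset.sum_congr rfl fun m _ => by
    rw [h.metric.inv_symm hz k m]; ring

/-- Lowering an index of p Q with the base metric gives the same `curvMidP` as raising an index of p
R in `sum_curvP_mul_inv`; this makes the two mixed connection coefficients adjoint. -/
theorem sum_mul_curvUpP (i j k : Fin n) :
    ∑ m, γ (basePt z) j m * curvUpP γ m i k z = curvMidP γ j i k z := by
  simp only [curvUpP, curvMidP, Finset.mul_sum]
  rw [Finset.sum_comm]
  refine Finset.sum_congr rfl fun a _ => ?_
  have e : ∀ m, γ (basePt z) j m * (covec z a * riemUpUp γ m i k a (basePt z)) =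
      ∑ t, covec z a * riemUp γ t i k a (basePt z)
        * (γ (basePt z) j m * (γ (basePt z))⁻¹ m t) := fun m => by
    rw [riemUpUp_eq_sum]
    simp only [Finset.mul_sum]
    exact Finset.sum_congr rfl fun t _ => by ring
  simp only [e]
  rw [Finset.sum_comm]
  simp only [← Finset.mul_sum, h.metric.sum_mul_inv hz]
  simp

/-- Q is skew in its last two indices. In the curvature this kills the part of `vertCoeff`
proportional to p. -/
theorem sum_covec_mul_curvUpP (k j : Fin n) : ∑ m, covec z m * curvUpP γ k j m z = 0 :=
  sum_sum_mul_mul_eq_zero (fun a b => h.metric.riemUpUp_skew hz k j a b) _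

theorem hasDirDerivAt_frameH_inv_alpha (l : Fin n) :
    HasDirDerivAt (fun y => (alpha γ y)⁻¹) 0 (frameH γ l z) z :=
  ((h.hasDirDerivAt_frameH_alpha hz l).inv (h.alpha_pos hz).ne').congr_deriv (by simp)

theorem hasDirDerivAt_frameV_inv_alpha (l : Fin n) : HasDirDerivAt (fun y => (alpha γ y)⁻¹)
    (-(2 * covecUp γ z l * ((alpha γ z)⁻¹ * (alpha γ z)⁻¹))) (frameV l z) z :=
  ((h.hasDirDerivAt_frameV_alpha hz l).inv (h.alpha_pos hz).ne').congr_deriv (by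
    have := (h.alpha_pos hz).ne'
    field_simp)

/-- The fibre metric is built from α, g⁻¹ and p, all parallel in horizontal directions, so it is
preserved by the dual connection -Γ. -/
theorem hasDirDerivAt_frameH_vertMetric (l i j : Fin n) : HasDirDerivAt (vertMetric γ i j)
    ((∑ k, -christoffel γ l k i (basePt z) * vertMetric γ k j z)
      + ∑ k, -christoffel γ l k j (basePt z) * vertMetric γ i k z) (frameH γ l z) z := by
  refine ((h.hasDirDerivAt_frameH_inv_alpha hz l).mul ((h.hasDirDerivAt_frameH_inv hz l i j).add
    ((h.hasDirDerivAt_frameH_covecUp hz l i).mul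
      (h.hasDirDerivAt_frameH_covecUp hz l j)))).congr_deriv ?_
  simp only [zero_mul, zero_add, vertMetric, Finset.mul_sum, Finset.sum_mul,
    ← Finset.sum_neg_distrib, ← Finset.sum_add_distrib, ← Finset.sum_sub_distrib]
  exact Finset.sum_congr rfl fun k _ => by rw [h.metric.inv_symm hz k i]; ring

/-- From p_m p^m = α - 1: the factor 1 + (α - 1) cancels the prefactor 1/α. -/
theorem sum_covec_mul_vertMetric (j : Fin n) :
    ∑ m, covec z m * vertMetric γ m j z = covecUp γ z j := by
  have hα := (h.alpha_pos hz).ne'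
  have e : ∀ m, covec z m * vertMetric γ m j z = (alpha γ z)⁻¹ *
      (covec z m * (γ (basePt z))⁻¹ m j + covec z m * covecUp γ z m * covecUp γ z j) := fun m => by
    rw [vertMetric]; ring
  have e2 : ∑ m, covec z m * covecUp γ z m = alpha γ z - 1 := by rw [alpha_eq]; ring
  simp only [e, ← Finset.mul_sum, Finset.sum_add_distrib, h.sum_covec_inv hz, ← Finset.sum_mul, e2]
  field_simp
  ring

theorem sum_vertCoeff_mul_vertMetric (l i j : Fin n) :
    ∑ m, vertCoeff γ l i m z * vertMetric γ m j z =
      -((alpha γ z)⁻¹ * (covecUp γ z l * vertMetric γ i j z + covecUp γ z i * vertMetric γ l j z))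
      + (((alpha γ z)⁻¹ + (alpha γ z)⁻¹ * (alpha γ z)⁻¹) * (γ (basePt z))⁻¹ l i
        + (alpha γ z)⁻¹ * (alpha γ z)⁻¹ * (covecUp γ z l * covecUp γ z i)) * covecUp γ z j := by
  have e : ∀ m, vertCoeff γ l i m z * vertMetric γ m j z =
      -((alpha γ z)⁻¹ * (covecUp γ z l * ((if m = i then 1 else 0) * vertMetric γ m j z)
        + covecUp γ z i * ((if m = l then 1 else 0) * vertMetric γ m j z)))
      + (((alpha γ z)⁻¹ + (alpha γ z)⁻¹ * (alpha γ z)⁻¹) * (γ (basePt z))⁻¹ l i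
        + (alpha γ z)⁻¹ * (alpha γ z)⁻¹ * (covecUp γ z l * covecUp γ z i))
        * (covec z m * vertMetric γ m j z) := fun m => by rw [vertCoeff]; ring
  simp only [e, Finset.sum_add_distrib, Finset.sum_neg_distrib, ← Finset.mul_sum,
    h.sum_covec_mul_vertMetric hz]
  simp

theorem hasDirDerivAt_frameV_vertMetric (l i j : Fin n) : HasDirDerivAt (vertMetric γ i j)
    ((∑ m, vertCoeff γ l i m z * vertMetric γ m j z)
      + ∑ m, vertCoeff γ l j m z * vertMetric γ i m z) (frameV l z) z := by
  refine ((h.hasDirDerivAt_frameV_inv_alpha hz l).mul ((h.hasDirDerivAt_frameV_inv hz l i j).add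
    ((h.hasDirDerivAt_frameV_covecUp hz l i).mul
      (h.hasDirDerivAt_frameV_covecUp hz l j)))).congr_deriv ?_
  simp only [h.vertMetric_symm hz i, h.sum_vertCoeff_mul_vertMetric hz]
  simp only [vertMetric, h.metric.inv_symm hz l, h.metric.inv_symm hz j i]
  ring

theorem contDiffOn_frame_apply (a b : Fin n ⊕ Fin n) :
    DifferentiableAt ℝ (fun y => frame γ a y b) z :=
  (h.contDiffOn_frame a b).differentiableAt_of_isOpen (isOpen_cotangentOver h.metric.isOpen) hz

/-- The brackets are [E_i, E_j] = p_a R_{ijm}^a E_m̄ and [E_i, E_j̄] = -Γ_{im}^j E_m̄, with vertical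
fields commuting. The pieces Γ, A and `vertCoeff` are symmetric and p R / 2 is skew, so its
antisymmetrization restores the full p R. -/
theorem frameCoeff_torsion (a b : Fin n ⊕ Fin n) :
    VectorField.lieBracket ℝ (frame γ a) (frame γ b) z =
      ∑ c, (frameCoeff γ φ a b c z - frameCoeff γ φ b a c z) • frame γ c z := by
  have hV : ∀ (j : Fin n) (c : Fin n ⊕ Fin n) (v : Fin n ⊕ Fin n → ℝ),
      HasDirDerivAt (fun y => frameV j y c) 0 v z := by
    intro j c v
    have : (fun y : Fin n ⊕ Fin n → ℝ => frameV j y c) = fun _ => frameV j z c := by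
      funext y
      cases c
      · rw [frameV_inl, frameV_inl]
      · rw [frameV_inr, frameV_inr]
    rw [this]
    exact HasDirDerivAt.const _ _ _
  have hH : ∀ (j c : Fin n) (v : Fin n ⊕ Fin n → ℝ),
      HasDirDerivAt (fun y => frameH γ j y (Sum.inl c)) 0 v z := by
    intro j c v
    simp only [frameH_inl]
    exact HasDirDerivAt.const _ _ _
  have hHV : ∀ l j c : Fin n, HasDirDerivAt (fun y => frameH γ j y (Sum.inr c))
      (christoffel γ c j l (basePt z)) (frameV l z) z := by
    intro l j c
    simp only [frameH_inr]
    exact hasDirDerivAt_frameV_contract (fun a => h.differentiableAt_christoffel hz c j a) l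
  have hHH : ∀ l j c : Fin n, HasDirDerivAt (fun y => frameH γ j y (Sum.inr c))
      (∑ a, covec z a * (pd l (christoffel γ c j a) (basePt z)
        + ∑ k, christoffel γ l k a (basePt z) * christoffel γ c j k (basePt z)))
      (frameH γ l z) z := by
    intro l j c
    simp only [frameH_inr]
    exact h.hasDirDerivAt_frameH_contract hz (fun a => h.differentiableAt_christoffel hz c j a) l
  have hpd : ∀ l i j k, pd l (christoffel γ i j k) (basePt z) =
      pd l (christoffel γ j i k) (basePt z) := fun l i j k => by
    have : christoffel γ i j k =ᶠ[nhds (basePt z)] christoffel γ j i k :=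
      (h.metric.eventually_mem hz).mono fun y hy => h.metric.christoffel_symm hy i j k
    rw [pd, pd, this.fderiv_eq]
  have hΓ := h.metric.christoffel_symm hz
  funext c
  rw [lieBracket_apply (h.contDiffOn_frame_apply hz a) (h.contDiffOn_frame_apply hz b)]
  simp only [Fintype.sum_sum_type, Finset.sum_apply, Pi.smul_apply, smul_eq_mul]
  rcases a with i | i <;> rcases b with j | j <;> rcases c with c | c <;>
    simp only [frame, Sum.elim_inl, Sum.elim_inr]
  · rw [(hH _ _ _).fderiv_eq, (hH _ _ _).fderiv_eq]
    simp [frameCoeff, frameH_inl, frameV_inl, hΓ i j, h.tensorA_symm hz i j]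
  -- The bracket of two horizontal lifts: antisymmetrizing the horizontal derivatives of p_a
  -- Γ_{cj}^a reproduces the coordinate formula `riem_eq`.
  · rw [(hHH _ _ _).fderiv_eq, (hHH _ _ _).fderiv_eq]
    simp only [frameCoeff, frameV_inr, hΓ i j, h.tensorA_symm hz i j, sub_self, zero_mul,
      Finset.sum_const_zero, zero_add, curvP_antisymm j i]
    simp only [mul_ite, mul_one, mul_zero, Finset.sum_ite_eq, Finset.mem_univ, if_true, curvP]
    rw [← Finset.sum_sub_distrib, mul_neg, sub_neg_eq_add, ← add_mul, add_halves, one_mul]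
    refine Finset.sum_congr rfl fun a _ => ?_
    rw [h.metric.riem_eq hz, hpd i c j, hpd j c i, ← mul_sub, add_sub_add_comm,
      ← Finset.sum_sub_distrib]
    congr 2
    exact Finset.sum_congr rfl fun k _ => by rw [hΓ c j, hΓ c i]; ring
  · rw [(hH _ _ _).fderiv_eq, (hV _ _ _).fderiv_eq]
    simp [frameCoeff, frameH_inl, frameV_inl]
  · rw [(hV _ _ _).fderiv_eq, (hHV _ _ _).fderiv_eq]
    simp [frameCoeff, frameH_inr, frameV_inr, hΓ c i]
  · rw [(hH _ _ _).fderiv_eq, (hV _ _ _).fderiv_eq]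
    simp [frameCoeff, frameH_inl, frameV_inl]
  · rw [(hV _ _ _).fderiv_eq, (hHV _ _ _).fderiv_eq]
    simp [frameCoeff, frameH_inr, frameV_inr, hΓ c j]
  · rw [(hV _ _ _).fderiv_eq, (hV _ _ _).fderiv_eq]
    simp [frameCoeff, frameV_inl]
  · rw [(hV _ _ _).fderiv_eq, (hV _ _ _).fderiv_eq]
    simp [frameCoeff, frameV_inr, h.vertCoeff_symm hz i j]

theorem frameCoeff_metric (a b c : Fin n ⊕ Fin n) :
    fderiv ℝ (fun y => Matrix.toBilin' (cgMetric γ φ y) (frame γ b y) (frame γ c y)) z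
      (frame γ a z) =
    (∑ e, frameCoeff γ φ a b e z * Matrix.toBilin' (cgMetric γ φ z) (frame γ e z) (frame γ c z))
    + ∑ e, frameCoeff γ φ a c e z
      * Matrix.toBilin' (cgMetric γ φ z) (frame γ b z) (frame γ e z) := by
  have hHVz : ∀ i j, cgForm γ φ z (frameH γ i z) (frameV j z) = 0 := fun i j => by
    rw [h.cgForm_symm hz, cgForm_frameV_frameH]
  have hHVev : ∀ i j, (fun y => cgForm γ φ y (frameH γ i y) (frameV j y)) =ᶠ[nhds z] fun _ => 0 :=
    fun i j => (h.isMetricOn_cgMetric.eventually_mem hz).mono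
      fun y hy => by beta_reduce; rw [h.cgForm_symm hy, cgForm_frameV_frameH]
  have hφ := (h.pos _ hz).ne'
  have hα := (h.alpha_pos hz).ne'
  -- The factor f of the horizontal metric cancels the one in 1/(2fα), leaving 1/(2α), which matches
  -- the vertical side in `hvert`.
  have hmix : ∀ (T : Fin n → ℝ) (c : Fin n), ∑ m, mixedCoeff γ φ z * T m
      * (φ (basePt z) * γ (basePt z) m c) = 1 / 2 * (alpha γ z)⁻¹ * ∑ m, γ (basePt z) c m * T m := by
    intro T c
    rw [Finset.mul_sum]
    refine Finset.sum_congr rfl fun m _ => ?_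
    rw [mixedCoeff, h.metric.symm _ hz m c]
    field_simp
  have hmix' : ∀ (T : Fin n → ℝ) (c : Fin n), ∑ m, mixedCoeff γ φ z * T m
      * (φ (basePt z) * γ (basePt z) c m) = 1 / 2 * (alpha γ z)⁻¹ * ∑ m, γ (basePt z) c m * T m := by
    intro T c
    rw [← hmix]
    exact Finset.sum_congr rfl fun m _ => by rw [h.metric.symm _ hz m c]
  -- The p^m p^k part of the fibre metric is invisible here because p_a p^m R_{ijm}^a = 0.
  have hvert : ∀ i j k, ∑ m, 1 / 2 * curvP γ i j m z * vertMetric γ m k z =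
      1 / 2 * (alpha γ z)⁻¹ * curvMidP γ i j k z := by
    intro i j k
    have e : ∀ m, 1 / 2 * curvP γ i j m z * vertMetric γ m k z = 1 / 2 * (alpha γ z)⁻¹ *
        (curvP γ i j m z * (γ (basePt z))⁻¹ m k
          + curvP γ i j m z * covecUp γ z m * covecUp γ z k) := fun m => by
      rw [vertMetric]; ring
    simp only [e, ← Finset.mul_sum, Finset.sum_add_distrib, h.sum_curvP_mul_inv hz,
      ← Finset.sum_mul, h.sum_curvP_mul_covecUp hz]
    ring
  simp only [toBilin'_cgMetric, Fintype.sum_sum_type]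
  rcases a with i | i <;> rcases b with j | j <;> rcases c with k | k <;>
    simp only [frame, Sum.elim_inl, Sum.elim_inr, cgForm_frameV_frameH, hHVz,
      cgForm_frameH_frameH, cgForm_frameV_frameV, frameCoeff, mul_zero, zero_mul,
      Finset.sum_const_zero, add_zero, zero_add]
  · have hd := hasDirDerivAt_frameH_base (γ := γ) (F := fun x => φ x * γ x j k)
      ((h.differentiableAt_fun hz).mul ((h.metric.contDiffOn j k).differentiableAt_of_isOpen
        h.metric.isOpen hz)) i
    have hp := ((hasDirDerivAt_single (h.differentiableAt_fun hz) i).mul (hasDirDerivAt_single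
      ((h.metric.contDiffOn j k).differentiableAt_of_isOpen h.metric.isOpen hz) i)).pd_eq
    have e1 : ∀ a b, ∑ e, (christoffel γ i a e (basePt z) + tensorA γ φ i a e (basePt z))
        * (φ (basePt z) * γ (basePt z) e b) =
        φ (basePt z) * ((∑ e, christoffel γ i a e (basePt z) * γ (basePt z) e b)
          + ∑ e, tensorA γ φ i a e (basePt z) * γ (basePt z) e b) := fun a b => by
      rw [← Finset.sum_add_distrib, Finset.mul_sum]
      exact Finset.sum_congr rfl fun e _ => by ring
    have e2 : ∀ e, γ (basePt z) j e = γ (basePt z) e j := fun e => h.metric.symm _ hz j e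
    rw [hd.fderiv_eq, hp, h.metric.pd_metric hz]
    simp only [e2, e1, h.sum_tensorA_mul hz]
    rw [h.metric.symm _ hz i k, h.metric.symm _ hz i j, ← e2 k]
    field_simp
    ring
  · rw [(hHVev _ _).fderiv_eq, hvert, hmix', h.sum_mul_curvUpP hz, curvMidP_antisymm i j]
    simp
  · simp only [h.vertMetric_symm hz j]
    rw [hvert, hmix, h.sum_mul_curvUpP hz, curvMidP_antisymm k i]
    simp
  · rw [show (fun y => vertMetric γ j k y) = vertMetric γ j k from rfl,
      (h.hasDirDerivAt_frameH_vertMetric hz i j k).fderiv_eq]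
  -- The horizontal metric does not depend on p; the two mixed terms cancel by antisymmetry of R in
  -- its first pair.
  · rw [(hasDirDerivAt_frameV_base (F := fun x => φ x * γ x j k)
      ((h.differentiableAt_fun hz).mul ((h.metric.contDiffOn j k).differentiableAt_of_isOpen
        h.metric.isOpen hz)) i).fderiv_eq, hmix, hmix', h.sum_mul_curvUpP hz,
      h.sum_mul_curvUpP hz, curvMidP_antisymm j k]
    ring
  · rw [(hHVev _ _).fderiv_eq]
    simp
  · simp
  · rw [show (fun y => vertMetric γ j k y) = vertMetric γ j k from rfl,
      (h.hasDirDerivAt_frameV_vertMetric hz i j k).fderiv_eq]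

theorem nabla_frame (a b : Fin n ⊕ Fin n) : nabla (cgMetric γ φ) (frame γ a) (frame γ b) z =
    ∑ c, frameCoeff γ φ a b c z • frame γ c z :=
  h.isMetricOn_cgMetric.nabla_frame hz (h.contDiffOn_frame_apply hz) (h.eq_zero_of_frame hz)
    (Θ := fun a b c => frameCoeff γ φ a b c z) (h.frameCoeff_torsion hz)
    (h.frameCoeff_metric hz) a b

end IsRescaledMetricOn

end Connection

/-! ### The structure equation in the adapted frame, and the curvature on horizontal vectors. -/

section FrameCurvature

variable {n : ℕ} {γ : (Fin n → ℝ) → Matrix (Fin n) (Fin n) ℝ} {φ : (Fin n → ℝ) → ℝ}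
  {U : Set (Fin n → ℝ)} {z : Fin n ⊕ Fin n → ℝ}

theorem sum_vertCoeff_mul (γ : (Fin n → ℝ) → Matrix (Fin n) (Fin n) ℝ) (z : Fin n ⊕ Fin n → ℝ)
    (i j : Fin n) (X : Fin n → ℝ) : ∑ e, vertCoeff γ i j e z * X e =
      -((alpha γ z)⁻¹ * (covecUp γ z i * X j + covecUp γ z j * X i))
      + (((alpha γ z)⁻¹ + (alpha γ z)⁻¹ * (alpha γ z)⁻¹) * (γ (basePt z))⁻¹ i j
        + (alpha γ z)⁻¹ * (alpha γ z)⁻¹ * (covecUp γ z i * covecUp γ z j))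
        * ∑ e, covec z e * X e := by
  have e : ∀ m, vertCoeff γ i j m z * X m =
      -((alpha γ z)⁻¹ * (covecUp γ z i * ((if m = j then 1 else 0) * X m)
        + covecUp γ z j * ((if m = i then 1 else 0) * X m)))
      + (((alpha γ z)⁻¹ + (alpha γ z)⁻¹ * (alpha γ z)⁻¹) * (γ (basePt z))⁻¹ i j
        + (alpha γ z)⁻¹ * (alpha γ z)⁻¹ * (covecUp γ z i * covecUp γ z j))
        * (covec z m * X m) := fun m => by rw [vertCoeff]; ring
  simp only [e, Finset.sum_add_distrib, Finset.sum_neg_distrib, ← Finset.mul_sum]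
  simp

theorem sum_covec_mul_covecUp (γ : (Fin n → ℝ) → Matrix (Fin n) (Fin n) ℝ)
    (z : Fin n ⊕ Fin n → ℝ) : ∑ m, covec z m * covecUp γ z m = alpha γ z - 1 := by
  rw [alpha_eq]; ring

namespace IsRescaledMetricOn

variable (h : IsRescaledMetricOn γ φ U) (hz : z ∈ cotangentOver U)
include h hz

/-- `vertCoeff` is an algebraic expression in α, g⁻¹, p and δ, so its covariant derivative in
horizontal directions vanishes and only the Christoffel terms of its three indices remain. -/
theorem hasDirDerivAt_frameH_vertCoeff (l i j m : Fin n) : HasDirDerivAt (vertCoeff γ i j m)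
    (∑ k, (christoffel γ l m k (basePt z) * vertCoeff γ i j k z
      - christoffel γ l k i (basePt z) * vertCoeff γ k j m z
      - christoffel γ l k j (basePt z) * vertCoeff γ i k m z)) (frameH γ l z) z := by
  have hb := h.hasDirDerivAt_frameH_inv_alpha hz l
  have hp := h.hasDirDerivAt_frameH_covecUp hz l
  have hc := hasDirDerivAt_frameH_covec (γ := γ) (z := z) l m
  refine ((((hb.mul (((hp i).mul (HasDirDerivAt.const (if m = j then 1 else 0) _ z)).add
    ((hp j).mul (HasDirDerivAt.const (if m = i then 1 else 0) _ z)))).neg).add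
    ((hb.add (hb.mul hb)).mul ((h.hasDirDerivAt_frameH_inv hz l i j).mul hc))).add
    ((hb.mul hb).mul (((hp i).mul (hp j)).mul hc))).congr_deriv ?_
  have hs1 : ∑ k, christoffel γ l m k (basePt z) * vertCoeff γ i j k z =
      ∑ k, vertCoeff γ i j k z * christoffel γ l m k (basePt z) :=
    Finset.sum_congr rfl fun k _ => mul_comm _ _
  have hΓ : ∑ k, covec z k * christoffel γ m l k (basePt z) =
      ∑ k, covec z k * christoffel γ l m k (basePt z) :=
    Finset.sum_congr rfl fun k _ => by rw [h.metric.christoffel_symm hz]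
  have hs2 : ∀ i j, ∑ k, christoffel γ l k i (basePt z) * vertCoeff γ k j m z =
      -((alpha γ z)⁻¹ * ((∑ k, christoffel γ l k i (basePt z) * covecUp γ z k)
          * (if m = j then 1 else 0)
        + covecUp γ z j * christoffel γ l m i (basePt z)))
      + ((alpha γ z)⁻¹ + (alpha γ z)⁻¹ * (alpha γ z)⁻¹)
        * ((∑ k, christoffel γ l k i (basePt z) * (γ (basePt z))⁻¹ k j) * covec z m)
      + (alpha γ z)⁻¹ * (alpha γ z)⁻¹
        * ((∑ k, christoffel γ l k i (basePt z) * covecUp γ z k) * covecUp γ z j * covec z m) := by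
    intro i j
    have e : ∀ k, christoffel γ l k i (basePt z) * vertCoeff γ k j m z =
      -((alpha γ z)⁻¹ * ((christoffel γ l k i (basePt z) * covecUp γ z k)
          * (if m = j then 1 else 0)
        + covecUp γ z j * (christoffel γ l k i (basePt z) * (if m = k then 1 else 0))))
      + ((alpha γ z)⁻¹ + (alpha γ z)⁻¹ * (alpha γ z)⁻¹)
        * ((christoffel γ l k i (basePt z) * (γ (basePt z))⁻¹ k j) * covec z m)
      + (alpha γ z)⁻¹ * (alpha γ z)⁻¹
        * ((christoffel γ l k i (basePt z) * covecUp γ z k) * covecUp γ z j * covec z m) :=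
      fun k => by rw [vertCoeff]; ring
    simp only [e, Finset.sum_add_distrib, Finset.sum_neg_distrib, ← Finset.mul_sum,
      ← Finset.sum_mul]
    simp
  have hs3 : ∑ k, christoffel γ l k j (basePt z) * vertCoeff γ i k m z =
      ∑ k, christoffel γ l k j (basePt z) * vertCoeff γ k i m z :=
    Finset.sum_congr rfl fun k _ => by rw [h.vertCoeff_symm hz]
  rw [Finset.sum_sub_distrib, Finset.sum_sub_distrib, hs1, sum_vertCoeff_mul, hs3, hs2, hs2, hΓ]
  ring

theorem hasDirDerivAt_frameV_vertCoeff (l i j m : Fin n) : HasDirDerivAt (vertCoeff γ i j m)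
    (-((-(2 * covecUp γ z l * ((alpha γ z)⁻¹ * (alpha γ z)⁻¹)))
        * (covecUp γ z i * (if m = j then 1 else 0) + covecUp γ z j * (if m = i then 1 else 0))
      + (alpha γ z)⁻¹ * ((γ (basePt z))⁻¹ i l * (if m = j then 1 else 0)
        + (γ (basePt z))⁻¹ j l * (if m = i then 1 else 0)))
      + ((-(2 * covecUp γ z l * ((alpha γ z)⁻¹ * (alpha γ z)⁻¹))) * (1 + 2 * (alpha γ z)⁻¹)
        * ((γ (basePt z))⁻¹ i j * covec z m)
      + ((alpha γ z)⁻¹ + (alpha γ z)⁻¹ * (alpha γ z)⁻¹)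
        * ((γ (basePt z))⁻¹ i j * (if m = l then 1 else 0)))
      + ((-(2 * covecUp γ z l * ((alpha γ z)⁻¹ * (alpha γ z)⁻¹))) * (2 * (alpha γ z)⁻¹)
        * (covecUp γ z i * covecUp γ z j * covec z m)
      + (alpha γ z)⁻¹ * (alpha γ z)⁻¹
        * (((γ (basePt z))⁻¹ i l * covecUp γ z j + covecUp γ z i * (γ (basePt z))⁻¹ j l) * covec z m
          + covecUp γ z i * covecUp γ z j * (if m = l then 1 else 0)))) (frameV l z) z := by
  have hb := h.hasDirDerivAt_frameV_inv_alpha hz l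
  have hp := h.hasDirDerivAt_frameV_covecUp hz l
  have hc := hasDirDerivAt_frameV_covec (z := z) l m
  refine ((((hb.mul (((hp i).mul (HasDirDerivAt.const (if m = j then 1 else 0) _ z)).add
    ((hp j).mul (HasDirDerivAt.const (if m = i then 1 else 0) _ z)))).neg).add
    ((hb.add (hb.mul hb)).mul ((h.hasDirDerivAt_frameV_inv hz l i j).mul hc))).add
    ((hb.mul hb).mul (((hp i).mul (hp j)).mul hc))).congr_deriv ?_
  ring

theorem curvature_frame_eq {a b c : Fin n ⊕ Fin n} {d₁ d₂ : Fin n ⊕ Fin n → ℝ}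
    (h₁ : ∀ e, HasDirDerivAt (frameCoeff γ φ b c e) (d₁ e) (frame γ a z) z)
    (h₂ : ∀ e, HasDirDerivAt (frameCoeff γ φ a c e) (d₂ e) (frame γ b z) z) :
    curvature (cgMetric γ φ) (frame γ a) (frame γ b) (frame γ c) z = ∑ m, (d₁ m - d₂ m
      + ((∑ e, (frameCoeff γ φ b c e z * frameCoeff γ φ a e m z
        - frameCoeff γ φ a c e z * frameCoeff γ φ b e m z))
        - ∑ e, (frameCoeff γ φ a b e z - frameCoeff γ φ b a e z) * frameCoeff γ φ e c m z))
        • frame γ m z :=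
  curvature_frame (h.contDiffOn_frame_apply hz)
    ((h.isMetricOn_cgMetric.eventually_mem hz).mono fun _ hy => h.nabla_frame hy)
    (h.frameCoeff_torsion hz a b) h₁ h₂

theorem hasDirDerivAt_frameH_tensorA (l i j m : Fin n) :
    HasDirDerivAt (fun y => tensorA γ φ i j m (basePt y))
      (pd l (tensorA γ φ i j m) (basePt z)) (frameH γ l z) z :=
  hasDirDerivAt_frameH_base (h.differentiableAt_tensorA hz i j m) l

/-- The curvature on three horizontal vectors. -/
theorem curvature_frameH_frameH_frameH (l i j : Fin n) :
    curvature (cgMetric γ φ) (frameH γ l) (frameH γ i) (frameH γ j) z =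
      (∑ m, (riem γ l i j m (basePt z)
        - mixedCoeff γ φ z * (∑ k, curvP γ l i k z * curvUpP γ m j k z)
        + 1 / 2 * mixedCoeff γ φ z * (∑ k, (curvUpP γ m l k z * curvP γ i j k z
          - curvUpP γ m i k z * curvP γ l j k z))
        + nablaA γ φ l i j m (basePt z) - nablaA γ φ i l j m (basePt z)
        + ∑ k, (tensorA γ φ l k m (basePt z) * tensorA γ φ i j k (basePt z)
          - tensorA γ φ i k m (basePt z) * tensorA γ φ l j k (basePt z))) • frameH γ m z)
      + ∑ m, (1 / 2 * (∑ a, covec z a * (nablaRiem γ l i j m a (basePt z)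
          - nablaRiem γ i l j m a (basePt z)))
        + 1 / 2 * (∑ k, (curvP γ l k m z * tensorA γ φ i j k (basePt z)
          - curvP γ i k m z * tensorA γ φ l j k (basePt z)))) • frameV m z := by
  have hΓ := h.metric.christoffel_symm hz
  have hd : ∀ l i (e : Fin n ⊕ Fin n), HasDirDerivAt (frameCoeff γ φ (.inl i) (.inl j) e)
      (Sum.elim (fun m => pd l (christoffel γ i j m) (basePt z) + pd l (tensorA γ φ i j m) (basePt z))
        (fun m => 1 / 2 * ((∑ a, covec z a * nablaRiem γ l i j m a (basePt z))
          + ∑ k, (christoffel γ l i k (basePt z) * curvP γ k j m z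
            + christoffel γ l j k (basePt z) * curvP γ i k m z
            + christoffel γ l m k (basePt z) * curvP γ i j k z))) e)
      (frame γ (.inl l) z) z := by
    rintro l i (m | m)
    · exact (hasDirDerivAt_frameH_base (h.differentiableAt_christoffel hz i j m) l).add
        (h.hasDirDerivAt_frameH_tensorA hz l i j m)
    · exact (h.hasDirDerivAt_frameH_curvP hz l i j m).const_mul _
  refine (h.curvature_frame_eq hz (a := .inl l) (b := .inl i) (c := .inl j)
    (hd l i) (hd i l)).trans ?_
  rw [Fintype.sum_sum_type]
  congr 1
  · refine Finset.sum_congr rfl fun m _ => ?_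
    congr 1
    simp only [Fintype.sum_sum_type, frameCoeff, Sum.elim_inl, h.tensorA_symm hz l i, hΓ l i,
      sub_self, zero_mul, Finset.sum_const_zero, zero_add, curvP_antisymm i l]
    rw [h.metric.riem_eq hz, nablaA_eq, nablaA_eq]
    -- In the product (Γ + A)(Γ + A), the ΓΓ part completes R, the cross terms complete the partial
    -- derivatives of A to covariant ones, and AA survives.
    have e1 : ∑ e, ((christoffel γ i j e (basePt z) + tensorA γ φ i j e (basePt z))
          * (christoffel γ l e m (basePt z) + tensorA γ φ l e m (basePt z))
        - (christoffel γ l j e (basePt z) + tensorA γ φ l j e (basePt z))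
          * (christoffel γ i e m (basePt z) + tensorA γ φ i e m (basePt z))) =
      (∑ k, (christoffel γ i j k (basePt z) * christoffel γ l k m (basePt z)
        - christoffel γ l j k (basePt z) * christoffel γ i k m (basePt z)))
      + (∑ k, christoffel γ l k m (basePt z) * tensorA γ φ i j k (basePt z))
      - (∑ k, christoffel γ l j k (basePt z) * tensorA γ φ i k m (basePt z))
      - (∑ k, christoffel γ i k m (basePt z) * tensorA γ φ l j k (basePt z))
      + (∑ k, christoffel γ i j k (basePt z) * tensorA γ φ l k m (basePt z))
      + ∑ k, (tensorA γ φ l k m (basePt z) * tensorA γ φ i j k (basePt z)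
          - tensorA γ φ i k m (basePt z) * tensorA γ φ l j k (basePt z)) := by
      simp only [← Finset.sum_add_distrib, ← Finset.sum_sub_distrib]
      exact Finset.sum_congr rfl fun k _ => by ring
    have e2 : ∑ e, (1 / 2 * curvP γ i j e z * (mixedCoeff γ φ z * curvUpP γ m l e z)
        - 1 / 2 * curvP γ l j e z * (mixedCoeff γ φ z * curvUpP γ m i e z)) =
        1 / 2 * mixedCoeff γ φ z * (∑ k, (curvUpP γ m l k z * curvP γ i j k z
          - curvUpP γ m i k z * curvP γ l j k z)) := by
      rw [Finset.mul_sum]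
      exact Finset.sum_congr rfl fun k _ => by ring
    -- The contribution of the bracket [E_l, E_i], whose coefficient is the full p R.
    have e3 : ∑ e, (1 / 2 * curvP γ l i e z - 1 / 2 * -curvP γ l i e z)
        * (mixedCoeff γ φ z * curvUpP γ m j e z) =
        mixedCoeff γ φ z * (∑ k, curvP γ l i k z * curvUpP γ m j k z) := by
      rw [Finset.mul_sum]
      exact Finset.sum_congr rfl fun k _ => by ring
    simp only [hΓ l i]
    rw [e1, e2, e3]
    ring
  · refine Finset.sum_congr rfl fun m _ => ?_
    congr 1
    simp only [Fintype.sum_sum_type, frameCoeff, Sum.elim_inr, h.tensorA_symm hz l i, hΓ l i,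
      sub_self, zero_mul, mul_zero, Finset.sum_const_zero, zero_add, sub_zero]
    -- The products with Γ cancel the Christoffel terms left by differentiating p R. The terms in
    -- Γ_{il} occur in both derivatives and cancel each other.
    have e1 : (∑ e, ((christoffel γ i j e (basePt z) + tensorA γ φ i j e (basePt z))
          * (1 / 2 * curvP γ l e m z)
        - (christoffel γ l j e (basePt z) + tensorA γ φ l j e (basePt z))
          * (1 / 2 * curvP γ i e m z)))
        + ∑ e, (1 / 2 * curvP γ i j e z * -christoffel γ l m e (basePt z)
          - 1 / 2 * curvP γ l j e z * -christoffel γ i m e (basePt z)) =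
      1 / 2 * (∑ k, (christoffel γ i l k (basePt z) * curvP γ k j m z
            + christoffel γ i j k (basePt z) * curvP γ l k m z
            + christoffel γ i m k (basePt z) * curvP γ l j k z))
      - 1 / 2 * (∑ k, (christoffel γ i l k (basePt z) * curvP γ k j m z
            + christoffel γ l j k (basePt z) * curvP γ i k m z
            + christoffel γ l m k (basePt z) * curvP γ i j k z))
      + 1 / 2 * ∑ k, (curvP γ l k m z * tensorA γ φ i j k (basePt z)
          - curvP γ i k m z * tensorA γ φ l j k (basePt z)) := by
      simp only [Finset.mul_sum, ← Finset.sum_add_distrib, ← Finset.sum_sub_distrib]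
      exact Finset.sum_congr rfl fun k _ => by ring
    simp only [mul_sub, Finset.sum_sub_distrib]
    simp only [mul_sub, Finset.sum_sub_distrib] at e1
    rw [e1]
    ring

end IsRescaledMetricOn

end FrameCurvature

/-! ### The curvature with vertical arguments. -/

section VerticalCurvature

variable {n : ℕ} {γ : (Fin n → ℝ) → Matrix (Fin n) (Fin n) ℝ} {φ : (Fin n → ℝ) → ℝ}
  {U : Set (Fin n → ℝ)} {z : Fin n ⊕ Fin n → ℝ}

namespace IsRescaledMetricOn

variable (h : IsRescaledMetricOn γ φ U) (hz : z ∈ cotangentOver U)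
include h hz

theorem sum_curvP_mul_vertCoeff (i j l m : Fin n) :
    ∑ e, curvP γ i j e z * vertCoeff γ l e m z =
      -((alpha γ z)⁻¹ * (covecUp γ z l * curvP γ i j m z))
      + ((alpha γ z)⁻¹ + (alpha γ z)⁻¹ * (alpha γ z)⁻¹) * (covec z m * curvMidP γ i j l z) := by
  have e : ∀ e, curvP γ i j e z * vertCoeff γ l e m z =
      -((alpha γ z)⁻¹ * (covecUp γ z l * (curvP γ i j e z * (if m = e then 1 else 0))
        + (curvP γ i j e z * covecUp γ z e) * (if m = l then 1 else 0)))
      + ((alpha γ z)⁻¹ + (alpha γ z)⁻¹ * (alpha γ z)⁻¹)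
        * (covec z m * (curvP γ i j e z * (γ (basePt z))⁻¹ e l))
      + (alpha γ z)⁻¹ * (alpha γ z)⁻¹
        * (covecUp γ z l * covec z m * (curvP γ i j e z * covecUp γ z e)) := fun e => by
    rw [vertCoeff, h.metric.inv_symm hz l e]; ring
  simp only [e, Finset.sum_add_distrib, Finset.sum_neg_distrib, ← Finset.mul_sum, ← Finset.sum_mul,
    h.sum_curvP_mul_covecUp hz, h.sum_curvP_mul_inv hz]
  simp

theorem hasDirDerivAt_frameH_mixed (l k j i : Fin n) :
    HasDirDerivAt (fun y => mixedCoeff γ φ y * curvUpP γ k j i y)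
      (-(pd l φ (basePt z) / φ (basePt z)) * mixedCoeff γ φ z * curvUpP γ k j i z
        + mixedCoeff γ φ z * ((∑ a, covec z a * nablaRiemUpUp γ l k j i a (basePt z))
      + ∑ s, (christoffel γ l j s (basePt z) * curvUpP γ k s i z
        - christoffel γ l s k (basePt z) * curvUpP γ s j i z
        - christoffel γ l s i (basePt z) * curvUpP γ k j s z))) (frameH γ l z) z :=
  (h.hasDirDerivAt_frameH_mixedCoeff hz l).mul (h.hasDirDerivAt_frameH_curvUpP hz l k j i)

/-- The curvature on a vertical and two horizontal vectors. -/
theorem curvature_frameV_frameH_frameH (l i j : Fin n) :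
    curvature (cgMetric γ φ) (frameV l) (frameH γ i) (frameH γ j) z =
      (∑ m, (-mixedCoeff γ φ z * (∑ a, covec z a * nablaRiemUpUp γ i m j l a (basePt z))
        + mixedCoeff γ φ z * ((∑ k, (curvUpP γ m k l z * tensorA γ φ i j k (basePt z)
            - curvUpP γ k j l z * tensorA γ φ i k m (basePt z)))
          + pd i φ (basePt z) / φ (basePt z) * curvUpP γ m j l z)) • frameH γ m z)
      + ∑ m, (1 / 2 * riem γ i j m l (basePt z)
        - 1 / 2 * mixedCoeff γ φ z * (∑ k, curvP γ i k m z * curvUpP γ k j l z)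
        - 1 / 2 * (alpha γ z)⁻¹ * (covecUp γ z l * curvP γ i j m z)
        + 1 / 2 * ((alpha γ z)⁻¹ + (alpha γ z)⁻¹ * (alpha γ z)⁻¹)
          * (covec z m * curvMidP γ i j l z)) • frameV m z := by
  have hd₁ : ∀ e : Fin n ⊕ Fin n, HasDirDerivAt (frameCoeff γ φ (.inl i) (.inl j) e)
      (Sum.elim 0 (fun m => 1 / 2 * riem γ i j m l (basePt z)) e) (frame γ (.inr l) z) z := by
    rintro (m | m)
    · exact ((hasDirDerivAt_frameV_base (h.differentiableAt_christoffel hz i j m) l).add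
        (hasDirDerivAt_frameV_base (h.differentiableAt_tensorA hz i j m) l)).congr_deriv (by simp)
    · exact (h.hasDirDerivAt_frameV_curvP hz l i j m).const_mul _
  have hd₂ : ∀ e : Fin n ⊕ Fin n, HasDirDerivAt (frameCoeff γ φ (.inr l) (.inl j) e)
      (Sum.elim (fun m => -(pd i φ (basePt z) / φ (basePt z)) * mixedCoeff γ φ z * curvUpP γ m j l z
        + mixedCoeff γ φ z * ((∑ a, covec z a * nablaRiemUpUp γ i m j l a (basePt z))
      + ∑ s, (christoffel γ i j s (basePt z) * curvUpP γ m s l z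
        - christoffel γ i s m (basePt z) * curvUpP γ s j l z
        - christoffel γ i s l (basePt z) * curvUpP γ m j s z))) 0 e) (frame γ (.inl i) z) z := by
    rintro (m | m)
    · exact h.hasDirDerivAt_frameH_mixed hz i m j l
    · exact HasDirDerivAt.const _ _ _
  refine (h.curvature_frame_eq hz (a := .inr l) (b := .inl i) (c := .inl j) hd₁ hd₂).trans ?_
  rw [Fintype.sum_sum_type]
  congr 1
  · refine Finset.sum_congr rfl fun m _ => ?_
    congr 1
    simp only [Fintype.sum_sum_type, frameCoeff, Sum.elim_inl, Pi.zero_apply,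
      sub_self, zero_mul, mul_zero, Finset.sum_const_zero, zero_add, add_zero, zero_sub, neg_neg]
    -- The subtracted sum comes from the bracket [E_l̄, E_i] and supplies the Christoffel term for
    -- the raised index l of Q.
    have e1 : (∑ e, ((christoffel γ i j e (basePt z) + tensorA γ φ i j e (basePt z))
          * (mixedCoeff γ φ z * curvUpP γ m e l z)
        - mixedCoeff γ φ z * curvUpP γ e j l z
          * (christoffel γ i e m (basePt z) + tensorA γ φ i e m (basePt z))))
        - ∑ e, christoffel γ i e l (basePt z) * (mixedCoeff γ φ z * curvUpP γ m j e z) =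
        mixedCoeff γ φ z * (∑ s, (christoffel γ i j s (basePt z) * curvUpP γ m s l z
        - christoffel γ i s m (basePt z) * curvUpP γ s j l z
        - christoffel γ i s l (basePt z) * curvUpP γ m j s z))
        + mixedCoeff γ φ z * (∑ k, (curvUpP γ m k l z * tensorA γ φ i j k (basePt z)
            - curvUpP γ k j l z * tensorA γ φ i k m (basePt z))) := by
      simp only [Finset.mul_sum, ← Finset.sum_add_distrib, ← Finset.sum_sub_distrib]
      exact Finset.sum_congr rfl fun k _ => by ring
    rw [e1]
    ring
  · refine Finset.sum_congr rfl fun m _ => ?_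
    congr 1
    simp only [Fintype.sum_sum_type, frameCoeff, Sum.elim_inr, Pi.zero_apply,
      sub_self, zero_mul, mul_zero, Finset.sum_const_zero, add_zero, zero_sub, sub_zero]
    have e1 : ∑ e, -(mixedCoeff γ φ z * curvUpP γ e j l z * (1 / 2 * curvP γ i e m z)) =
        -(1 / 2 * mixedCoeff γ φ z * (∑ k, curvP γ i k m z * curvUpP γ k j l z)) := by
      rw [Finset.mul_sum, ← Finset.sum_neg_distrib]
      exact Finset.sum_congr rfl fun k _ => by ring
    have e2 : ∑ e, 1 / 2 * curvP γ i j e z * vertCoeff γ l e m z =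
        1 / 2 * ∑ e, curvP γ i j e z * vertCoeff γ l e m z := by
      rw [Finset.mul_sum]
      exact Finset.sum_congr rfl fun k _ => by ring
    rw [e1, e2, h.sum_curvP_mul_vertCoeff hz]
    ring

/-- The curvature on a vertical, a horizontal and a vertical vector. -/
theorem curvature_frameV_frameH_frameV (l i j : Fin n) :
    curvature (cgMetric γ φ) (frameV l) (frameH γ i) (frameV j) z =
      ∑ m, (mixedCoeff γ φ z * riemUpUp γ m i j l (basePt z)
        + mixedCoeff γ φ z * (alpha γ z)⁻¹
          * (covecUp γ z j * curvUpP γ m i l z - covecUp γ z l * curvUpP γ m i j z)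
        + mixedCoeff γ φ z * mixedCoeff γ φ z
          * ∑ k, curvUpP γ m k l z * curvUpP γ k i j z) • frameH γ m z := by
  have hd₁ : ∀ e : Fin n ⊕ Fin n, HasDirDerivAt (frameCoeff γ φ (.inl i) (.inr j) e)
      (Sum.elim (fun m => -(2 * covecUp γ z l / alpha γ z) * mixedCoeff γ φ z * curvUpP γ m i j z
        + mixedCoeff γ φ z * riemUpUp γ m i j l (basePt z)) 0 e) (frame γ (.inr l) z) z := by
    rintro (m | m)
    · exact (h.hasDirDerivAt_frameV_mixedCoeff hz l).mul (h.hasDirDerivAt_frameV_curvUpP hz l m i j)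
    · exact ((hasDirDerivAt_frameV_base (h.differentiableAt_christoffel hz i m j)
        l).neg).congr_deriv (by simp)
  have hd₂ : ∀ e : Fin n ⊕ Fin n, HasDirDerivAt (frameCoeff γ φ (.inr l) (.inr j) e)
      (Sum.elim 0 (fun m => ∑ k, (christoffel γ i m k (basePt z) * vertCoeff γ l j k z
      - christoffel γ i k l (basePt z) * vertCoeff γ k j m z
      - christoffel γ i k j (basePt z) * vertCoeff γ l k m z)) e) (frame γ (.inl i) z) z := by
    rintro (m | m)
    · exact HasDirDerivAt.const _ _ _
    · exact h.hasDirDerivAt_frameH_vertCoeff hz i l j m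
  refine (h.curvature_frame_eq hz (a := .inr l) (b := .inl i) (c := .inr j) hd₁ hd₂).trans ?_
  rw [Fintype.sum_sum_type]
  refine (congrArg₂ (· + ·) (Finset.sum_congr rfl fun m _ => congrArg₂ (· • ·) ?_ rfl)
    (Finset.sum_eq_zero fun m _ => ?_)).trans (add_zero _)
  · simp only [Fintype.sum_sum_type, frameCoeff, Sum.elim_inl, Pi.zero_apply,
      sub_self, zero_mul, mul_zero, Finset.sum_const_zero, add_zero, zero_sub, sub_zero]
    have e1 : ∑ e, mixedCoeff γ φ z * curvUpP γ e i j z * (mixedCoeff γ φ z * curvUpP γ m e l z) =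
        mixedCoeff γ φ z * mixedCoeff γ φ z * ∑ k, curvUpP γ m k l z * curvUpP γ k i j z := by
      rw [Finset.mul_sum]
      exact Finset.sum_congr rfl fun k _ => by ring
    have e2 : ∑ e, -(vertCoeff γ l j e z * (mixedCoeff γ φ z * curvUpP γ m i e z)) =
        -(mixedCoeff γ φ z * ∑ e, vertCoeff γ l j e z * curvUpP γ m i e z) := by
      rw [Finset.mul_sum, ← Finset.sum_neg_distrib]
      exact Finset.sum_congr rfl fun k _ => by ring
    -- Of the contraction with `vertCoeff` only the two Kronecker terms survive. Combined with the
    -- derivative of 1/α, they make the p^l and p^j terms skew in l and j.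
    rw [e1, e2, sum_vertCoeff_mul, h.sum_covec_mul_curvUpP hz]
    ring
  -- The vertical component vanishes because the Christoffel terms in the horizontal derivative of
  -- `vertCoeff` cancel those from the connection and the bracket.
  · rw [← zero_smul ℝ (frame γ (.inr m) z)]
    congr 1
    simp only [Fintype.sum_sum_type, frameCoeff, Sum.elim_inr, Pi.zero_apply,
      sub_self, zero_mul, mul_zero, Finset.sum_const_zero, zero_add, zero_sub]
    simp only [← Finset.sum_neg_distrib, ← Finset.sum_add_distrib, ← Finset.sum_sub_distrib]
    exact Finset.sum_eq_zero fun k _ => by ring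

/-- Every occurrence of p_e p^e becomes α - 1; the coefficients of p^l p_m then collapse to 1/α. -/
theorem sum_covec_mul_vertCoeff (l m : Fin n) : ∑ e, covec z e * vertCoeff γ l e m z =
    (alpha γ z)⁻¹ * (covecUp γ z l * covec z m)
      - (1 - (alpha γ z)⁻¹) * (if m = l then 1 else 0) := by
  have hα := (h.alpha_pos hz).ne'
  have e : ∀ e, covec z e * vertCoeff γ l e m z =
      -((alpha γ z)⁻¹ * (covecUp γ z l * (covec z e * (if m = e then 1 else 0))
        + (covec z e * covecUp γ z e) * (if m = l then 1 else 0)))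
      + ((alpha γ z)⁻¹ + (alpha γ z)⁻¹ * (alpha γ z)⁻¹)
        * (covec z m * (covec z e * (γ (basePt z))⁻¹ e l))
      + (alpha γ z)⁻¹ * (alpha γ z)⁻¹
        * (covecUp γ z l * covec z m * (covec z e * covecUp γ z e)) := fun e => by
    rw [vertCoeff, h.metric.inv_symm hz l e]; ring
  simp only [e, Finset.sum_add_distrib, Finset.sum_neg_distrib, ← Finset.mul_sum, ← Finset.sum_mul,
    sum_covec_mul_covecUp, h.sum_covec_inv hz]
  simp only [mul_ite, mul_one, mul_zero, Finset.sum_ite_eq, Finset.mem_univ, if_true]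
  split_ifs <;> field_simp <;> ring

/-- The curvature on three vertical vectors. -/
theorem curvature_frameV_frameV_frameV (l i j : Fin n) :
    curvature (cgMetric γ φ) (frameV l) (frameV i) (frameV j) z =
      ∑ m, ((alpha γ z ^ 2 + alpha γ z + 1) / alpha γ z ^ 3
          * ((γ (basePt z))⁻¹ i j * (if m = l then 1 else 0)
            - (γ (basePt z))⁻¹ j l * (if m = i then 1 else 0))
        + (alpha γ z + 2) / alpha γ z ^ 3
          * ((γ (basePt z))⁻¹ l j * covecUp γ z i * covec z m
            - (γ (basePt z))⁻¹ i j * covecUp γ z l * covec z m)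
        + (alpha γ z - 1) / alpha γ z ^ 3
          * ((if m = i then 1 else 0) * covecUp γ z l * covecUp γ z j
            - (if m = l then 1 else 0) * covecUp γ z i * covecUp γ z j)) • frameV m z := by
  have hα := (h.alpha_pos hz).ne'
  refine (h.curvature_frame_eq hz (a := .inr l) (b := .inr i) (c := .inr j)
    (d₁ := Sum.elim 0 _) (d₂ := Sum.elim 0 _)
    (Sum.rec (fun m => HasDirDerivAt.const _ _ _)
      (fun m => h.hasDirDerivAt_frameV_vertCoeff hz l i j m))
    (Sum.rec (fun m => HasDirDerivAt.const _ _ _)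
      (fun m => h.hasDirDerivAt_frameV_vertCoeff hz i l j m))).trans ?_
  -- Covariant derivatives of vertical frame fields along vertical ones are vertical and these
  -- fields commute, so only fibre coefficients contribute.
  rw [Fintype.sum_sum_type]
  refine (congrArg₂ (· + ·) (Finset.sum_eq_zero fun m _ => ?_)
    (Finset.sum_congr rfl fun m _ => congrArg₂ (· • ·) ?_ rfl)).trans (zero_add _)
  · rw [← zero_smul ℝ (frame γ (.inl m) z)]
    congr 1
    simp [Fintype.sum_sum_type, frameCoeff, h.vertCoeff_symm hz i l]
  · simp only [Fintype.sum_sum_type, frameCoeff, Sum.elim_inr, h.vertCoeff_symm hz i l,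
      sub_self, zero_mul, mul_zero, Finset.sum_const_zero, zero_add, add_zero, sub_zero,
      Finset.sum_sub_distrib]
    rw [sum_vertCoeff_mul, sum_vertCoeff_mul, h.sum_covec_mul_vertCoeff hz,
      h.sum_covec_mul_vertCoeff hz]
    simp only [vertCoeff, h.metric.inv_symm hz j, h.metric.inv_symm hz i l]
    field_simp
    ring

end IsRescaledMetricOn

end VerticalCurvature

/-! ### The eight formulas in expanded index form. -/

section Components

/-- The expanded formulas carry double contractions p_t p_a, the computed ones products of single
contractions. The primed version has t and a interchanged. -/
theorem sum_contract_mul_contract {κ ι : Type*} [Fintype κ] [Fintype ι] (p : ι → ℝ)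
    (X Y : κ → ι → ℝ) : ∑ t, ∑ a, ∑ k, p t * (p a * (X k t * Y k a)) =
      ∑ k, (∑ a, p a * X k a) * ∑ a, p a * Y k a := by
  simp only [Finset.sum_mul_sum]
  conv_rhs => rw [Finset.sum_comm]
  refine Finset.sum_congr rfl fun a _ => ?_
  rw [Finset.sum_comm]
  exact Finset.sum_congr rfl fun t _ => Finset.sum_congr rfl fun k _ => by ring

theorem sum_contract_mul_contract' {κ ι : Type*} [Fintype κ] [Fintype ι] (p : ι → ℝ)
    (X Y : κ → ι → ℝ) : ∑ t, ∑ a, ∑ k, p t * (p a * (X k a * Y k t)) =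
      ∑ k, (∑ a, p a * X k a) * ∑ a, p a * Y k a := by
  rw [← sum_contract_mul_contract, Finset.sum_comm]
  exact Finset.sum_congr rfl fun t _ => Finset.sum_congr rfl fun a _ =>
    Finset.sum_congr rfl fun k _ => by ring

theorem sum_contract_mul {κ ι : Type*} [Fintype κ] [Fintype ι] (p : ι → ℝ)
    (X : κ → ι → ℝ) (W : κ → ℝ) : ∑ a, ∑ k, p a * (X k a * W k) =
      ∑ k, (∑ a, p a * X k a) * W k := by
  simp only [Finset.sum_mul]
  rw [Finset.sum_comm]
  exact Finset.sum_congr rfl fun a _ => Finset.sum_congr rfl fun k _ => by ring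

theorem sum_contract_const_mul {ι : Type*} [Fintype ι] (p : ι → ℝ) (c : ℝ) (X : ι → ℝ) :
    ∑ a, p a * (c * X a) = c * ∑ a, p a * X a := by
  rw [Finset.mul_sum]
  exact Finset.sum_congr rfl fun a _ => by ring

variable {n : ℕ} {γ : (Fin n → ℝ) → Matrix (Fin n) (Fin n) ℝ} {φ : (Fin n → ℝ) → ℝ}
  {U : Set (Fin n → ℝ)} {z : Fin n ⊕ Fin n → ℝ}

namespace IsRescaledMetricOn

variable (h : IsRescaledMetricOn γ φ U) (hz : z ∈ cotangentOver U)
include h hz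

theorem curvature_HHH (l i j : Fin n) :
    curvature (cgMetric γ φ) (frameH γ l) (frameH γ i) (frameH γ j) z =
      (∑ m, (riem γ l i j m (basePt z)
          - 1 / (2 * φ (basePt z) * alpha γ z) * (∑ t, ∑ a, ∑ k, covec z t * covec z a
            * riem γ l i k a (basePt z) * riemUpUp γ m j k t (basePt z))
          + 1 / (4 * φ (basePt z) * alpha γ z) * (∑ t, ∑ a, ∑ k, covec z t * covec z a
            * (riemUpUp γ m l k t (basePt z) * riem γ i j k a (basePt z)
              - riemUpUp γ m i k t (basePt z) * riem γ l j k a (basePt z)))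
          + nablaA γ φ l i j m (basePt z) - nablaA γ φ i l j m (basePt z)
          + (∑ k, (tensorA γ φ l k m (basePt z) * tensorA γ φ i j k (basePt z)
            - tensorA γ φ i k m (basePt z) * tensorA γ φ l j k (basePt z)))) • frameH γ m z)
      + ∑ m, (1 / 2 * (∑ t, covec z t * (nablaRiem γ l i j m t (basePt z)
            - nablaRiem γ i l j m t (basePt z)))
          + 1 / 2 * (∑ t, ∑ k, covec z t
            * (riem γ l k m t (basePt z) * tensorA γ φ i j k (basePt z)
              - riem γ i k m t (basePt z) * tensorA γ φ l j k (basePt z)))) • frameV m z := by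
  refine (h.curvature_frameH_frameH_frameH hz l i j).trans (congrArg₂ (· + ·)
    (Finset.sum_congr rfl fun m _ => congrArg₂ (· • ·) ?_ rfl)
    (Finset.sum_congr rfl fun m _ => congrArg₂ (· • ·) ?_ rfl))
  · simp only [curvP, curvUpP, mixedCoeff, mul_assoc, mul_sub, Finset.sum_sub_distrib,
      sum_contract_mul_contract (covec z), sum_contract_mul_contract' (covec z)]
    ring
  · simp only [curvP, mul_sub, Finset.sum_sub_distrib, sum_contract_mul (covec z)]

theorem curvature_VHH (l i j : Fin n) :
    curvature (cgMetric γ φ) (frameV l) (frameH γ i) (frameH γ j) z =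
      (∑ m, (-1 / (2 * φ (basePt z) * alpha γ z)
            * (∑ a, covec z a * nablaRiemUpUp γ i m j l a (basePt z))
          + 1 / (2 * φ (basePt z) * alpha γ z) * ((∑ a, ∑ k, covec z a
              * (riemUpUp γ m k l a (basePt z) * tensorA γ φ i j k (basePt z)
                - riemUpUp γ k j l a (basePt z) * tensorA γ φ i k m (basePt z)))
            + ∑ a, covec z a * (pd i φ (basePt z) / φ (basePt z))
              * riemUpUp γ m j l a (basePt z))) • frameH γ m z)
      + ∑ m, (1 / 2 * riem γ i j m l (basePt z)
          - 1 / (4 * φ (basePt z) * alpha γ z) * (∑ t, ∑ a, ∑ k, covec z t * covec z a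
            * riem γ i k m t (basePt z) * riemUpUp γ k j l a (basePt z))
          - 1 / (2 * alpha γ z) * (∑ a, covec z a * covecUp γ z l * riem γ i j m a (basePt z))
          + (alpha γ z + 1) / (2 * alpha γ z ^ 2)
            * (∑ a, covec z a * covec z m * riemUp γ i j l a (basePt z))) • frameV m z := by
  have hα := (h.alpha_pos hz).ne'
  -- The coefficient of g⁻¹ in `vertCoeff`, halved by the factor in p R / 2.
  have e : (alpha γ z + 1) / (2 * alpha γ z ^ 2) =
      1 / 2 * ((alpha γ z)⁻¹ + (alpha γ z)⁻¹ * (alpha γ z)⁻¹) := by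
    field_simp
  refine (h.curvature_frameV_frameH_frameH hz l i j).trans (congrArg₂ (· + ·)
    (Finset.sum_congr rfl fun m _ => congrArg₂ (· • ·) ?_ rfl)
    (Finset.sum_congr rfl fun m _ => congrArg₂ (· • ·) ?_ rfl))
  all_goals
    simp only [curvP, curvUpP, curvMidP, mixedCoeff, e, mul_assoc, mul_sub, Finset.sum_sub_distrib,
      sum_contract_mul_contract (covec z), sum_contract_mul (covec z),
      sum_contract_const_mul (covec z)]
    ring

theorem curvature_HVH (l i j : Fin n) :
    curvature (cgMetric γ φ) (frameH γ l) (frameV i) (frameH γ j) z =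
      (∑ m, (1 / (2 * φ (basePt z) * alpha γ z)
            * (∑ a, covec z a * nablaRiemUpUp γ l m j i a (basePt z))
          + 1 / (2 * φ (basePt z) * alpha γ z) * ((∑ a, ∑ k, covec z a
              * (riemUpUp γ k j i a (basePt z) * tensorA γ φ l k m (basePt z)
                - riemUpUp γ m k i a (basePt z) * tensorA γ φ l j k (basePt z)))
            - ∑ a, covec z a * (pd l φ (basePt z) / φ (basePt z))
              * riemUpUp γ m j i a (basePt z))) • frameH γ m z)
      + ∑ m, (-1 / 2 * riem γ l j m i (basePt z)
          + 1 / (4 * φ (basePt z) * alpha γ z) * (∑ t, ∑ a, ∑ k, covec z t * covec z a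
            * riem γ l k m a (basePt z) * riemUpUp γ k j i t (basePt z))
          + 1 / (2 * alpha γ z) * (∑ a, covec z a * covecUp γ z i * riem γ l j m a (basePt z))
          - (alpha γ z + 1) / (2 * alpha γ z ^ 2)
            * (∑ a, covec z a * covec z m * riemUp γ l j i a (basePt z))) • frameV m z := by
  rw [curvature_antisymm, h.curvature_VHH hz, neg_add, ← Finset.sum_neg_distrib,
    ← Finset.sum_neg_distrib]
  simp only [← neg_smul]
  refine congrArg₂ (· + ·)
    (Finset.sum_congr rfl fun m _ => congrArg₂ (· • ·) ?_ rfl)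
    (Finset.sum_congr rfl fun m _ => congrArg₂ (· • ·) ?_ rfl)
  all_goals
    simp only [mul_assoc, mul_sub, Finset.sum_sub_distrib,
      sum_contract_mul_contract (covec z), sum_contract_mul_contract' (covec z)]
    ring

theorem curvature_VHV (l i j : Fin n) :
    curvature (cgMetric γ φ) (frameV l) (frameH γ i) (frameV j) z =
      ∑ m, (1 / (2 * φ (basePt z) * alpha γ z) * riemUpUp γ m i j l (basePt z)
          + 1 / (2 * φ (basePt z) * alpha γ z ^ 2) * (∑ a, covec z a
            * (covecUp γ z j * riemUpUp γ m i l a (basePt z)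
              - covecUp γ z l * riemUpUp γ m i j a (basePt z)))
          + 1 / (4 * φ (basePt z) ^ 2 * alpha γ z ^ 2) * (∑ a, ∑ t, ∑ k, covec z a * covec z t
              * riemUpUp γ m k l a (basePt z) * riemUpUp γ k i j t (basePt z))) • frameH γ m z := by
  refine (h.curvature_frameV_frameH_frameV hz l i j).trans
    (Finset.sum_congr rfl fun m _ => congrArg₂ (· • ·) ?_ rfl)
  simp only [curvUpP, mixedCoeff, mul_assoc, mul_sub, Finset.sum_sub_distrib,
    sum_contract_mul_contract (covec z), sum_contract_const_mul (covec z)]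
  ring

theorem curvature_HVV (l i j : Fin n) :
    curvature (cgMetric γ φ) (frameH γ l) (frameV i) (frameV j) z =
      ∑ m, (-1 / (2 * φ (basePt z) * alpha γ z) * riemUpUp γ m l j i (basePt z)
          + 1 / (2 * φ (basePt z) * alpha γ z ^ 2) * (∑ a, covec z a
            * (covecUp γ z i * riemUpUp γ m l j a (basePt z)
              - covecUp γ z j * riemUpUp γ m l i a (basePt z)))
          - 1 / (4 * φ (basePt z) ^ 2 * alpha γ z ^ 2) * (∑ a, ∑ t, ∑ k, covec z a * covec z t
              * riemUpUp γ m k i a (basePt z) * riemUpUp γ k l j t (basePt z))) • frameH γ m z := by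
  rw [curvature_antisymm, h.curvature_VHV hz, ← Finset.sum_neg_distrib]
  simp only [← neg_smul]
  refine Finset.sum_congr rfl fun m _ => congrArg₂ (· • ·) ?_ rfl
  simp only [mul_sub, Finset.sum_sub_distrib]
  ring

/-- The Bianchi identity solved for one term. When the third argument differs in type from the first
two, both terms on the right are already known. -/
theorem curvature_frame_cyclic (a b c : Fin n ⊕ Fin n) :
    curvature (cgMetric γ φ) (frame γ a) (frame γ b) (frame γ c) z =
      curvature (cgMetric γ φ) (frame γ c) (frame γ b) (frame γ a) z
      - curvature (cgMetric γ φ) (frame γ c) (frame γ a) (frame γ b) z := by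
  have e := h.isMetricOn_cgMetric.curvature_cyclic hz (h.contDiffOn_frame a) (h.contDiffOn_frame b)
    (h.contDiffOn_frame c)
  rw [curvature_antisymm _ (frame γ b) (frame γ c)] at e
  rw [← sub_eq_zero, ← e]
  abel

theorem curvature_VVH (l i j : Fin n) :
    curvature (cgMetric γ φ) (frameV l) (frameV i) (frameH γ j) z =
      ∑ m, (1 / (4 * φ (basePt z) ^ 2 * alpha γ z ^ 2) * (∑ t, ∑ a, ∑ k, covec z t * covec z a
              * (riemUpUp γ m k l a (basePt z) * riemUpUp γ k j i t (basePt z)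
                - riemUpUp γ m k i a (basePt z) * riemUpUp γ k j l t (basePt z)))
          + 1 / (φ (basePt z) * alpha γ z) * riemUpUp γ m j i l (basePt z)
          + 1 / (φ (basePt z) * alpha γ z ^ 2) * (∑ a, covec z a
            * (covecUp γ z i * riemUpUp γ m j l a (basePt z)
              - covecUp γ z l * riemUpUp γ m j i a (basePt z)))) • frameH γ m z := by
  have e := h.curvature_frame_cyclic hz (.inr l) (.inr i) (.inl j)
  simp only [frame, Sum.elim_inl, Sum.elim_inr] at e
  rw [e, h.curvature_HVV hz, h.curvature_HVV hz, ← Finset.sum_sub_distrib]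
  simp only [← sub_smul]
  refine Finset.sum_congr rfl fun m _ => congrArg₂ (· • ·) ?_ rfl
  -- The two terms linear in Q without p differ by a swap of the last two indices; skewness makes
  -- them add up, turning 1/(2fα) into 1/(fα).
  simp only [mul_assoc, mul_sub, Finset.sum_sub_distrib, sum_contract_mul_contract (covec z),
    sum_contract_mul_contract' (covec z), h.metric.riemUpUp_skew hz m j l i]
  ring

theorem curvature_HHV (l i j : Fin n) :
    curvature (cgMetric γ φ) (frameH γ l) (frameH γ i) (frameV j) z =
      (∑ m, (1 / (2 * φ (basePt z) * alpha γ z) * (∑ a, covec z a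
            * (nablaRiemUpUp γ l m i j a (basePt z) - nablaRiemUpUp γ i m l j a (basePt z)))
          + 1 / (2 * φ (basePt z) * alpha γ z) * ((∑ a, ∑ k, covec z a
              * (riemUpUp γ k i j a (basePt z) * tensorA γ φ l k m (basePt z)
                - riemUpUp γ k l j a (basePt z) * tensorA γ φ i k m (basePt z)))
            + ∑ a, covec z a
              * (-(pd l φ (basePt z) / φ (basePt z)) * riemUpUp γ m i j a (basePt z)
                + pd i φ (basePt z) / φ (basePt z) * riemUpUp γ m l j a (basePt z)))) • frameH γ m z)
      + ∑ m, (riem γ i l m j (basePt z)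
          + 1 / (4 * φ (basePt z) * alpha γ z) * (∑ t, ∑ a, ∑ k, covec z t * covec z a
            * (riem γ l k m t (basePt z) * riemUpUp γ k i j a (basePt z)
              - riem γ i k m a (basePt z) * riemUpUp γ k l j t (basePt z)))
          + 1 / alpha γ z * (∑ a, covec z a * covecUp γ z j * riem γ l i m a (basePt z))
          - (alpha γ z + 1) / alpha γ z ^ 2
            * (∑ a, covec z a * covec z m * riemUp γ l i j a (basePt z))) • frameV m z := by
  have e := h.curvature_frame_cyclic hz (.inl l) (.inl i) (.inr j)
  simp only [frame, Sum.elim_inl, Sum.elim_inr] at e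
  rw [e, h.curvature_VHH hz, h.curvature_VHH hz, add_sub_add_comm, ← Finset.sum_sub_distrib,
    ← Finset.sum_sub_distrib]
  simp only [← sub_smul]
  refine congrArg₂ (· + ·)
    (Finset.sum_congr rfl fun m _ => congrArg₂ (· • ·) ?_ rfl)
    (Finset.sum_congr rfl fun m _ => congrArg₂ (· • ·) ?_ rfl)
  -- The contractions of Q with A_{il} and A_{li} cancel by symmetry of A, so only those with the
  -- derivative direction on A remain.
  · simp only [mul_assoc, mul_sub, mul_add, Finset.sum_sub_distrib, Finset.sum_add_distrib,
      sum_contract_mul (covec z), sum_contract_const_mul (covec z), h.tensorA_symm hz l i]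
    ring
  · simp only [mul_assoc, mul_sub, mul_neg, Finset.sum_sub_distrib, Finset.sum_neg_distrib,
      sum_contract_mul_contract (covec z), sum_contract_mul_contract' (covec z),
      sum_contract_const_mul (covec z), riem_antisymm γ i l, riemUp_antisymm γ i l]
    ring

theorem curvature_VVV (l i j : Fin n) :
    curvature (cgMetric γ φ) (frameV l) (frameV i) (frameV j) z =
      ∑ m, ((alpha γ z ^ 2 + alpha γ z + 1) / alpha γ z ^ 3
          * ((γ (basePt z))⁻¹ i j * (if m = l then 1 else 0)
            - (γ (basePt z))⁻¹ j l * (if m = i then 1 else 0))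
        + (alpha γ z + 2) / alpha γ z ^ 3
          * ((γ (basePt z))⁻¹ l j * covecUp γ z i * covec z m
            - (γ (basePt z))⁻¹ i j * covecUp γ z l * covec z m)
        + (alpha γ z - 1) / alpha γ z ^ 3
          * ((if m = i then 1 else 0) * covecUp γ z l * covecUp γ z j
            - (if m = l then 1 else 0) * covecUp γ z i * covecUp γ z j)) • frameV m z :=
  h.curvature_frameV_frameV_frameV hz l i j

end IsRescaledMetricOn

end Components

theorem isRescaledMetricOn_chartImage {n : ℕ} {M : Type*} [TopologicalSpace M]
    [ChartedSpace (EuclideanSpace ℝ (Fin n)) M] [IsManifold (𝓡 n) ∞ M]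
    (g : Bundle.ContMDiffRiemannianMetric (𝓡 n) ∞ (EuclideanSpace ℝ (Fin n))
      (fun x : M => TangentSpace (𝓡 n) x))
    {f : M → ℝ} (hf : ContMDiff (𝓡 n) 𝓘(ℝ, ℝ) ∞ f) (hf_pos : ∀ x, 0 < f x)
    {e : OpenPartialHomeomorph M (EuclideanSpace ℝ (Fin n))}
    (he : e ∈ IsManifold.maximalAtlas (𝓡 n) ∞ M) :
    IsRescaledMetricOn (metricInChart g e) (funInChart f e) (chartImage e) where
  metric :=
    { isOpen := isOpen_chartImage e
      contDiffOn := contDiffOn_metricInChart g he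
      symm := fun _ _ _ _ => g.symm _ _ _
      isUnit := fun _ hy => (posDef_metricInChart g he hy).det_pos.ne'.isUnit }
  posDef := fun _ hx => posDef_metricInChart g he hx
  contDiffOn := contDiffOn_funInChart hf he
  pos := fun _ _ => hf_pos _

end CheegerGromoll

end

open CheegerGromoll in
theorem mainTheorem3 {n : ℕ} {M : Type*} [TopologicalSpace M]
    [ChartedSpace (EuclideanSpace ℝ (Fin n)) M] [IsManifold (𝓡 n) ∞ M]
    (g : Bundle.ContMDiffRiemannianMetric (𝓡 n) ∞ (EuclideanSpace ℝ (Fin n))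
      (fun x : M => TangentSpace (𝓡 n) x))
    (f : M → ℝ) (hf : ContMDiff (𝓡 n) 𝓘(ℝ, ℝ) ∞ f) (hf_pos : ∀ x, 0 < f x)
    (e : OpenPartialHomeomorph M (EuclideanSpace ℝ (Fin n)))
    (he : e ∈ IsManifold.maximalAtlas (𝓡 n) ∞ M)
    (P : CotangentBundle n M) (hP : P.proj ∈ e.source) (l i j : Fin n) :
    let γ : (Fin n → ℝ) → Matrix (Fin n) (Fin n) ℝ := metricInChart g e
    let φ : (Fin n → ℝ) → ℝ := funInChart f e
    let G : (Fin n ⊕ Fin n → ℝ) → Matrix (Fin n ⊕ Fin n) (Fin n ⊕ Fin n) ℝ := cgMetric γ φ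
    let z : Fin n ⊕ Fin n → ℝ := inducedCoord e P
    let x : Fin n → ℝ := basePt z
    let p : Fin n → ℝ := covec z
    let pu : Fin n → ℝ := covecUp γ z
    let α : ℝ := alpha γ z
    let c : ℝ := φ x
    let df : Fin n → ℝ := fun k => pd k φ x
    let g' : Fin n → Fin n → ℝ := fun a b => (γ x)⁻¹ a b
    let δ : Fin n → Fin n → ℝ := fun a b => if a = b then 1 else 0
    let R : Fin n → Fin n → Fin n → Fin n → ℝ := fun a b k s => riem γ a b k s x
    let S : Fin n → Fin n → Fin n → Fin n → ℝ := fun a b k s => riemUp γ a b k s x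
    let Q : Fin n → Fin n → Fin n → Fin n → ℝ := fun k a b s => riemUpUp γ k a b s x
    let A : Fin n → Fin n → Fin n → ℝ := fun a b h => tensorA γ φ a b h x
    let DR : Fin n → Fin n → Fin n → Fin n → Fin n → ℝ := fun k a b m t => nablaRiem γ k a b m t x
    let DQ : Fin n → Fin n → Fin n → Fin n → Fin n → ℝ :=
      fun k m a b s => nablaRiemUpUp γ k m a b s x
    let DA : Fin n → Fin n → Fin n → Fin n → ℝ := fun k a b m => nablaA γ φ k a b m x
    let E : Fin n → (Fin n ⊕ Fin n → ℝ) → (Fin n ⊕ Fin n → ℝ) := frameH γ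
    let V : Fin n → (Fin n ⊕ Fin n → ℝ) → (Fin n ⊕ Fin n → ℝ) := frameV
    (curvature G (E l) (E i) (E j) z =
      (∑ m, (R l i j m
          - 1 / (2 * c * α) * (∑ t, ∑ a, ∑ h, p t * p a * R l i h a * Q m j h t)
          + 1 / (4 * c * α) * (∑ t, ∑ a, ∑ h,
              p t * p a * (Q m l h t * R i j h a - Q m i h t * R l j h a))
          + DA l i j m - DA i l j m
          + (∑ h, (A l h m * A i j h - A i h m * A l j h))) • E m z)
      + ∑ m, (1 / 2 * (∑ t, p t * (DR l i j m t - DR i l j m t))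
          + 1 / 2 * (∑ t, ∑ h, p t * (R l h m t * A i j h - R i h m t * A l j h))) • V m z) ∧
    (curvature G (V l) (E i) (E j) z =
      (∑ m, (-1 / (2 * c * α) * (∑ a, p a * DQ i m j l a)
          + 1 / (2 * c * α) * ((∑ a, ∑ h, p a * (Q m h l a * A i j h - Q h j l a * A i h m))
            + ∑ a, p a * (df i / c) * Q m j l a)) • E m z)
      + ∑ m, (1 / 2 * R i j m l
          - 1 / (4 * c * α) * (∑ t, ∑ a, ∑ h, p t * p a * R i h m t * Q h j l a)
          - 1 / (2 * α) * (∑ a, p a * pu l * R i j m a)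
          + (α + 1) / (2 * α ^ 2) * (∑ a, p a * p m * S i j l a)) • V m z) ∧
    (curvature G (E l) (V i) (E j) z =
      (∑ m, (1 / (2 * c * α) * (∑ a, p a * DQ l m j i a)
          + 1 / (2 * c * α) * ((∑ a, ∑ h, p a * (Q h j i a * A l h m - Q m h i a * A l j h))
            - ∑ a, p a * (df l / c) * Q m j i a)) • E m z)
      + ∑ m, (-1 / 2 * R l j m i
          + 1 / (4 * c * α) * (∑ t, ∑ a, ∑ h, p t * p a * R l h m a * Q h j i t)
          + 1 / (2 * α) * (∑ a, p a * pu i * R l j m a)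
          - (α + 1) / (2 * α ^ 2) * (∑ a, p a * p m * S l j i a)) • V m z) ∧
    (curvature G (V l) (V i) (E j) z =
      ∑ m, (1 / (4 * c ^ 2 * α ^ 2) * (∑ t, ∑ a, ∑ h,
              p t * p a * (Q m h l a * Q h j i t - Q m h i a * Q h j l t))
          + 1 / (c * α) * Q m j i l
          + 1 / (c * α ^ 2) * (∑ a, p a * (pu i * Q m j l a - pu l * Q m j i a))) • E m z) ∧
    (curvature G (E l) (E i) (V j) z =
      (∑ m, (1 / (2 * c * α) * (∑ a, p a * (DQ l m i j a - DQ i m l j a))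
          + 1 / (2 * c * α) * ((∑ a, ∑ h, p a * (Q h i j a * A l h m - Q h l j a * A i h m))
            + ∑ a, p a * (-(df l / c) * Q m i j a + df i / c * Q m l j a))) • E m z)
      + ∑ m, (R i l m j
          + 1 / (4 * c * α) * (∑ t, ∑ a, ∑ h,
              p t * p a * (R l h m t * Q h i j a - R i h m a * Q h l j t))
          + 1 / α * (∑ a, p a * pu j * R l i m a)
          - (α + 1) / α ^ 2 * (∑ a, p a * p m * S l i j a)) • V m z) ∧
    (curvature G (V l) (E i) (V j) z =
      ∑ m, (1 / (2 * c * α) * Q m i j l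
          + 1 / (2 * c * α ^ 2) * (∑ a, p a * (pu j * Q m i l a - pu l * Q m i j a))
          + 1 / (4 * c ^ 2 * α ^ 2) * (∑ a, ∑ t, ∑ h,
              p a * p t * Q m h l a * Q h i j t)) • E m z) ∧
    (curvature G (E l) (V i) (V j) z =
      ∑ m, (-1 / (2 * c * α) * Q m l j i
          + 1 / (2 * c * α ^ 2) * (∑ a, p a * (pu i * Q m l j a - pu j * Q m l i a))
          - 1 / (4 * c ^ 2 * α ^ 2) * (∑ a, ∑ t, ∑ h,
              p a * p t * Q m h i a * Q h l j t)) • E m z) ∧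
    (curvature G (V l) (V i) (V j) z =
      ∑ m, ((α ^ 2 + α + 1) / α ^ 3 * (g' i j * δ m l - g' j l * δ m i)
          + (α + 2) / α ^ 3 * (g' l j * pu i * p m - g' i j * pu l * p m)
          + (α - 1) / α ^ 3 * (δ m i * pu l * pu j - δ m l * pu i * pu j)) • V m z) := by
  intro γ φ G z x p pu α c df g' δ R S Q A DR DQ DA E V
  have h : IsRescaledMetricOn (metricInChart g e) (funInChart f e) (chartImage e) :=
    isRescaledMetricOn_chartImage g hf hf_pos he
  have hz : inducedCoord e P ∈ cotangentOver (chartImage e) := e.map_source hP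
  exact ⟨h.curvature_HHH hz l i j, h.curvature_VHH hz l i j, h.curvature_HVH hz l i j,
    h.curvature_VVH hz l i j, h.curvature_HHV hz l i j, h.curvature_VHV hz l i j,
    h.curvature_HVV hz l i j, h.curvature_VVV hz l i j⟩
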